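/- \textbf{Model.} Prices live on the grid $\{1,\dots,N\}$. The state of the order book is $Q=(Q_1,\dots,Q_N)\in\mathbb Z^N$, where $|Q_l|$ is the number of (unit-size) limit orders at level $l$, bids being counted negatively and asks positively; $p_A=\inf\{l:Q_l>0\}\wedge(N+1)$ is the best ask, $p_B=\sup\{l:Q_l<0\}\vee 0$ the best bid and $S=p_A-p_B$ the spread. To every level $l$ a vector $X_l$ of factors, a function of the state of the book, is attached. $(Q(t))_{t\ge 0}$ is a non-explosive continuous-time Markov chain in which, with nonnegative intensities depending on the side of the book, on the number $k=|Q_l|$ of orders at level $l$ and on $X_l$: limit sell orders arrive at each level $l>p_B$ ($Q_l\mapsto Q_l+1$) and limit buy orders at each level $l<p_A$ ($Q_l\mapsto Q_l-1$) with intensities $\lambda_k(X_l)$; market orders remove one order at $p_A$ and at $p_B$ with intensities $\mu_k(X_l)$; and an order at a non-empty level is cancelled with intensity $\phi_k(X_l)$. Write $Q_A,Q_B$ for the numbers of orders at the best ask and best bid. For $i\in\{A,B\}$ let $j$ be the other side, and put $$\tau_A^{\rm quote}=\inf\{t: p_A(t)>p_A(0)\},\qquad \tau_A^{\rm other}=\inf\{t: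 p_A(t)<p_A(0)\text{ or }p_B(t)\ne p_B(0)\},$$ $$\tau_B^{\rm quote}=\inf\{t: p_B(t)<p_B(0)\},\qquad \tau_B^{\rm other}=\inf\{t: p_B(t)>p_B(0)\text{ or }p_A(t)\neq p_A(0)\}.$$ Fix $q_0^A,q_0^B\ge 1$ and $s_0\ge 1$ such that the event $\{Q_A(0)=q_0^A,\ Q_B(0)=q_0^B,\ S(0)=s_0\}$ has positive probability. Assume that, starting from this event, the factors $X_{p_B},X_{p_B+1},\dots,X_{p_A}$ have fixed values, which do not change as long as $p_A$ and $p_B$ do not move, and that the total arrival rate of limit orders inside the spread is the same for both sides: $$\Lambda_{s_0}:=\sum_{m=1}^{s_0-1}\lambda_0(X_{p_A-m})=\sum_{m=1}^{s_0-1}\lambda_0(X_{p_B+m}),$$ with the sell-side intensity in the first sum and the buy-side intensity in the second. For $i\in\{A,B\}$ let $\sigma_i\in[0,\infty]$ be the first-passage time to $0$ of the (non-explosive) birth--death process on $\{0,1,2,\dots\}$ started at $q_0^i$ with birth rates $\lambda_k(X_{p_i})$ and death rates $\mu_k(X_{p_i})+\phi_k(X_{p_i})$, the intensities being those of side $i$.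 Let $f_{\sigma_i}$ be its density on $(0,\infty)$ (a sub-probability density if $\mathbb P[\sigma_i=\infty]>0$) and $\hat f^{s_0}_{\sigma_i}(s)=\int_0^\infty e^{-st}f_{\sigma_i}(t)\,dt$. \textbf{Proposition.} The density $f_{\sigma_i}$ exists. If $\lambda_k(X_{p_i})>0$ for $k\ge 0$ and $\mu_k(X_{p_i})+\phi_k(X_{p_i})>0$ for $k\ge 1$, then for every $s\in\mathbb C$ at which the integral defining $\hat f^{s_0}_{\sigma_i}(s)$ converges absolutely, the following continued fractions converge and $$\hat f^{s_0}_{\sigma_i}(s)=\prod_{r=1}^{q_0^i}\left(-\frac1{\lambda_{r-1}(X_{p_i})}\ \mathop{\mathrm K}_{k=r}^{\infty}\frac{-\lambda_{k-1}(X_{p_i})\,(\mu_k(X_{p_i})+\phi_k(X_{p_i}))}{\lambda_k(X_{p_i})+\mu_k(X_{p_i})+\phi_k(X_{p_i})+s}\right).$$ The probability $$\mathbb P\bigl[\tau_i^{\rm quote}<\tau_i^{\rm other}\,\big|\,Q_A(0)=q_0^A,\,Q_B(0)=q_0^B,\,S(0)=s_0\bigr]$$ is the value at $0$ of the inverse Laplace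 transform of $$\hat G^{s_0}_{\sigma_i,\sigma_j}(s)=\frac1s\,\hat f^{s_0}_{\sigma_i}(s)\left(\hat f^{s_0}_{\sigma_j}(2\Lambda_{s_0}-s)+\frac{2\Lambda_{s_0}}{2\Lambda_{s_0}-s}\bigl(1-\hat f^{s_0}_{\sigma_j}(2\Lambda_{s_0}-s)\bigr)\right).$$ That is, it equals the absolutely convergent integral $\frac1{2\pi i}\int_{\gamma-i\infty}^{\gamma+i\infty}\hat G^{s_0}_{\sigma_i,\sigma_j}(s)\,ds$ for every $\gamma>0$ such that either $\gamma<2\Lambda_{s_0}$, or $\gamma>2\Lambda_{s_0}$, $\sigma_j<\infty$ almost surely and $\mathbb E[e^{(\gamma-2\Lambda_{s_0})\sigma_j}]<\infty$. In particular, when $s_0=1$, $$\hat G^{1}_{\sigma_i,\sigma_j}(s)=\frac1s\,\hat f^{1}_{\sigma_i}(s)\,\hat f^{1}_{\sigma_j}(-s).$$ -/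

import Mathlib

open MeasureTheory ProbabilityTheory Filter Topology
open scoped NNReal ENNReal

noncomputable section

namespace LimitOrderBook

/-! ### Continuous-time Markov chains on a countable state space -/

section MarkovChain

variable {E : Type*}

/-- Total exit rate `q(x) = ∑_y q(x, y)`. -/
def exitRate (rate : E → E → ℝ≥0) (x : E) : ℝ≥0 := ∑' y, rate x y

open Classical in
/-- Transition probabilities of the embedded jump chain; a state with exit rate `0` is absorbing. -/
def jumpProb (rate : E → E → ℝ≥0) (x y : E) : ℝ≥0 :=
  if exitRate rate x = 0 then (if y = x then 1 else 0) else rate x y / exitRate rate x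

/-- `Z` is a non-explosive continuous-time Markov chain with jump rates `rate x y` (`x ≠ y`):
there are a jump chain `Y` and holding times `H` (infinite in an absorbing state) such that `Y` is
a discrete Markov chain with transition probabilities `jumpProb rate`, the holding times are,
given `Y`, independent and exponential with parameters `exitRate rate (Y n)`, the jump times
`H 0 + ⋯ + H (n-1)` tend to infinity, and `Z` equals `Y n` between the `n`-th and the
`(n+1)`-st jump time. The initial law is arbitrary. -/
def IsMarkovJumpProcess {Ω : Type*} [MeasurableSpace Ω] (P : Measure Ω)
    (rate : E → E → ℝ≥0) (Z : ℝ≥0 → Ω → E) : Prop :=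
  ∃ (Y : ℕ → Ω → E) (H : ℕ → Ω → ℝ≥0∞),
    (∀ n y, MeasurableSet {ω | Y n ω = y}) ∧
    (∀ n, Measurable (H n)) ∧
    (∀ (n : ℕ) (y : ℕ → E) (t : ℕ → ℝ≥0),
      P {ω | (∀ k ≤ n, Y k ω = y k) ∧ ∀ k < n, (t k : ℝ≥0∞) < H k ω} =
        P {ω | Y 0 ω = y 0} *
          ∏ k ∈ Finset.range n, ((jumpProb rate (y k) (y (k + 1)) : ℝ≥0∞) *
            ENNReal.ofReal (Real.exp (-((exitRate rate (y k) : ℝ) * (t k : ℝ)))))) ∧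
    (∀ᵐ ω ∂P, ∑' n, H n ω = ⊤) ∧
    (∀ᵐ ω ∂P, ∀ (n : ℕ) (t : ℝ≥0), ∑ k ∈ Finset.range n, H k ω ≤ (t : ℝ≥0∞) →
      (t : ℝ≥0∞) < ∑ k ∈ Finset.range (n + 1), H k ω → Z t ω = Y n ω)

/-- `inf {t ≥ 0 : A t}` in `[0, ∞]`, with `inf ∅ = ∞`. -/
def firstTime (A : ℝ≥0 → Prop) : ℝ≥0∞ := ⨅ (t : ℝ≥0) (_ : A t), (t : ℝ≥0∞)

/-- Jump rates of a birth-death process on `{0, 1, 2, …}`; there are no deaths in state `0`. -/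
def birthDeathRate (birth death : ℕ → ℝ≥0) (m n : ℕ) : ℝ≥0 :=
  if n = m + 1 then birth m else if m = n + 1 then death m else 0

end MarkovChain

/-! ### Densities, Laplace transforms, continued fractions -/

/-- Law on the real line of a `[0, ∞]`-valued random time, on the event that it is finite (a
sub-probability measure when the time may be infinite). -/
def finiteLaw {Ω : Type*} [MeasurableSpace Ω] (P : Measure Ω) (σ : Ω → ℝ≥0∞) : Measure ℝ :=
  (P.restrict {ω | σ ω < ⊤}).map (fun ω => (σ ω).toReal)

/-- The Lebesgue density of `finiteLaw P σ`. -/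
def density {Ω : Type*} [MeasurableSpace Ω] (P : Measure Ω) (σ : Ω → ℝ≥0∞) (t : ℝ) : ℝ :=
  ((finiteLaw P σ).rnDeriv volume t).toReal

/-- One-sided Laplace transform `∫₀^∞ e^{-st} f(t) dt`. -/
def laplace (f : ℝ → ℝ) (s : ℂ) : ℂ :=
  ∫ t in Set.Ioi (0 : ℝ), Complex.exp (-s * (t : ℂ)) * (f t : ℂ)

/-- The integral defining `laplace f s` converges absolutely. -/
def LaplaceConverges (f : ℝ → ℝ) (s : ℂ) : Prop :=
  IntegrableOn (fun t : ℝ => Complex.exp (-s * (t : ℂ)) * (f t : ℂ)) (Set.Ioi 0)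

/-- The integrand `u ↦ e^{st} G(s)`, `s = γ + iu`, of the Bromwich integral. -/
def bromwichIntegrand (G : ℂ → ℂ) (γ t u : ℝ) : ℂ :=
  Complex.exp (((γ : ℂ) + (u : ℂ) * Complex.I) * (t : ℂ)) * G ((γ : ℂ) + (u : ℂ) * Complex.I)

/-- The inverse Laplace transform of `G` at `t` along the line `Re s = γ` is the value `v`: the
Bromwich integral `(2πi)⁻¹ ∫_{γ-i∞}^{γ+i∞} e^{st} G(s) ds` converges absolutely and equals `v`. -/
def HasInverseLaplaceAt (G : ℂ → ℂ) (γ t : ℝ) (v : ℂ) : Prop :=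
  Integrable (bromwichIntegrand G γ t) ∧
    (1 / (2 * Real.pi) : ℂ) * ∫ u : ℝ, bromwichIntegrand G γ t u = v

/-- The continued fraction `K_{k=j}^∞ a_k / b_k = a_j / (b_j + a_{j+1} / (b_{j+1} + ⋯))`
converges to `v`. -/
def HasContFractValue (a b : ℕ → ℂ) (j : ℕ) (v : ℂ) : Prop :=
  Tendsto (GenContFract.convs'
    { h := 0, s := Stream'.Seq.ofStream (fun n => ⟨a (j + n), b (j + n)⟩) }) atTop (𝓝 v)

/-! ### The order book -/

/-- The two sides of the book. -/
inductive Side : Type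
  | ask : Side
  | bid : Side

/-- The opposite side. -/
def Side.other : Side → Side
  | .ask => .bid
  | .bid => .ask

/-- A state of the book on the price grid `{1, …, N}`: signed queue sizes, with bids negative and
asks positive. -/
abbrev Book (N : ℕ) : Type := Finset.Icc 1 N → ℤ

namespace Book

variable {N : ℕ}

/-- Signed queue size at price level `l` (`0` off the grid). -/
def queue (b : Book N) (l : ℕ) : ℤ := if h : l ∈ Finset.Icc 1 N then b ⟨l, h⟩ else 0

/-- Best ask `inf {l : Q_l > 0} ∧ (N + 1)`. -/
def bestAsk (b : Book N) : ℕ := sInf ({l | 0 < b.queue l} ∪ {N + 1})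

/-- Best bid `sup {l : Q_l < 0} ∨ 0`. -/
def bestBid (b : Book N) : ℕ := sSup ({l | b.queue l < 0} ∪ {0})

/-- The best quote on a side. -/
def bestQuote (b : Book N) : Side → ℕ
  | .ask => b.bestAsk
  | .bid => b.bestBid

/-- Number of orders at price level `l`. -/
def size (b : Book N) (l : ℕ) : ℕ := (b.queue l).natAbs

/-- Bid-ask spread in ticks. -/
def spread (b : Book N) : ℤ := (b.bestAsk : ℤ) - (b.bestBid : ℤ)

end Book

/-- State-dependent order flow. Each level `l` carries a vector of stylized factors `X_l`, an
arbitrary function of the state of the book. `limitRate i k x`, `marketRate i k x` and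
`cancelRate i k x` are the intensities `λ_k(x)`, `μ_k(x)`, `φ_k(x)` at a level with `k` orders and
factors `x`, of limit orders joining side `i`, of market orders consuming side `i` and of
cancellations on side `i`. -/
structure OrderFlow (N : ℕ) (𝒳 : Type*) where
  /-- The factor vector `X_l`. -/
  factor : Book N → ℕ → 𝒳
  /-- `λ` -/
  limitRate : Side → ℕ → 𝒳 → ℝ≥0
  /-- `μ` -/
  marketRate : Side → ℕ → 𝒳 → ℝ≥0
  /-- `φ` -/
  cancelRate : Side → ℕ → 𝒳 → ℝ≥0

namespace OrderFlow

variable {N : ℕ} {𝒳 : Type*} (F : OrderFlow N 𝒳)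

/-- Rate of `Q_l ↦ Q_l + 1`: limit sell orders (at `l > p_B`), sell market orders (at `l = p_B`),
bid cancellations (at levels that hold bids). -/
def upRate (b : Book N) (l : ℕ) : ℝ≥0 :=
  (if b.bestBid < l then F.limitRate .ask (b.size l) (F.factor b l) else 0) +
  (if l = b.bestBid then F.marketRate .bid (b.size l) (F.factor b l) else 0) +
  (if b.queue l < 0 then F.cancelRate .bid (b.size l) (F.factor b l) else 0)

/-- Rate of `Q_l ↦ Q_l - 1`: limit buy orders (at `l < p_A`), buy market orders (at `l = p_A`),
ask cancellations (at levels that hold asks). -/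
def downRate (b : Book N) (l : ℕ) : ℝ≥0 :=
  (if l < b.bestAsk then F.limitRate .bid (b.size l) (F.factor b l) else 0) +
  (if l = b.bestAsk then F.marketRate .ask (b.size l) (F.factor b l) else 0) +
  (if 0 < b.queue l then F.cancelRate .ask (b.size l) (F.factor b l) else 0)

/-- Jump rates of the book. -/
def bookRate (b b' : Book N) : ℝ≥0 :=
  ∑ l : Finset.Icc 1 N,
    ((if b' = Function.update b l (b l + 1) then F.upRate b l else 0) +
     (if b' = Function.update b l (b l - 1) then F.downRate b l else 0))

/-- Jump rates of the queue at the best quote of side `i` when its factors are `x`: births at rate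
`λ_k(x)`, deaths at rate `μ_k(x) + φ_k(x)`. -/
def quoteRate (i : Side) (x : 𝒳) : ℕ → ℕ → ℝ≥0 :=
  birthDeathRate (fun k => F.limitRate i k x) (fun k => F.marketRate i k x + F.cancelRate i k x)

end OrderFlow

/-- First time the best quote of side `i` moves away from the opposite side: `p_A` up for
`i = A`, `p_B` down for `i = B`. -/
def quoteTime {N : ℕ} (i : Side) (Q : ℝ≥0 → Book N) : ℝ≥0∞ :=
  match i with
  | .ask => firstTime fun t => (Q 0).bestAsk < (Q t).bestAsk
  | .bid => firstTime fun t => (Q t).bestBid < (Q 0).bestBid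

/-- First time of any competing move of the best quotes. -/
def otherTime {N : ℕ} (i : Side) (Q : ℝ≥0 → Book N) : ℝ≥0∞ :=
  match i with
  | .ask => firstTime fun t => (Q t).bestAsk < (Q 0).bestAsk ∨ (Q t).bestBid ≠ (Q 0).bestBid
  | .bid => firstTime fun t => (Q 0).bestBid < (Q t).bestBid ∨ (Q t).bestAsk ≠ (Q 0).bestAsk

/-- `q i` orders at the best quote of each side `i`, and spread `s₀`. -/
def HasTop {N : ℕ} (q : Side → ℕ) (s₀ : ℕ) (b : Book N) : Prop :=
  (∀ i, b.size (b.bestQuote i) = q i) ∧ b.spread = (s₀ : ℤ)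

/-- The transform
`Ĝ(s) = s⁻¹ f̂ᵢ(s) (f̂ⱼ(2Λ - s) + 2Λ / (2Λ - s) * (1 - f̂ⱼ(2Λ - s)))`. -/
def quoteTransform (fi fj : ℂ → ℂ) (Λ : ℝ) (s : ℂ) : ℂ :=
  1 / s * fi s *
    (fj (2 * (Λ : ℂ) - s) + 2 * (Λ : ℂ) / (2 * (Λ : ℂ) - s) * (1 - fj (2 * (Λ : ℂ) - s)))

/-- Position of the best quote of side `i`, in ticks above the best bid, when the spread is `s₀`. -/
def quoteOffset (s₀ : ℕ) : Side → ℕ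
  | .ask => s₀
  | .bid => 0

end LimitOrderBook

end

noncomputable section

namespace LimitOrderBook

/-! ### Holding times -/

/-! As long as neither quote moves, the book matters only through the sizes of its two best queues.
These behave as independent birth-death processes, and any order placed inside the spread ends the
race at total rate `2Λ`. Orders beyond the quotes change nothing. So the conditional probability
should be that of `σ_i` falling before both `σ_j` and an exponential clock of rate `κ = 2Λ`, namely
`∫ e^{-κt} F(t) (κ (1 - G(t)) + g(t)) dt`, with `F`, `G` the distribution functions of `σ_i`, `σ_j`
and `g` the density of `σ_j`. This is `raceValue`.

No coupling of the book with independent queues is built. Summing over jump paths shows that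
first-passage distribution functions solve Kolmogorov's backward equation; in particular they have
densities, which are again differentiable. Integration by parts then gives the first-step equation
`raceValue_step`, so `raceValue` as a function of the two top queues (`topValue`) is harmonic for
the generator of the book (`topValue_harmonic`). To identify a harmonic function with an exit
probability, a discount `θ > 0` is added to the clock: non-explosion makes the discounted remainder
vanish (`tsum_discount_eq`), and then `θ → 0` (`measure_exit_eq`, `tendsto_raceValue`). The last
limit needs `e^{-κt} (1 - G(t)) → 0`, which is automatic for `Λ > 0` and follows from `σ_j < ∞` for
`Λ = 0`.

For the inversion formula, `f̂_i(s) / s` is the transform of `F`, of order `|s|⁻²` on vertical lines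
because the density has a bounded derivative. The bracket in `Ĝ` is the transform at `2Λ - s` of `2Λ
(1 - G) + g`. Fubini and Fourier inversion of `e^{-γv} F(v)` turn the Bromwich integral into
`raceValue` (`hasInverseLaplaceAt_quoteTransform`). To the right of `2Λ`, the exponential moment of
`σ_j` supplies the convergence.

For the continued fractions, `E[e^{-sσ}]` as a function of the starting state solves a three-term
recurrence. For real `s` it is a sum over paths, hence the minimal nonnegative solution, and the
truncated fractions increase to its successive ratios (`tendsto_approx`). For complex `s` the
fractions at `Re s` are majorants, which gives convergence; two solutions bounded by the path sum
agree because their difference is bounded by its tails (`exists_tendsto_approx`). -/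

/-- The measure `e^{-rh} dh` on `(0, ∞)`. -/
def expKernel (r : ℝ) : Measure ℝ :=
  (volume.restrict (Set.Ioi 0)).withDensity fun h => ENNReal.ofReal (Real.exp (-(r * h)))

instance (r : ℝ) : SFinite (expKernel r) := by unfold expKernel; infer_instance

lemma measurable_ofReal_exp_neg_mul (r : ℝ) :
    Measurable fun h : ℝ => ENNReal.ofReal (Real.exp (-(r * h))) := by fun_prop

lemma lintegral_expKernel (r : ℝ) {φ : ℝ → ℝ≥0∞} (hφ : Measurable φ) :
    ∫⁻ h, φ h ∂expKernel r =
      ∫⁻ h in Set.Ioi 0, ENNReal.ofReal (Real.exp (-(r * h))) * φ h := by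
  rw [expKernel, lintegral_withDensity_eq_lintegral_mul _ (by fun_prop) hφ]; rfl

/-- For `r ≤ 0` both sides are infinite, since `ENNReal.ofReal r = 0` has inverse `⊤`. Allowing
every real `r` later covers absorbing states and exponents `r + θ` of unknown sign. -/
lemma lintegral_exp_neg_mul_Ioi (r : ℝ) (t : ℝ) :
    ∫⁻ h in Set.Ioi t, ENNReal.ofReal (Real.exp (-(r * h))) =
      ENNReal.ofReal (Real.exp (-(r * t))) * (ENNReal.ofReal r)⁻¹ := by
  rcases lt_or_ge 0 r with hr | hr
  · have hint : IntegrableOn (fun h : ℝ => Real.exp (-(r * h))) (Set.Ioi t) := by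
      simpa only [neg_mul] using integrableOn_exp_mul_Ioi (neg_lt_zero.2 hr) t
    rw [← ofReal_integral_eq_lintegral_ofReal hint
      (Eventually.of_forall fun h => (Real.exp_pos _).le)]
    have h1 : ∫ h in Set.Ioi t, Real.exp (-(r * h)) = Real.exp (-(r * t)) * r⁻¹ := by
      have := integral_exp_mul_Ioi (neg_lt_zero.2 hr) t
      simp only [neg_mul] at this
      rw [this]; field_simp
    rw [h1, ENNReal.ofReal_mul (Real.exp_pos _).le, ENNReal.ofReal_inv_of_pos hr]
  · rw [ENNReal.ofReal_of_nonpos hr, ENNReal.inv_zero,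
      ENNReal.mul_top (by simpa using Real.exp_pos _), eq_top_iff]
    calc (⊤ : ℝ≥0∞) = ENNReal.ofReal (Real.exp (-(r * t))) * volume (Set.Ioi t) := by
          rw [Real.volume_Ioi, ENNReal.mul_top (by simpa using Real.exp_pos _)]
      _ = ∫⁻ h in Set.Ioi t, ENNReal.ofReal (Real.exp (-(r * t))) := by simp
      _ ≤ _ := by
          refine setLIntegral_mono (by fun_prop) fun h hh => ?_
          have : t < h := hh
          exact ENNReal.ofReal_le_ofReal (Real.exp_le_exp.2 (by nlinarith))

lemma expKernel_univ (r : ℝ) : expKernel r Set.univ = (ENNReal.ofReal r)⁻¹ := by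
  have := lintegral_expKernel r (φ := fun _ => 1) measurable_const
  simp only [lintegral_const, one_mul, mul_one] at this
  rw [this, lintegral_exp_neg_mul_Ioi]; simp

/-- The exponential law on `[0, ∞]` with parameter `r ≥ 0`; it is concentrated at `∞` if `r = 0`. -/
def holdingLaw (r : ℝ≥0) : Measure ℝ≥0∞ :=
  (r : ℝ≥0∞) • (expKernel r).map ENNReal.ofReal +
    if r = 0 then Measure.dirac ⊤ else 0

lemma holdingLaw_Ioi (r t : ℝ≥0) :
    holdingLaw r (Set.Ioi (t : ℝ≥0∞)) = ENNReal.ofReal (Real.exp (-((r : ℝ) * (t : ℝ)))) := by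
  rcases eq_or_ne r 0 with rfl | hr
  · simp [holdingLaw]
  · have hpre : ENNReal.ofReal ⁻¹' Set.Ioi (t : ℝ≥0∞) = Set.Ioi (t : ℝ) := by
      ext x
      simp only [Set.mem_preimage, Set.mem_Ioi]
      rw [← ENNReal.ofReal_coe_nnreal, ENNReal.ofReal_lt_ofReal_iff']
      exact ⟨fun h => h.1, fun h => ⟨h, t.2.trans_lt h⟩⟩
    have hpos : (0 : ℝ) < r := by positivity
    simp only [holdingLaw, hr, if_false, add_zero, Measure.smul_apply, smul_eq_mul]
    rw [Measure.map_apply ENNReal.measurable_ofReal measurableSet_Ioi, hpre, expKernel,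
      withDensity_apply _ measurableSet_Ioi, Measure.restrict_restrict measurableSet_Ioi,
      Set.Ioi_inter_Ioi, max_eq_left t.coe_nonneg, lintegral_exp_neg_mul_Ioi, ENNReal.ofReal_coe_nnreal,
      mul_left_comm, ENNReal.mul_inv_cancel (by simpa using hr) ENNReal.coe_ne_top, mul_one]

lemma holdingLaw_univ (r : ℝ≥0) : holdingLaw r Set.univ = 1 := by
  have h0 : holdingLaw r {0} = 0 := by
    simp only [holdingLaw, Measure.add_apply, Measure.smul_apply, smul_eq_mul]
    rw [Measure.map_apply ENNReal.measurable_ofReal (measurableSet_singleton _), expKernel,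
      withDensity_apply _ (ENNReal.measurable_ofReal (measurableSet_singleton _)),
      Measure.restrict_restrict (ENNReal.measurable_ofReal (measurableSet_singleton _))]
    have : ENNReal.ofReal ⁻¹' {0} ∩ Set.Ioi 0 = ∅ := by
      ext x; simp
    rw [this]
    split_ifs <;> simp
  have h1 : (Set.univ : Set ℝ≥0∞) = {0} ∪ Set.Ioi ((0 : ℝ≥0) : ℝ≥0∞) := by
    ext x; simp
  have h2 := holdingLaw_Ioi r 0
  simp only [NNReal.coe_zero, mul_zero, neg_zero, Real.exp_zero, ENNReal.ofReal_one] at h2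
  rw [h1, measure_union (by simp) measurableSet_Ioi, h0, h2, zero_add]

instance (r : ℝ≥0) : IsProbabilityMeasure (holdingLaw r) := ⟨holdingLaw_univ r⟩

/-- Extension of a function on the line to `[0, ∞]` by the value `0` at `∞`. -/
def vanishTop (ψ : ℝ → ℝ≥0∞) (t : ℝ≥0∞) : ℝ≥0∞ := if t = ⊤ then 0 else ψ t.toReal

lemma measurable_vanishTop {ψ : ℝ → ℝ≥0∞} (hψ : Measurable ψ) : Measurable (vanishTop ψ) :=
  Measurable.ite (measurableSet_singleton _) measurable_const (hψ.comp ENNReal.measurable_toReal)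

/-- The atom at `∞` of an absorbing state is invisible to `vanishTop`, so no case distinction on `r
= 0` survives. The factor `r` is kept outside in order to turn a jump probability into a rate. -/
lemma lintegral_holdingLaw_vanishTop (r : ℝ≥0) {ψ : ℝ → ℝ≥0∞} (hψ : Measurable ψ) (t : ℝ≥0∞) :
    ∫⁻ h, vanishTop ψ (t + h) ∂holdingLaw r =
      r * vanishTop (fun s => ∫⁻ h, ψ (s + h) ∂expKernel r) t := by
  rcases eq_or_ne t ⊤ with rfl | ht
  · simp [vanishTop]
  have hm : Measurable fun h => vanishTop ψ (t + h) :=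
    (measurable_vanishTop hψ).comp (measurable_const.add measurable_id)
  have htop : ∫⁻ h, vanishTop ψ (t + h) ∂(if r = 0 then Measure.dirac ⊤ else 0 : Measure ℝ≥0∞)
      = 0 := by
    split_ifs
    · rw [lintegral_dirac' _ hm]; simp [vanishTop]
    · simp
  rw [holdingLaw, lintegral_add_measure, htop, add_zero, lintegral_smul_measure,
    lintegral_map hm ENNReal.measurable_ofReal, smul_eq_mul]
  congr 1
  have e : vanishTop (fun s => ∫⁻ h, ψ (s + h) ∂expKernel r) t =
      ∫⁻ h, ψ (t.toReal + h) ∂expKernel r := by simp [vanishTop, ht]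
  rw [e, lintegral_expKernel _ (φ := fun a => vanishTop ψ (t + ENNReal.ofReal a))
    (hm.comp ENNReal.measurable_ofReal),
    lintegral_expKernel _ (by fun_prop)]
  refine setLIntegral_congr_fun measurableSet_Ioi fun h hh => ?_
  have hh : (0 : ℝ) < h := hh
  simp only [vanishTop, ENNReal.add_eq_top, ht, ENNReal.ofReal_ne_top, or_self, if_false]
  rw [ENNReal.toReal_add ht ENNReal.ofReal_ne_top, ENNReal.toReal_ofReal hh.le]

/-! ### Jump chain and holding times -/

section JumpChain

set_option linter.unusedSectionVars false

variable {E : Type*}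

/-- If the rates out of `y` are not summable, the exit rate is `0` by the convention for `tsum`, and
`y` counts as absorbing. -/
lemma tsum_jumpProb (rate : E → E → ℝ≥0) (y : E) :
    ∑' y', (jumpProb rate y y' : ℝ≥0∞) = 1 := by
  classical
  by_cases h : exitRate rate y = 0
  · have h1 : ∀ y', (jumpProb rate y y' : ℝ≥0∞) = if y' = y then 1 else 0 := by
      intro y'
      simp only [jumpProb, h, if_true]
      split_ifs <;> simp
    simp only [h1, tsum_ite_eq]
  · have hs : Summable (rate y) := by
      by_contra hs
      exact h (tsum_eq_zero_of_not_summable hs)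
    have h1 : ∀ y', (jumpProb rate y y' : ℝ≥0∞) = (rate y y' : ℝ≥0∞) * (exitRate rate y : ℝ≥0∞)⁻¹ := by
      intro y'
      simp only [jumpProb, h, if_false, div_eq_mul_inv, ENNReal.coe_mul]
      rw [ENNReal.coe_inv h]
    simp only [h1]
    rw [ENNReal.tsum_mul_right, ← ENNReal.coe_tsum hs]
    exact ENNReal.mul_inv_cancel (ENNReal.coe_ne_zero.2 h) ENNReal.coe_ne_top

lemma jumpProb_mul_exitRate {rate : E → E → ℝ≥0} {y : E} (hs : Summable (rate y)) (y' : E) :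
    (jumpProb rate y y' : ℝ≥0∞) * exitRate rate y = rate y y' := by
  classical
  by_cases h : exitRate rate y = 0
  · have : rate y y' = 0 := by
      have := (hs.tsum_eq_zero_iff).1 h
      exact this y'
    simp [h, this]
  · rw [← ENNReal.coe_mul]
    simp only [jumpProb, h, if_false]
    rw [div_mul_cancel₀ _ h]

variable {Ω : Type*} [MeasurableSpace Ω]

/-- The joint law of the jump chain `Y` and the holding times `H` of a jump process. -/
structure IsJumpSkeleton (P : Measure Ω) (rate : E → E → ℝ≥0) (Y : ℕ → Ω → E)
    (H : ℕ → Ω → ℝ≥0∞) : Prop where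
  measurableSet_state : ∀ n y, MeasurableSet {ω | Y n ω = y}
  measurable_holding : ∀ n, Measurable (H n)
  law : ∀ (n : ℕ) (y : ℕ → E) (t : ℕ → ℝ≥0),
      P {ω | (∀ k ≤ n, Y k ω = y k) ∧ ∀ k < n, (t k : ℝ≥0∞) < H k ω} =
        P {ω | Y 0 ω = y 0} *
          ∏ k ∈ Finset.range n, ((jumpProb rate (y k) (y (k + 1)) : ℝ≥0∞) *
            ENNReal.ofReal (Real.exp (-((exitRate rate (y k) : ℝ) * (t k : ℝ)))))

/-- The event that the jump chain follows `y` up to step `n`. -/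
def pathEvent (Y : ℕ → Ω → E) (n : ℕ) (y : ℕ → E) : Set Ω := {ω | ∀ k ≤ n, Y k ω = y k}

/-- Extension of a finite path to an infinite one. -/
def extendPath {n : ℕ} (y : Fin (n + 1) → E) (k : ℕ) : E := y ⟨min k n, by omega⟩

lemma mem_pathEvent_extendPath {Y : ℕ → Ω → E} {n : ℕ} {y : Fin (n + 1) → E} {ω : Ω} :
    ω ∈ pathEvent Y n (extendPath y) ↔ (fun k : Fin (n + 1) => Y k ω) = y := by
  constructor
  · intro h
    ext k
    have := h k (by omega)
    simpa [extendPath, Nat.min_eq_left (show (k : ℕ) ≤ n by omega)] using this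
  · rintro rfl k hk
    simp [extendPath, Nat.min_eq_left hk]

/-- Jump times. -/
def jumpTime (H : ℕ → Ω → ℝ≥0∞) (n : ℕ) (ω : Ω) : ℝ≥0∞ := ∑ k ∈ Finset.range n, H k ω

namespace IsJumpSkeleton

variable [Countable E] {P : Measure Ω} [IsProbabilityMeasure P] {rate : E → E → ℝ≥0}
  {Y : ℕ → Ω → E} {H : ℕ → Ω → ℝ≥0∞}

lemma measurableSet_of_state (h : IsJumpSkeleton P rate Y H) (n : ℕ) (A : E → Prop) :
    MeasurableSet {ω | A (Y n ω)} := by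
  have : {ω | A (Y n ω)} = ⋃ y ∈ {y | A y}, {ω | Y n ω = y} := by ext; simp
  rw [this]
  exact MeasurableSet.biUnion (Set.to_countable _) fun y _ => h.measurableSet_state n y

lemma measurableSet_pathEvent (h : IsJumpSkeleton P rate Y H) (n : ℕ) (y : ℕ → E) :
    MeasurableSet (pathEvent Y n y) := by
  have : pathEvent Y n y = ⋂ k, ⋂ (_ : k ≤ n), {ω | Y k ω = y k} := by ext; simp [pathEvent]
  rw [this]
  exact MeasurableSet.iInter fun k => MeasurableSet.iInter fun _ => h.measurableSet_state k _

lemma measurable_jumpTime (h : IsJumpSkeleton P rate Y H) (n : ℕ) : Measurable (jumpTime H n) :=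
  Finset.measurable_fun_sum _ fun k _ => h.measurable_holding k

/-- The prescribed law only mentions events `t k < H k`, so positivity has to be derived. Taking `t
= 0`, the extra requirement `0 < H n` on a path up to step `n` costs no probability: splitting over
the next state gives the same product times `∑ z, jumpProb (y n) z = 1`. -/
lemma ae_holding_pos (h : IsJumpSkeleton P rate Y H) : ∀ᵐ ω ∂P, ∀ n, 0 < H n ω := by
  have key : ∀ n, ∀ᵐ ω ∂P, ∀ k < n, 0 < H k ω := by
    intro n
    induction n with
    | zero => simp
    | succ n ih =>
      have hpath : ∀ y : Fin (n + 1) → E,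
          P (pathEvent Y n (extendPath y) ∩ {ω | ∀ k < n, 0 < H k ω} ∩ {ω | H n ω = 0}) = 0 := by
        intro y
        set y' := extendPath y
        have hA : MeasurableSet (pathEvent Y n y' ∩ {ω | ∀ k < n, 0 < H k ω}) := by
          refine (h.measurableSet_pathEvent n y').inter ?_
          have : {ω | ∀ k < n, 0 < H k ω} = ⋂ k, ⋂ (_ : k < n), {ω | 0 < H k ω} := by ext; simp
          rw [this]
          exact MeasurableSet.iInter fun k => MeasurableSet.iInter fun _ =>
            measurableSet_lt measurable_const (h.measurable_holding k)
        have hB : MeasurableSet {ω | 0 < H n ω} :=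
          measurableSet_lt measurable_const (h.measurable_holding n)
        have h1 : P (pathEvent Y n y' ∩ {ω | ∀ k < n, 0 < H k ω}) =
            P {ω | Y 0 ω = y' 0} *
              ∏ k ∈ Finset.range n, (jumpProb rate (y' k) (y' (k + 1)) : ℝ≥0∞) := by
          have := h.law n y' 0
          simp only [Pi.zero_apply, NNReal.coe_zero, mul_zero, neg_zero, Real.exp_zero,
            ENNReal.ofReal_one, mul_one, ENNReal.coe_zero] at this
          exact this
        have h2 : P (pathEvent Y n y' ∩ {ω | ∀ k < n, 0 < H k ω} ∩ {ω | 0 < H n ω}) =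
            P {ω | Y 0 ω = y' 0} *
              ∏ k ∈ Finset.range n, (jumpProb rate (y' k) (y' (k + 1)) : ℝ≥0∞) := by
          have hU : pathEvent Y n y' ∩ {ω | ∀ k < n, 0 < H k ω} ∩ {ω | 0 < H n ω} =
              ⋃ z, {ω | (∀ k ≤ n + 1, Y k ω = Function.update y' (n + 1) z k) ∧
                ∀ k < n + 1, ((0 : ℕ → ℝ≥0) k : ℝ≥0∞) < H k ω} := by
            ext ω
            simp only [pathEvent, Set.mem_inter_iff, Set.mem_ofPred_eq, Set.mem_iUnion,
              Pi.zero_apply, ENNReal.coe_zero]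
            constructor
            · rintro ⟨⟨a, b⟩, c⟩
              refine ⟨Y (n + 1) ω, fun k hk => ?_, fun k hk => ?_⟩
              · rcases Nat.le_succ_iff.1 hk with hk | rfl
                · rw [Function.update_of_ne (by omega), a k hk]
                · simp
              · rcases Nat.lt_succ_iff_lt_or_eq.1 hk with hk | rfl
                exacts [b k hk, c]
            · rintro ⟨z, a, b⟩
              refine ⟨⟨fun k hk => ?_, fun k hk => b k (by omega)⟩, b n (by omega)⟩
              rw [a k (by omega), Function.update_of_ne (by omega)]
          rw [hU, measure_iUnion]
          · have hz : ∀ z, P {ω | (∀ k ≤ n + 1, Y k ω = Function.update y' (n + 1) z k) ∧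
                ∀ k < n + 1, ((0 : ℕ → ℝ≥0) k : ℝ≥0∞) < H k ω} = P {ω | Y 0 ω = y' 0} *
              (∏ k ∈ Finset.range n, (jumpProb rate (y' k) (y' (k + 1)) : ℝ≥0∞)) *
                jumpProb rate (y' n) z := by
              intro z
              rw [h.law, Finset.prod_range_succ, mul_assoc]
              congr 1
              congr 1
              · refine Finset.prod_congr rfl fun k hk => ?_
                have := Finset.mem_range.1 hk
                rw [Function.update_of_ne (by omega), Function.update_of_ne (by omega)]
                simp
              · rw [Function.update_of_ne (by omega)]
                simp
            simp only [hz]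
            rw [ENNReal.tsum_mul_left, tsum_jumpProb, mul_one]
          · intro z z' hzz
            refine Set.disjoint_left.2 fun ω h1 h2 => hzz ?_
            have e1 := h1.1 (n + 1) le_rfl
            have e2 := h2.1 (n + 1) le_rfl
            simp only [Function.update_self] at e1 e2
            rw [← e1, e2]
          · intro z
            have : {ω | (∀ k ≤ n + 1, Y k ω = Function.update y' (n + 1) z k) ∧
                ∀ k < n + 1, ((0 : ℕ → ℝ≥0) k : ℝ≥0∞) < H k ω} =
                pathEvent Y (n + 1) (Function.update y' (n + 1) z) ∩
                  ⋂ k, ⋂ (_ : k < n + 1), {ω | ((0 : ℕ → ℝ≥0) k : ℝ≥0∞) < H k ω} := by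
              ext; simp [pathEvent]
            rw [this]
            exact (h.measurableSet_pathEvent _ _).inter (MeasurableSet.iInter fun k =>
              MeasurableSet.iInter fun _ =>
                measurableSet_lt measurable_const (h.measurable_holding k))
        have h3 : pathEvent Y n y' ∩ {ω | ∀ k < n, 0 < H k ω} ∩ {ω | H n ω = 0} =
            (pathEvent Y n y' ∩ {ω | ∀ k < n, 0 < H k ω}) \
            (pathEvent Y n y' ∩ {ω | ∀ k < n, 0 < H k ω} ∩ {ω | 0 < H n ω}) := by
          ext ω
          simp only [Set.mem_inter_iff, Set.mem_ofPred_eq, Set.mem_sdiff, pos_iff_ne_zero]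
          tauto
        rw [h3, measure_sdiff Set.inter_subset_left (hA.inter hB).nullMeasurableSet
          (measure_ne_top _ _), h1, h2, tsub_self]
      have hall : ∀ᵐ ω ∂P, ∀ y : Fin (n + 1) → E, ω ∉
          pathEvent Y n (extendPath y) ∩ {ω | ∀ k < n, 0 < H k ω} ∩ {ω | H n ω = 0} :=
        ae_all_iff.2 fun y => measure_eq_zero_iff_ae_notMem.1 (hpath y)
      filter_upwards [ih, hall] with ω h1 h2 k hk
      rcases Nat.lt_succ_iff_lt_or_eq.1 hk with hk | rfl
      · exact h1 k hk
      · by_contra h0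
        exact h2 (fun j => Y j ω) ⟨⟨mem_pathEvent_extendPath.2 rfl, h1⟩, by simpa using h0⟩
  filter_upwards [ae_all_iff.2 key] with ω h n using h (n + 1) n (by omega)

end IsJumpSkeleton
end JumpChain

/-! ### Independence of the holding times and the Markov property at jump times -/

section JumpChain
set_option linter.unusedSectionVars false
variable {E : Type*} {Ω : Type*} [MeasurableSpace Ω]
namespace IsJumpSkeleton

variable [Countable E] {P : Measure Ω} [IsProbabilityMeasure P] {rate : E → E → ℝ≥0}
  {Y : ℕ → Ω → E} {H : ℕ → Ω → ℝ≥0∞}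

/-- On a path event, the holding times are independent and exponential. -/
lemma map_holding_restrict (h : IsJumpSkeleton P rate Y H) (n : ℕ) (y : ℕ → E) :
    (P.restrict (pathEvent Y n y)).map (fun ω (k : Fin n) => H k ω) =
      (P {ω | Y 0 ω = y 0} *
        ∏ k ∈ Finset.range n, (jumpProb rate (y k) (y (k + 1)) : ℝ≥0∞)) •
        Measure.pi fun k : Fin n => holdingLaw (exitRate rate (y k)) := by
  -- The law is known on rays only. The whole space is added to the π-system as spanning set, since
  -- the rays `(t, ∞]` do not contain `0`.
  set C : Set (Set ℝ≥0∞) := insert Set.univ (Set.range fun t : ℝ≥0 => Set.Ioi (t : ℝ≥0∞))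
  have hgen : MeasurableSpace.generateFrom C = (inferInstance : MeasurableSpace ℝ≥0∞) := by
    rw [BorelSpace.measurable_eq (α := ℝ≥0∞)]
    refine le_antisymm ?_ ?_
    · refine MeasurableSpace.generateFrom_le ?_
      rintro _ (rfl | ⟨t, rfl⟩)
      · exact MeasurableSet.univ
      · rw [← BorelSpace.measurable_eq (α := ℝ≥0∞)]; exact measurableSet_Ioi
    · rw [borel_eq_generateFrom_Ioi]
      refine MeasurableSpace.generateFrom_le ?_
      rintro _ ⟨a, rfl⟩
      induction a with
      | top => simp
      | coe a => exact MeasurableSpace.measurableSet_generateFrom (Or.inr ⟨a, rfl⟩)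
  have hpi : IsPiSystem C := by
    rintro _ (rfl | ⟨a, rfl⟩) _ (rfl | ⟨b, rfl⟩) -
    · simp [C]
    · simp only [Set.univ_inter]; exact Or.inr ⟨b, rfl⟩
    · simp only [Set.inter_univ]; exact Or.inr ⟨a, rfl⟩
    · refine Or.inr ⟨max a b, ?_⟩
      simp [Set.Ioi_inter_Ioi]
  have hmeas : Measurable fun ω (k : Fin n) => H k ω :=
    measurable_pi_lambda _ fun k => h.measurable_holding k
  have hrect : ∀ s : Fin n → Set ℝ≥0∞, (∀ k, s k ∈ C) →
      (P.restrict (pathEvent Y n y)).map (fun ω (k : Fin n) => H k ω) (Set.univ.pi s) =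
      ((P {ω | Y 0 ω = y 0} *
        ∏ k ∈ Finset.range n, (jumpProb rate (y k) (y (k + 1)) : ℝ≥0∞)) •
        Measure.pi fun k : Fin n => holdingLaw (exitRate rate (y k))) (Set.univ.pi s) := by
    intro s hs
    have hsm : ∀ k, MeasurableSet (s k) := fun k => by
      rcases hs k with h | ⟨t, h⟩
      · rw [h]; exact MeasurableSet.univ
      · rw [← h]; exact measurableSet_Ioi
    -- The whole space is treated as the ray with `t = 0`; the two differ only at `0`, a value the
    -- holding times almost surely avoid.
    have hex : ∀ k : Fin n, ∃ t : ℝ≥0, holdingLaw (exitRate rate (y k)) (s k) =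
        ENNReal.ofReal (Real.exp (-((exitRate rate (y k) : ℝ) * (t : ℝ)))) ∧
        ∀ x, 0 < x → (x ∈ s k ↔ (t : ℝ≥0∞) < x) := by
      intro k
      rcases hs k with h | ⟨t, h⟩
      · exact ⟨0, by simp [h], fun x hx => by simp [h, hx]⟩
      · exact ⟨t, by rw [← h, holdingLaw_Ioi], fun x _ => by rw [← h]; rfl⟩
    choose t ht1 ht2 using hex
    have hlaw := h.law n y (fun k => if hk : k < n then t ⟨k, hk⟩ else 0)
    rw [Measure.map_apply hmeas (MeasurableSet.univ_pi hsm), Measure.restrict_apply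
      (hmeas (MeasurableSet.univ_pi hsm)), Measure.smul_apply, Measure.pi_pi, smul_eq_mul]
    have hset : P ((fun ω (k : Fin n) => H k ω) ⁻¹' Set.univ.pi s ∩ pathEvent Y n y) =
        P {ω | (∀ k ≤ n, Y k ω = y k) ∧
          ∀ k < n, ((if hk : k < n then t ⟨k, hk⟩ else 0 : ℝ≥0) : ℝ≥0∞) < H k ω} := by
      refine measure_congr ?_
      filter_upwards [h.ae_holding_pos] with ω hω
      refine propext ?_
      constructor
      · rintro ⟨h1, h2⟩
        refine ⟨h2, fun k hk => ?_⟩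
        simp only [hk, dif_pos]
        exact (ht2 ⟨k, hk⟩ _ (hω k)).1 (h1 ⟨k, hk⟩ trivial)
      · rintro ⟨h1, h2⟩
        refine ⟨fun k _ => ?_, h1⟩
        have := h2 k k.2
        simp only [k.2, dif_pos] at this
        exact (ht2 k _ (hω k)).2 this
    rw [hset, hlaw, Finset.prod_mul_distrib, mul_assoc]
    congr 2
    rw [Finset.prod_range]
    refine Finset.prod_congr rfl fun k _ => ?_
    rw [ht1]; simp
  refine ext_of_generate_finite (Set.univ.pi '' Set.univ.pi fun _ : Fin n => C)
    (generateFrom_eq_pi (fun _ => hgen) fun _ => ?_).symm (IsPiSystem.pi fun _ => hpi) ?_ ?_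
  · exact ⟨fun _ => Set.univ, fun _ => Or.inl rfl, Set.iUnion_const _⟩
  · rintro _ ⟨s, hs, rfl⟩
    exact hrect s fun k => hs k trivial
  · rw [← Set.pi_univ (Set.univ : Set (Fin n))]
    exact hrect _ fun k => Or.inl rfl

/-- Markov property at a jump time, along a path. -/
lemma setLIntegral_pathEvent_succ (h : IsJumpSkeleton P rate Y H) (n : ℕ) (y : ℕ → E)
    {φ : ℝ≥0∞ → ℝ≥0∞} (hφ : Measurable φ) :
    ∫⁻ ω in pathEvent Y (n + 1) y, φ (jumpTime H (n + 1) ω) ∂P =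
      jumpProb rate (y n) (y (n + 1)) * ∫⁻ ω in pathEvent Y n y,
        ∫⁻ x, φ (jumpTime H n ω + x) ∂holdingLaw (exitRate rate (y n)) ∂P := by
  have hlin : ∀ (m : ℕ) {ψ : ℝ≥0∞ → ℝ≥0∞}, Measurable ψ →
      ∫⁻ ω in pathEvent Y m y, ψ (jumpTime H m ω) ∂P =
        (P {ω | Y 0 ω = y 0} *
          ∏ k ∈ Finset.range m, (jumpProb rate (y k) (y (k + 1)) : ℝ≥0∞)) *
        ∫⁻ x, ψ (∑ k, x k) ∂Measure.pi fun k : Fin m => holdingLaw (exitRate rate (y k)) := by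
    intro m ψ hψ
    have hmeas : Measurable fun ω (k : Fin m) => H k ω :=
      measurable_pi_lambda _ fun k => h.measurable_holding k
    rw [← smul_eq_mul, ← lintegral_smul_measure, ← h.map_holding_restrict,
      lintegral_map (by fun_prop) hmeas]
    refine lintegral_congr fun ω => ?_
    rw [jumpTime, Finset.sum_range]
  have hm : Measurable fun s => ∫⁻ x, φ (s + x) ∂holdingLaw (exitRate rate (y n)) :=
    Measurable.lintegral_prod_right (by fun_prop)
  rw [hlin (n + 1) hφ, hlin n hm, Finset.prod_range_succ]
  -- Splitting off the last coordinate of the product law isolates the holding time of the current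
  -- state.
  have hmp := measurePreserving_piFinSuccAbove
    (fun k : Fin (n + 1) => holdingLaw (exitRate rate (y k))) (Fin.last n)
  have e1 : ∫⁻ x : Fin (n + 1) → ℝ≥0∞, φ (∑ k, x k)
      ∂Measure.pi (fun k : Fin (n + 1) => holdingLaw (exitRate rate (y k))) =
      ∫⁻ z : ℝ≥0∞ × (Fin n → ℝ≥0∞), φ (∑ k, z.2 k + z.1)
        ∂((holdingLaw (exitRate rate (y n))).prod
          (Measure.pi fun k : Fin n => holdingLaw (exitRate rate (y k)))) := by
    have hmap := hmp.map_eq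
    simp only [Fin.succAbove_last, Fin.val_last, Fin.val_castSucc] at hmap
    rw [← hmap, lintegral_map (by fun_prop) (MeasurableEquiv.measurable _)]
    refine lintegral_congr fun x => ?_
    rw [Fin.sum_univ_castSucc]
    simp [MeasurableEquiv.piFinSuccAbove, Fin.insertNthEquiv, Fin.init]
  rw [e1, lintegral_prod_symm _ (by fun_prop)]
  ring

/-- With countably many states there are countably many finite paths, so events about the first `n`
steps reduce to single paths, where the law is explicit. -/
lemma setLIntegral_of_path (h : IsJumpSkeleton P rate Y H) (n : ℕ) (c : (Fin (n + 1) → E) → Prop)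
    [DecidablePred c] (F : Ω → ℝ≥0∞) :
    ∫⁻ ω in {ω | c fun k : Fin (n + 1) => Y k ω}, F ω ∂P =
      ∑' y : Fin (n + 1) → E, if c y then ∫⁻ ω in pathEvent Y n (extendPath y), F ω ∂P else 0 := by
  have hset : {ω | c fun k : Fin (n + 1) => Y k ω} =
      ⋃ y : Fin (n + 1) → E, if c y then pathEvent Y n (extendPath y) else ∅ := by
    ext ω
    simp only [Set.mem_ofPred_eq, Set.mem_iUnion]
    constructor
    · intro hc
      exact ⟨_, by rw [if_pos hc]; exact mem_pathEvent_extendPath.2 rfl⟩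
    · rintro ⟨y, hy⟩
      split_ifs at hy with hc
      · rw [mem_pathEvent_extendPath.1 hy]; exact hc
      · exact hy.elim
  rw [hset, lintegral_iUnion]
  · refine tsum_congr fun y => ?_
    split_ifs <;> simp
  · intro y
    split_ifs
    exacts [h.measurableSet_pathEvent n _, MeasurableSet.empty]
  · intro y z hyz
    refine Set.disjoint_left.2 fun ω h1 h2 => hyz ?_
    simp only at h1 h2
    split_ifs at h1 h2
    · rw [← mem_pathEvent_extendPath.1 h1, ← mem_pathEvent_extendPath.1 h2]
    all_goals first | exact h1.elim | exact h2.elim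

end IsJumpSkeleton

open Classical in
/-- One step of the jump process stopped in `D`, acting on functions of the state and the time. -/
def stepOp (rate : E → E → ℝ≥0) (D : E → Prop) (g : E → ℝ → ℝ≥0∞) (y : E) (s : ℝ) : ℝ≥0∞ :=
  if D y then 0 else ∑' y', (rate y y' : ℝ≥0∞) * ∫⁻ h, g y' (s + h) ∂expKernel (exitRate rate y)

lemma measurable_stepOp [Countable E] {rate : E → E → ℝ≥0} {D : E → Prop} {g : E → ℝ → ℝ≥0∞}
    (hg : ∀ y, Measurable (g y)) (y : E) : Measurable (stepOp rate D g y) := by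
  unfold stepOp
  by_cases hD : D y
  · simp only [hD, if_true]; exact measurable_const
  · simp only [hD, if_false]
    refine Measurable.tsum fun y' => Measurable.const_mul ?_ _
    have := hg y'
    exact Measurable.lintegral_prod_right (f := fun s h => g y' (s + h)) (by fun_prop)

namespace IsJumpSkeleton

variable [Countable E] {P : Measure Ω} [IsProbabilityMeasure P] {rate : E → E → ℝ≥0}
  {Y : ℕ → Ω → E} {H : ℕ → Ω → ℝ≥0∞}

/-- After summing over the next state, the factor `exitRate` of the exponential density turns
`jumpProb` into `rate`. This is why `stepOp` pairs raw rates with the unnormalised kernel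
`expKernel`. -/
lemma setLIntegral_pathEvent_step (h : IsJumpSkeleton P rate Y H) (hs : ∀ y, Summable (rate y))
    {g : E → ℝ → ℝ≥0∞} (hg : ∀ y, Measurable (g y)) (n : ℕ) (y : ℕ → E) {D : E → Prop}
    (hD : ¬ D (y n)) :
    ∫⁻ ω in pathEvent Y n y, vanishTop (g (Y (n + 1) ω)) (jumpTime H (n + 1) ω) ∂P =
      ∫⁻ ω in pathEvent Y n y, vanishTop (stepOp rate D g (Y n ω)) (jumpTime H n ω) ∂P := by
  have hU : pathEvent Y n y = ⋃ z, pathEvent Y (n + 1) (Function.update y (n + 1) z) := by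
    ext ω
    simp only [pathEvent, Set.mem_iUnion, Set.mem_ofPred_eq]
    constructor
    · intro a
      refine ⟨Y (n + 1) ω, fun k hk => ?_⟩
      rcases Nat.le_succ_iff.1 hk with hk | rfl
      · rw [Function.update_of_ne (by omega), a k hk]
      · simp
    · rintro ⟨z, a⟩ k hk
      rw [a k (by omega), Function.update_of_ne (by omega)]
  have hz : ∀ z, ∫⁻ ω in pathEvent Y (n + 1) (Function.update y (n + 1) z),
      vanishTop (g (Y (n + 1) ω)) (jumpTime H (n + 1) ω) ∂P =
      ∫⁻ ω in pathEvent Y n y, (rate (y n) z : ℝ≥0∞) *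
        vanishTop (fun s => ∫⁻ h, g z (s + h) ∂expKernel (exitRate rate (y n)))
          (jumpTime H n ω) ∂P := by
    intro z
    have e1 : ∫⁻ ω in pathEvent Y (n + 1) (Function.update y (n + 1) z),
        vanishTop (g (Y (n + 1) ω)) (jumpTime H (n + 1) ω) ∂P =
        ∫⁻ ω in pathEvent Y (n + 1) (Function.update y (n + 1) z),
        vanishTop (g z) (jumpTime H (n + 1) ω) ∂P := by
      refine setLIntegral_congr_fun (h.measurableSet_pathEvent _ _) fun ω hω => ?_
      have := hω (n + 1) le_rfl
      simp only [Function.update_self] at this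
      rw [this]
    have e2 : pathEvent Y n (Function.update y (n + 1) z) = pathEvent Y n y := by
      ext ω
      refine forall₂_congr fun k hk => ?_
      rw [Function.update_of_ne (by omega)]
    have hm : Measurable (fun s => ∫⁻ h, g z (s + h) ∂expKernel (exitRate rate (y n))) := by
      have := hg z
      exact Measurable.lintegral_prod_right (f := fun s h => g z (s + h)) (by fun_prop)
    rw [e1, h.setLIntegral_pathEvent_succ n _ (measurable_vanishTop (hg z)), e2,
      Function.update_self, Function.update_of_ne (by omega)]
    simp only [lintegral_holdingLaw_vanishTop _ (hg z)]
    have hm' : Measurable fun ω => vanishTop (fun s => ∫⁻ h, g z (s + h)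
        ∂expKernel (exitRate rate (y n))) (jumpTime H n ω) :=
      (measurable_vanishTop hm).comp (h.measurable_jumpTime n)
    rw [lintegral_const_mul _ hm', lintegral_const_mul _ hm', ← mul_assoc, jumpProb_mul_exitRate (hs _)]
  calc ∫⁻ ω in pathEvent Y n y, vanishTop (g (Y (n + 1) ω)) (jumpTime H (n + 1) ω) ∂P
      = ∑' z, ∫⁻ ω in pathEvent Y (n + 1) (Function.update y (n + 1) z),
          vanishTop (g (Y (n + 1) ω)) (jumpTime H (n + 1) ω) ∂P := by
        rw [hU, lintegral_iUnion (fun z => h.measurableSet_pathEvent _ _)]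
        intro z z' hzz
        refine Set.disjoint_left.2 fun ω h1 h2 => hzz ?_
        have e1 := h1 (n + 1) le_rfl
        have e2 := h2 (n + 1) le_rfl
        simp only [Function.update_self] at e1 e2
        rw [← e1, e2]
    _ = ∫⁻ ω in pathEvent Y n y, ∑' z, (rate (y n) z : ℝ≥0∞) *
        vanishTop (fun s => ∫⁻ h, g z (s + h) ∂expKernel (exitRate rate (y n)))
          (jumpTime H n ω) ∂P := by
        rw [lintegral_tsum]
        · exact tsum_congr hz
        · intro z
          have hm : Measurable (fun s => ∫⁻ h, g z (s + h) ∂expKernel (exitRate rate (y n))) := by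
            have := hg z
            exact Measurable.lintegral_prod_right (f := fun s h => g z (s + h)) (by fun_prop)
          exact (((measurable_vanishTop hm).comp (h.measurable_jumpTime n)).const_mul
            _).aemeasurable
    _ = _ := by
        refine setLIntegral_congr_fun (h.measurableSet_pathEvent _ _) fun ω hω => ?_
        have := hω n le_rfl
        simp only [this, vanishTop, stepOp, hD, if_false]
        split_ifs <;> simp

/-- Markov property of the jump process stopped in `D`. -/
lemma setLIntegral_avoid_succ (h : IsJumpSkeleton P rate Y H) (hs : ∀ y, Summable (rate y))
    {g : E → ℝ → ℝ≥0∞} (hg : ∀ y, Measurable (g y)) (D : E → Prop) (b : E) (n : ℕ) :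
    ∫⁻ ω in {ω | Y 0 ω = b ∧ ∀ k < n + 1, ¬ D (Y k ω)},
        vanishTop (g (Y (n + 1) ω)) (jumpTime H (n + 1) ω) ∂P =
      ∫⁻ ω in {ω | Y 0 ω = b ∧ ∀ k < n, ¬ D (Y k ω)},
        vanishTop (stepOp rate D g (Y n ω)) (jumpTime H n ω) ∂P := by
  classical
  have e1 : {ω | Y 0 ω = b ∧ ∀ k < n + 1, ¬ D (Y k ω)} =
      {ω | (fun y : Fin (n + 1) → E => y 0 = b ∧ ∀ k, ¬ D (y k)) fun k => Y k ω} := by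
    ext ω
    exact and_congr_right fun _ => ⟨fun a k => a k k.2, fun a k hk => a ⟨k, hk⟩⟩
  have e2 : {ω | Y 0 ω = b ∧ ∀ k < n, ¬ D (Y k ω)} =
      {ω | (fun y : Fin (n + 1) → E => y 0 = b ∧ ∀ k : Fin n, ¬ D (y k.castSucc))
        fun k => Y k ω} := by
    ext ω
    exact and_congr_right fun _ => ⟨fun a k => a k k.2, fun a k hk => a ⟨k, hk⟩⟩
  rw [e1, e2, h.setLIntegral_of_path n (fun y => y 0 = b ∧ ∀ k, ¬ D (y k)),
    h.setLIntegral_of_path n (fun y => y 0 = b ∧ ∀ k : Fin n, ¬ D (y k.castSucc))]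
  refine tsum_congr fun y => ?_
  have hlast : extendPath y n = y (Fin.last n) := by simp [extendPath, Fin.last]
  -- A path ending in `D` contributes nothing to either side: it is excluded on the left, and
  -- `stepOp` vanishes on `D` on the right.
  by_cases hD : D (y (Fin.last n))
  · rw [if_neg (fun a => a.2 _ hD)]
    split_ifs
    · symm
      rw [setLIntegral_congr_fun (g := fun _ => 0) (h.measurableSet_pathEvent _ _), lintegral_zero]
      intro ω hω
      have := hω n le_rfl
      rw [hlast] at this
      simp [this, vanishTop, stepOp, hD]
    · rfl
  · have : (y 0 = b ∧ ∀ k, ¬ D (y k)) ↔ (y 0 = b ∧ ∀ k : Fin n, ¬ D (y k.castSucc)) := by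
      rw [Fin.forall_fin_succ']; tauto
    simp only [this]
    split_ifs
    · exact h.setLIntegral_pathEvent_step hs hg n _ (by rwa [hlast])
    · rfl

/-- Expectations at the `n`-th jump, before which the process has not visited `D`. -/
lemma setLIntegral_avoid (h : IsJumpSkeleton P rate Y H) (hs : ∀ y, Summable (rate y))
    (D : E → Prop) (b : E) (n : ℕ) {g : E → ℝ → ℝ≥0∞} (hg : ∀ y, Measurable (g y)) :
    ∫⁻ ω in {ω | Y 0 ω = b ∧ ∀ k < n, ¬ D (Y k ω)},
        vanishTop (g (Y n ω)) (jumpTime H n ω) ∂P =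
      P {ω | Y 0 ω = b} * ((stepOp rate D)^[n] g) b 0 := by
  induction n generalizing g with
  | zero =>
    simp only [not_lt_zero, false_imp_iff, implies_true, and_true, Function.iterate_zero, id]
    rw [setLIntegral_congr_fun (g := fun _ => g b 0) (h.measurableSet_state 0 b)]
    · simp [mul_comm]
    · intro ω hω
      have : Y 0 ω = b := hω
      simp [this, vanishTop, jumpTime]
  | succ n ih =>
    rw [h.setLIntegral_avoid_succ hs hg, ih (measurable_stepOp hg), Function.iterate_succ_apply]

end IsJumpSkeleton
end JumpChain

/-! ### First times of jump processes -/

section FirstTime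

variable {E : Type*}

/-- A path `z` which equals `y n` between the jump times `h 0 + ⋯ + h (n - 1)` and
`h 0 + ⋯ + h n`, without accumulation of jumps. -/
structure IsJumpPath (z : ℝ≥0 → E) (y : ℕ → E) (h : ℕ → ℝ≥0∞) : Prop where
  pos : ∀ n, 0 < h n
  tsum_eq_top : ∑' n, h n = ⊤
  eq_state : ∀ (n : ℕ) (t : ℝ≥0), ∑ k ∈ Finset.range n, h k ≤ (t : ℝ≥0∞) →
    (t : ℝ≥0∞) < ∑ k ∈ Finset.range (n + 1), h k → z t = y n

namespace IsJumpPath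

variable {z : ℝ≥0 → E} {y : ℕ → E} {h : ℕ → ℝ≥0∞}

lemma monotone_sum (h : ℕ → ℝ≥0∞) : Monotone fun n => ∑ k ∈ Finset.range n, h k :=
  fun _ _ hmn => Finset.sum_le_sum_of_subset (Finset.range_mono hmn)

lemma sum_lt_sum_succ (H : IsJumpPath z y h) {n : ℕ} (hn : ∑ k ∈ Finset.range n, h k ≠ ⊤) :
    ∑ k ∈ Finset.range n, h k < ∑ k ∈ Finset.range (n + 1), h k := by
  rw [Finset.sum_range_succ]
  exact ENNReal.lt_add_right hn (H.pos n).ne'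

/-- Absence of explosion is what places every finite time in some holding interval. -/
lemma exists_eq_state (H : IsJumpPath z y h) (t : ℝ≥0) :
    ∃ n, ∑ k ∈ Finset.range n, h k ≤ (t : ℝ≥0∞) ∧ z t = y n := by
  have hex : ∃ n, (t : ℝ≥0∞) < ∑ k ∈ Finset.range n, h k := by
    have := ENNReal.tendsto_nat_tsum h
    rw [H.tsum_eq_top] at this
    exact (this.eventually (lt_mem_nhds ENNReal.coe_lt_top)).exists
  classical
  have h1 := Nat.find_spec hex
  have h0 : Nat.find hex ≠ 0 := by
    intro h0
    rw [h0] at h1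
    simp at h1
  obtain ⟨n, hn⟩ := Nat.exists_eq_succ_of_ne_zero h0
  have h2 : ¬ (t : ℝ≥0∞) < ∑ k ∈ Finset.range n, h k := Nat.find_min hex (by omega)
  rw [hn] at h1
  exact ⟨n, not_lt.1 h2, H.eq_state n t (not_lt.1 h2) h1⟩

/-- Holding intervals are closed on the left, so a set of states is entered exactly at jump times.
Indices that follow an infinite holding time contribute `⊤` and are harmless. -/
lemma firstTime_eq (H : IsJumpPath z y h) (A : E → Prop) :
    firstTime (fun t => A (z t)) = ⨅ (n : ℕ) (_ : A (y n)), ∑ k ∈ Finset.range n, h k := by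
  refine le_antisymm ?_ ?_
  · refine le_iInf₂ fun n hn => ?_
    by_cases htop : ∑ k ∈ Finset.range n, h k = ⊤
    · rw [htop]; exact le_top
    have hz := H.eq_state n (∑ k ∈ Finset.range n, h k).toNNReal
      (by rw [ENNReal.coe_toNNReal htop])
      (by rw [ENNReal.coe_toNNReal htop]; exact H.sum_lt_sum_succ htop)
    calc firstTime (fun t => A (z t)) ≤ ((∑ k ∈ Finset.range n, h k).toNNReal : ℝ≥0∞) :=
          iInf₂_le _ (by rw [hz]; exact hn)
      _ = _ := ENNReal.coe_toNNReal htop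
  · refine le_iInf₂ fun t ht => ?_
    obtain ⟨n, h1, h2⟩ := H.exists_eq_state t
    exact (iInf₂_le n (by rwa [h2] at ht)).trans h1

lemma firstTime_eq_of_first (H : IsJumpPath z y h) {A : E → Prop} {n : ℕ} (hn : A (y n))
    (hlt : ∀ k < n, ¬ A (y k)) :
    firstTime (fun t => A (z t)) = ∑ k ∈ Finset.range n, h k := by
  rw [H.firstTime_eq]
  refine le_antisymm (iInf₂_le n hn) (le_iInf₂ fun m hm => monotone_sum h ?_)
  by_contra hmn
  exact hlt m (by omega) hm

lemma firstTime_eq_top_of_forall_not (H : IsJumpPath z y h) {A : E → Prop}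
    (hA : ∀ n, ¬ A (y n)) : firstTime (fun t => A (z t)) = ⊤ := by
  rw [H.firstTime_eq]
  simp [hA]

/-- Jump times increase strictly while finite, so comparing first times amounts to comparing first
indices. The finiteness condition discards states of the jump chain that the path never reaches. -/
lemma firstTime_lt_firstTime_iff (H : IsJumpPath z y h) (A B : E → Prop) :
    firstTime (fun t => A (z t)) < firstTime (fun t => B (z t)) ↔
      ∃ n, (∀ k < n, ¬ (A (y k) ∨ B (y k))) ∧ (A (y n) ∧ ¬ B (y n)) ∧
        ∑ k ∈ Finset.range n, h k ≠ ⊤ := by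
  classical
  constructor
  · intro hlt
    have hex : ∃ n, A (y n) := by
      by_contra hex
      push Not at hex
      rw [H.firstTime_eq_top_of_forall_not hex] at hlt
      exact not_top_lt hlt
    have hfirst := H.firstTime_eq_of_first (Nat.find_spec hex) fun k hk => Nat.find_min hex hk
    have hB : ∀ k ≤ Nat.find hex, ¬ B (y k) := by
      intro k hk hBk
      rw [hfirst, H.firstTime_eq B] at hlt
      exact absurd ((iInf₂_le k hBk).trans (monotone_sum h hk)) (not_le.2 hlt)
    refine ⟨Nat.find hex, fun k hk => ?_, ⟨Nat.find_spec hex, hB _ le_rfl⟩, ?_⟩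
    · rintro (h1 | h1)
      exacts [Nat.find_min hex hk h1, hB k hk.le h1]
    · rw [← hfirst]; exact (hlt.trans_le le_top).ne
  · rintro ⟨n, h1, ⟨h2, h3⟩, h4⟩
    rw [H.firstTime_eq_of_first h2 fun k hk h => h1 k hk (Or.inl h), H.firstTime_eq B]
    refine (H.sum_lt_sum_succ h4).trans_le (le_iInf₂ fun m hm => monotone_sum h ?_)
    by_contra hmn
    rcases Nat.lt_or_ge m n with hmn' | hmn'
    · exact h1 m hmn' (Or.inr hm)
    · have : m = n := by omega
      exact h3 (this ▸ hm)

lemma zero_eq (H : IsJumpPath z y h) : z 0 = y 0 := by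
  refine H.eq_state 0 0 (by simp) ?_
  simpa using H.pos 0

end IsJumpPath

variable {Ω : Type*} [MeasurableSpace Ω]

lemma IsMarkovJumpProcess.exists_skeleton [Countable E] {P : Measure Ω} [IsProbabilityMeasure P]
    {rate : E → E → ℝ≥0} {Z : ℝ≥0 → Ω → E} (hZ : IsMarkovJumpProcess P rate Z) :
    ∃ (Y : ℕ → Ω → E) (H : ℕ → Ω → ℝ≥0∞), IsJumpSkeleton P rate Y H ∧
      ∀ᵐ ω ∂P, IsJumpPath (fun t => Z t ω) (fun n => Y n ω) (fun n => H n ω) := by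
  obtain ⟨Y, H, h1, h2, h3, h4, h5⟩ := hZ
  have hs : IsJumpSkeleton P rate Y H := ⟨h1, h2, h3⟩
  refine ⟨Y, H, hs, ?_⟩
  filter_upwards [hs.ae_holding_pos, h4, h5] with ω a b c using ⟨a, b, c⟩

open Classical in
/-- The law of the first time in `D`, as a sum over the number of jumps before that time. -/
lemma IsJumpSkeleton.setLIntegral_firstTime [Countable E] {P : Measure Ω} [IsProbabilityMeasure P]
    {rate : E → E → ℝ≥0} {Z : ℝ≥0 → Ω → E} {Y : ℕ → Ω → E} {H : ℕ → Ω → ℝ≥0∞}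
    (h : IsJumpSkeleton P rate Y H) (hs : ∀ y, Summable (rate y))
    (hZ : ∀ᵐ ω ∂P, IsJumpPath (fun t => Z t ω) (fun n => Y n ω) (fun n => H n ω))
    (D : E → Prop) (b : E) {ψ : ℝ → ℝ≥0∞} (hψ : Measurable ψ) :
    ∫⁻ ω in {ω | Y 0 ω = b}, vanishTop ψ (firstTime fun t => D (Z t ω)) ∂P =
      P {ω | Y 0 ω = b} *
        ∑' n, ((stepOp rate D)^[n] fun y s => if D y then ψ s else 0) b 0 := by
  have hg : ∀ y, Measurable (fun s : ℝ => if D y then ψ s else 0) := fun y => by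
    split_ifs
    exacts [hψ, measurable_const]
  have hset : ∀ n, MeasurableSet {ω | Y 0 ω = b ∧ ∀ k < n, ¬ D (Y k ω)} := by
    intro n
    have : {ω | Y 0 ω = b ∧ ∀ k < n, ¬ D (Y k ω)} =
        {ω | Y 0 ω = b} ∩ ⋂ k, ⋂ (_ : k < n), {ω | ¬ D (Y k ω)} := by ext; simp
    rw [this]
    exact (h.measurableSet_state 0 b).inter (MeasurableSet.iInter fun k =>
      MeasurableSet.iInter fun _ => h.measurableSet_of_state k fun y => ¬ D y)
  have hF : ∀ n, Measurable fun ω =>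
      vanishTop (fun s : ℝ => if D (Y n ω) then ψ s else 0) (jumpTime H n ω) := by
    intro n
    have : (fun ω => vanishTop (fun s : ℝ => if D (Y n ω) then ψ s else 0) (jumpTime H n ω)) =
        Set.indicator {ω | D (Y n ω)} fun ω => vanishTop ψ (jumpTime H n ω) := by
      ext ω
      by_cases hD : D (Y n ω) <;> simp [Set.indicator, hD, vanishTop]
    rw [this]
    exact ((measurable_vanishTop hψ).comp (h.measurable_jumpTime n)).indicator
      (h.measurableSet_of_state n _)
  rw [← ENNReal.tsum_mul_left]
  simp only [← h.setLIntegral_avoid hs D b _ hg]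
  rw [← lintegral_indicator (h.measurableSet_state 0 b)]
  simp only [← lintegral_indicator (hset _)]
  rw [← lintegral_tsum fun n => ((hF n).indicator (hset n)).aemeasurable]
  refine lintegral_congr_ae ?_
  filter_upwards [hZ] with ω hω
  by_cases h0 : Y 0 ω = b
  · rw [Set.indicator_of_mem (by exact h0)]
    by_cases hex : ∃ n, D (Y n ω)
    · have hfirst := hω.firstTime_eq_of_first (Nat.find_spec hex)
        fun k hk => Nat.find_min hex hk
      -- Only the index of the first visit survives: before it the state is not in `D`, and after it
      -- the avoidance condition fails.
      rw [hfirst, tsum_eq_single (Nat.find hex)]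
      · rw [Set.indicator_of_mem (show ω ∈ {ω | Y 0 ω = b ∧ ∀ k < Nat.find hex, ¬ D (Y k ω)} from
          ⟨h0, fun k hk => Nat.find_min hex hk⟩)]
        simp [Nat.find_spec hex, jumpTime]
      · intro m hm
        rcases lt_or_gt_of_ne hm with hm | hm
        · have := Nat.find_min hex hm
          simp [Set.indicator, this, vanishTop]
        · rw [Set.indicator_of_notMem]
          rintro ⟨-, h2⟩
          exact h2 _ hm (Nat.find_spec hex)
    · push Not at hex
      rw [hω.firstTime_eq_top_of_forall_not hex]
      simp [vanishTop, hex, Set.indicator]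
  · rw [Set.indicator_of_notMem (by exact h0)]
    symm
    rw [ENNReal.tsum_eq_zero]
    intro n
    rw [Set.indicator_of_notMem]
    exact fun a => h0 a.1

end FirstTime

/-! ### First-passage laws of birth-death processes -/

section BirthDeath

variable (lam d : ℕ → ℝ≥0)

lemma birthDeathRate_eq_zero {m n : ℕ} (h : n ∉ ({m + 1, m - 1} : Finset ℕ)) :
    birthDeathRate lam d m n = 0 := by
  simp only [Finset.mem_insert, Finset.mem_singleton, not_or] at h
  rw [birthDeathRate, if_neg h.1, if_neg (by omega)]

lemma summable_birthDeathRate (m : ℕ) : Summable (birthDeathRate lam d m) :=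
  summable_of_ne_finset_zero (s := {m + 1, m - 1}) fun _ h => birthDeathRate_eq_zero lam d h

lemma tsum_birthDeathRate_mul (m : ℕ) (c : ℕ → ℝ≥0∞) :
    ∑' n, (birthDeathRate lam d (m + 1) n : ℝ≥0∞) * c n =
      lam (m + 1) * c (m + 2) + d (m + 1) * c m := by
  rw [tsum_eq_sum (s := {m + 2, m}), Finset.sum_pair (by omega)]
  · simp [birthDeathRate, show m ≠ m + 1 + 1 by omega]
  · intro n hn
    rw [birthDeathRate_eq_zero, ENNReal.coe_zero, zero_mul]
    simpa using hn

lemma exitRate_birthDeathRate (m : ℕ) :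
    exitRate (birthDeathRate lam d) (m + 1) = lam (m + 1) + d (m + 1) := by
  have h := tsum_birthDeathRate_mul lam d m (fun _ => 1)
  simp only [mul_one] at h
  rw [← ENNReal.coe_tsum (summable_birthDeathRate lam d (m + 1))] at h
  exact_mod_cast h

/-- Law of the first-passage time to `0` on the event that it happens at the `n`-th jump, for the
birth-death process started at `a`. -/
def passageLawAt : ℕ → ℕ → Measure ℝ
  | 0, 0 => Measure.dirac 0
  | 0, _ + 1 => 0
  | _ + 1, 0 => 0
  | n + 1, a + 1 =>
    (lam (a + 1) : ℝ≥0∞) •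
        (expKernel ((lam (a + 1) + d (a + 1) : ℝ≥0) : ℝ) ∗ passageLawAt n (a + 2)) +
      (d (a + 1) : ℝ≥0∞) • (expKernel ((lam (a + 1) + d (a + 1) : ℝ≥0) : ℝ) ∗ passageLawAt n a)

instance sFinite_passageLawAt (n a : ℕ) : SFinite (passageLawAt lam d n a) := by
  induction n generalizing a with
  | zero => cases a <;> (unfold passageLawAt; infer_instance)
  | succ n ih =>
    cases a with
    | zero => unfold passageLawAt; infer_instance
    | succ a =>
      have := ih a
      have := ih (a + 2)
      unfold passageLawAt Measure.conv
      infer_instance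

/-- Law of the first-passage time to `0` of the birth-death process started at `a`, on the event
that it is finite. -/
def passageLaw (a : ℕ) : Measure ℝ := Measure.sum fun n => passageLawAt lam d n a

/-- Both sides condition on the first jump: the outermost `stepOp` corresponds to the outermost
convolution, and `s` is the time already elapsed. -/
lemma stepOp_iterate_birthDeathRate {ψ : ℝ → ℝ≥0∞} (hψ : Measurable ψ) (n a : ℕ) (s : ℝ) :
    ((stepOp (birthDeathRate lam d) (· = 0))^[n] fun y s => if y = 0 then ψ s else 0) a s =
      ∫⁻ t, ψ (s + t) ∂passageLawAt lam d n a := by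
  induction n generalizing a s with
  | zero =>
    cases a with
    | zero => simp [passageLawAt]
    | succ a => simp [passageLawAt]
  | succ n ih =>
    rw [Function.iterate_succ_apply']
    cases a with
    | zero => simp [stepOp, passageLawAt]
    | succ a =>
      have hψ' : ∀ s, Measurable fun t => ψ (s + t) := fun s => hψ.comp (measurable_const_add s)
      simp only [stepOp, Nat.add_eq_zero_iff, one_ne_zero, and_false, if_false, ih]
      rw [tsum_birthDeathRate_mul, exitRate_birthDeathRate, passageLawAt, lintegral_add_measure,
        lintegral_smul_measure, lintegral_smul_measure, Measure.lintegral_conv (hψ' s),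
        Measure.lintegral_conv (hψ' s)]
      simp only [smul_eq_mul, add_assoc]

variable {lam d} {Ω : Type*} [MeasurableSpace Ω] {P : Measure Ω} [IsProbabilityMeasure P]

/-- First-passage times of birth-death processes are measurable, and their law is
`passageLaw`. -/
lemma finiteLaw_firstTime_birthDeath {Z : ℝ≥0 → Ω → ℕ}
    (hZ : IsMarkovJumpProcess P (birthDeathRate lam d) Z) {q : ℕ} (h0 : ∀ᵐ ω ∂P, Z 0 ω = q) :
    AEMeasurable (fun ω => firstTime fun t => Z t ω = 0) P ∧
      finiteLaw P (fun ω => firstTime fun t => Z t ω = 0) = passageLaw lam d q := by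
  classical
  obtain ⟨Y, H, hs, hp⟩ := hZ.exists_skeleton
  set σ : Ω → ℝ≥0∞ := fun ω => firstTime fun t => Z t ω = 0
  have hσ : σ =ᵐ[P] fun ω => ⨅ n, if Y n ω = 0 then jumpTime H n ω else ⊤ := by
    filter_upwards [hp] with ω hω
    have := hω.firstTime_eq (· = 0)
    simp only [σ, this]
    refine iInf_congr fun n => ?_
    by_cases h : Y n ω = 0 <;> simp [h, jumpTime]
  have hm : Measurable fun ω => ⨅ n, if Y n ω = 0 then jumpTime H n ω else ⊤ :=
    Measurable.iInf fun n => Measurable.ite (hs.measurableSet_state n 0)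
      (hs.measurable_jumpTime n) measurable_const
  have hσm : AEMeasurable σ P := ⟨_, hm, hσ⟩
  refine ⟨hσm, ?_⟩
  have hY0 : ∀ᵐ ω ∂P, Y 0 ω = q := by
    filter_upwards [hp, h0] with ω h1 h2
    exact h1.zero_eq.symm.trans h2
  -- The initial state is almost surely `q`, so restricting to it changes nothing and the path
  -- formula gives the law itself.
  have hP : P {ω | Y 0 ω = q} = 1 := (prob_compl_eq_zero_iff (hs.measurableSet_state 0 q)).1 hY0
  ext B hB
  have key := hs.setLIntegral_firstTime (summable_birthDeathRate lam d) hp (· = 0) q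
    (ψ := B.indicator 1) (measurable_one.indicator hB)
  have hres : P.restrict {ω | Y 0 ω = q} = P := Measure.restrict_eq_self_of_ae_mem hY0
  rw [hres, hP, one_mul] at key
  have e1 : ∀ n, ((stepOp (birthDeathRate lam d) (· = 0))^[n]
      fun y s => if y = 0 then B.indicator 1 s else 0) q 0 = passageLawAt lam d n q B := by
    intro n
    rw [stepOp_iterate_birthDeathRate lam d (measurable_one.indicator hB)]
    simp [lintegral_indicator_one hB]
  have e2 : finiteLaw P σ B = ∫⁻ ω, vanishTop (B.indicator 1) (σ ω) ∂P := by
    have hnull : NullMeasurableSet {ω | σ ω < ⊤} P := nullMeasurableSet_lt hσm aemeasurable_const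
    rw [finiteLaw, Measure.map_apply_of_aemeasurable hσm.restrict.ennreal_toReal hB,
      Measure.restrict_apply₀' hnull, ← lintegral_indicator_one₀]
    · refine lintegral_congr fun ω => ?_
      by_cases ht : σ ω = ⊤
      · simp [vanishTop, ht]
      · simp [vanishTop, ht, Set.indicator, Ne.lt_top]
    · exact (hσm.ennreal_toReal.nullMeasurable hB).inter hnull
  rw [e2]
  refine key.trans ?_
  rw [passageLaw, Measure.sum_apply _ hB]
  refine tsum_congr fun n => ?_
  rw [← e1]
  congr!

end BirthDeath

/-! ### Backward equation and density of the first-passage time -/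

section BirthDeath

variable (lam d : ℕ → ℝ≥0)

lemma passageLaw_zero : passageLaw lam d 0 = Measure.dirac 0 := by
  ext B hB
  rw [passageLaw, Measure.sum_apply _ hB, tsum_eq_single 0]
  · simp [passageLawAt]
  · rintro (_ | n) hn
    · exact absurd rfl hn
    · simp [passageLawAt]

instance (a : ℕ) : SFinite (passageLaw lam d a) := by unfold passageLaw; infer_instance

lemma lintegral_passageLaw_succ (a : ℕ) {ψ : ℝ → ℝ≥0∞} (hψ : Measurable ψ) :
    ∫⁻ t, ψ t ∂passageLaw lam d (a + 1) =
      lam (a + 1) * ∫⁻ h, ∫⁻ t, ψ (h + t) ∂passageLaw lam d (a + 2)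
          ∂expKernel ((lam (a + 1) + d (a + 1) : ℝ≥0) : ℝ) +
        d (a + 1) * ∫⁻ h, ∫⁻ t, ψ (h + t) ∂passageLaw lam d a
          ∂expKernel ((lam (a + 1) + d (a + 1) : ℝ≥0) : ℝ) := by
  have hψ' : ∀ s, Measurable fun t => ψ (s + t) := fun s => hψ.comp (measurable_const_add s)
  simp only [passageLaw, lintegral_sum_measure]
  rw [lintegral_tsum fun n => (Measurable.lintegral_prod_right
      (f := fun h t => ψ (h + t)) (by fun_prop)).aemeasurable,
    lintegral_tsum fun n => (Measurable.lintegral_prod_right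
      (f := fun h t => ψ (h + t)) (by fun_prop)).aemeasurable,
    ← ENNReal.tsum_mul_left, ← ENNReal.tsum_mul_left, ← ENNReal.tsum_add,
    tsum_eq_zero_add' ENNReal.summable]
  simp only [passageLawAt, lintegral_zero_measure, zero_add]
  refine tsum_congr fun n => ?_
  rw [lintegral_add_measure, lintegral_smul_measure, lintegral_smul_measure,
    Measure.lintegral_conv hψ, Measure.lintegral_conv hψ]
  simp only [smul_eq_mul]

/-- Partial sums allow an induction on the number of jumps: conditioning on the first jump bounds
the sum by weights `λ / (λ + d)` and `d / (λ + d)`, whose total is at most `1`, also when both rates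
vanish. -/
lemma sum_passageLawAt_univ_le_one (N a : ℕ) :
    ∑ n ∈ Finset.range N, passageLawAt lam d n a Set.univ ≤ 1 := by
  induction N generalizing a with
  | zero => simp
  | succ N ih =>
    rw [Finset.sum_range_succ']
    cases a with
    | zero => simp [passageLawAt]
    | succ a =>
      have h1 : ∀ n, passageLawAt lam d (n + 1) (a + 1) Set.univ =
          (ENNReal.ofReal ((lam (a + 1) + d (a + 1) : ℝ≥0) : ℝ))⁻¹ *
          (lam (a + 1) * passageLawAt lam d n (a + 2) Set.univ +
            d (a + 1) * passageLawAt lam d n a Set.univ) := by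
        intro n
        have hconv : ∀ μ : Measure ℝ, SFinite μ →
            (expKernel ((lam (a + 1) + d (a + 1) : ℝ≥0) : ℝ) ∗ μ) Set.univ =
            (ENNReal.ofReal ((lam (a + 1) + d (a + 1) : ℝ≥0) : ℝ))⁻¹ * μ Set.univ := by
          intro μ hμ
          rw [Measure.conv, Measure.map_apply (by fun_prop) MeasurableSet.univ, Set.preimage_univ,
            ← Set.univ_prod_univ, Measure.prod_prod, expKernel_univ]
        rw [passageLawAt, Measure.add_apply, Measure.smul_apply, Measure.smul_apply,
          hconv _ inferInstance, hconv _ inferInstance, smul_eq_mul, smul_eq_mul]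
        ring
      simp only [h1]
      rw [← Finset.mul_sum, Finset.sum_add_distrib, ← Finset.mul_sum, ← Finset.mul_sum]
      simp only [passageLawAt, Measure.coe_zero, Pi.zero_apply, add_zero]
      rw [ENNReal.ofReal_coe_nnreal]
      calc _ ≤ ((lam (a + 1) + d (a + 1) : ℝ≥0) : ℝ≥0∞)⁻¹ *
            (lam (a + 1) * 1 + d (a + 1) * 1) := by gcongr <;> exact ih _
        _ ≤ 1 := by
          rw [mul_one, mul_one, ← ENNReal.coe_add]
          exact ENNReal.inv_mul_le_one _

lemma passageLaw_univ_le_one (a : ℕ) : passageLaw lam d a Set.univ ≤ 1 := by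
  rw [passageLaw, Measure.sum_apply _ MeasurableSet.univ, ENNReal.tsum_eq_iSup_nat]
  exact iSup_le fun N => sum_passageLawAt_univ_le_one lam d N a

instance isFiniteMeasure_passageLaw (a : ℕ) : IsFiniteMeasure (passageLaw lam d a) :=
  ⟨(passageLaw_univ_le_one lam d a).trans_lt ENNReal.one_lt_top⟩

lemma passageLawAt_Iio_zero (n a : ℕ) : passageLawAt lam d n a (Set.Iio 0) = 0 := by
  induction n generalizing a with
  | zero => cases a <;> simp [passageLawAt]
  | succ n ih =>
    cases a with
    | zero => simp [passageLawAt]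
    | succ a =>
      have hconv : ∀ r : ℝ, ∀ b, (expKernel r ∗ passageLawAt lam d n b) (Set.Iio 0) = 0 := by
        intro r b
        rw [← lintegral_indicator_one measurableSet_Iio, Measure.lintegral_conv
          (measurable_one.indicator measurableSet_Iio), expKernel]
        refine lintegral_eq_zero_of_ae_eq_zero ?_
        refine (withDensity_absolutelyContinuous _ _).ae_le ?_
        refine (ae_restrict_iff' measurableSet_Ioi).2 (Eventually.of_forall fun h hh => ?_)
        have hh : (0 : ℝ) < h := hh
        refine le_antisymm ?_ bot_le
        calc ∫⁻ y, (Set.Iio (0 : ℝ)).indicator 1 (h + y) ∂passageLawAt lam d n b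
            ≤ ∫⁻ y, (Set.Iio (0 : ℝ)).indicator 1 y ∂passageLawAt lam d n b := by
              refine lintegral_mono fun y => ?_
              by_cases hy : h + y < 0
              · simp [Set.indicator, hy, show y < 0 by linarith]
              · simp [Set.indicator, hy]
          _ = 0 := by rw [lintegral_indicator_one measurableSet_Iio, ih]
      simp [passageLawAt, hconv]

lemma passageLaw_Iio_zero (a : ℕ) : passageLaw lam d a (Set.Iio 0) = 0 := by
  rw [passageLaw, Measure.sum_apply _ measurableSet_Iio]
  simp [passageLawAt_Iio_zero]

/-- Distribution function of the first-passage time to `0`. -/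
def passageCDF (a : ℕ) (t : ℝ) : ℝ := (passageLaw lam d a).real (Set.Iic t)

/-- Density of the first-passage time to `0`. -/
def passageDensity : ℕ → ℝ → ℝ
  | 0, _ => 0
  | a + 1, t => lam (a + 1) * (passageCDF lam d (a + 2) t - passageCDF lam d (a + 1) t) +
      d (a + 1) * (passageCDF lam d a t - passageCDF lam d (a + 1) t)

lemma passageCDF_nonneg (a : ℕ) (t : ℝ) : 0 ≤ passageCDF lam d a t := measureReal_nonneg

lemma passageCDF_le_one (a : ℕ) (t : ℝ) : passageCDF lam d a t ≤ 1 := by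
  refine ENNReal.toReal_le_of_le_ofReal zero_le_one ?_
  rw [ENNReal.ofReal_one]
  exact (measure_mono (Set.subset_univ _)).trans (passageLaw_univ_le_one lam d a)

lemma passageCDF_mono (a : ℕ) : Monotone (passageCDF lam d a) := fun _ _ h =>
  measureReal_mono (Set.Iic_subset_Iic.2 h)

lemma passageCDF_zero {t : ℝ} (ht : 0 ≤ t) : passageCDF lam d 0 t = 1 := by
  rw [passageCDF, passageLaw_zero, Measure.real, Measure.dirac_apply' _ measurableSet_Iic]
  simp [ht]

lemma passageCDF_of_neg (a : ℕ) {t : ℝ} (ht : t < 0) : passageCDF lam d a t = 0 := by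
  have : passageLaw lam d a (Set.Iic t) = 0 :=
    measure_mono_null (fun x hx => lt_of_le_of_lt hx ht) (passageLaw_Iio_zero lam d a)
  simp [passageCDF, Measure.real, this]

/-- Conditioning on the first jump at time `h` gives `∫ e^{-rh} k(t - h) dh`; substituting `u = t -
h` moves the variable `t` to the exponential factor and the endpoint. Continuity, and then
differentiability, can be read off in this form. -/
lemma passageCDF_succ (a : ℕ) (t : ℝ) :
    passageCDF lam d (a + 1) t =
      Real.exp (-((lam (a + 1) + d (a + 1) : ℝ) * t)) *
        ∫ u in (0 : ℝ)..t, Real.exp ((lam (a + 1) + d (a + 1) : ℝ) * u) *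
          (lam (a + 1) * passageCDF lam d (a + 2) u + d (a + 1) * passageCDF lam d a u) := by
  set r : ℝ := lam (a + 1) + d (a + 1) with hr
  set k : ℝ → ℝ := fun u => lam (a + 1) * passageCDF lam d (a + 2) u +
    d (a + 1) * passageCDF lam d a u with hk
  have hkm : Measurable k :=
    ((passageCDF_mono lam d (a + 2)).measurable.const_mul _).add
      ((passageCDF_mono lam d a).measurable.const_mul _)
  have hk0 : ∀ u, 0 ≤ k u := fun u => add_nonneg
    (mul_nonneg NNReal.zero_le_coe (passageCDF_nonneg lam d _ _))
    (mul_nonneg NNReal.zero_le_coe (passageCDF_nonneg lam d _ _))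
  have hkneg : ∀ u < 0, k u = 0 := fun u hu => by
    simp [hk, passageCDF_of_neg lam d _ hu]
  rcases lt_or_ge t 0 with ht | ht
  · rw [passageCDF_of_neg lam d _ ht, intervalIntegral.integral_symm,
      intervalIntegral.integral_of_le ht.le, integral_Ioc_eq_integral_Ioo,
      setIntegral_eq_zero_of_forall_eq_zero, neg_zero, mul_zero]
    intro u hu
    change _ * k u = 0
    rw [hkneg u hu.2, mul_zero]
  have e1 : passageLaw lam d (a + 1) (Set.Iic t) =
      ∫⁻ h in Set.Ioi (0 : ℝ), ENNReal.ofReal (Real.exp (-(r * h)) * k (t - h)) := by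
    have hin : ∀ b h, ∫⁻ y, (Set.Iic t).indicator 1 (h + y) ∂passageLaw lam d b =
        ENNReal.ofReal (passageCDF lam d b (t - h)) := by
      intro b h
      have : (fun y => (Set.Iic t).indicator (1 : ℝ → ℝ≥0∞) (h + y)) =
          (Set.Iic (t - h)).indicator 1 := by
        ext y; simp [Set.indicator, le_sub_iff_add_le']
      rw [this, lintegral_indicator_one measurableSet_Iic, passageCDF, ofReal_measureReal]
    have hmeas : ∀ b, Measurable fun h => ENNReal.ofReal (passageCDF lam d b (t - h)) := fun b =>
      ((passageCDF_mono lam d b).measurable.comp (measurable_const.sub measurable_id)).ennreal_ofReal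
    rw [← lintegral_indicator_one measurableSet_Iic, lintegral_passageLaw_succ _ _ _
      (measurable_one.indicator measurableSet_Iic)]
    simp only [hin]
    rw [← lintegral_const_mul _ (hmeas _), ← lintegral_const_mul _ (hmeas _),
      ← lintegral_add_left ((hmeas _).const_mul _),
      lintegral_expKernel _ (φ := fun h => lam (a + 1) * ENNReal.ofReal (passageCDF lam d (a + 2) (t - h)) +
        d (a + 1) * ENNReal.ofReal (passageCDF lam d a (t - h)))
        (((hmeas _).const_mul _).add ((hmeas _).const_mul _))]
    refine lintegral_congr fun h => ?_
    rw [ENNReal.ofReal_mul (Real.exp_pos _).le, hk,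
      ENNReal.ofReal_add (mul_nonneg NNReal.zero_le_coe (passageCDF_nonneg lam d _ _))
        (mul_nonneg NNReal.zero_le_coe (passageCDF_nonneg lam d _ _)),
      ENNReal.ofReal_mul NNReal.zero_le_coe, ENNReal.ofReal_mul NNReal.zero_le_coe]
    simp [hr]
  have e2 : passageCDF lam d (a + 1) t =
      ∫ h in Set.Ioi (0 : ℝ), Real.exp (-(r * h)) * k (t - h) := by
    rw [passageCDF, Measure.real, e1, integral_eq_lintegral_of_nonneg_ae]
    · exact Eventually.of_forall fun h => mul_nonneg (Real.exp_pos _).le (hk0 _)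
    · have : Measurable fun h => k (t - h) := hkm.comp (measurable_const.sub measurable_id)
      exact (Measurable.mul (by fun_prop) this).aestronglyMeasurable
  have e3 : ∫ h in Set.Ioi (0 : ℝ), Real.exp (-(r * h)) * k (t - h) =
      ∫ h in Set.Ioc (0 : ℝ) t, Real.exp (-(r * h)) * k (t - h) := by
    refine setIntegral_eq_of_subset_of_forall_sdiff_eq_zero measurableSet_Ioi
      Set.Ioc_subset_Ioi_self fun h hh => ?_
    have h1 : 0 < h := hh.1
    have h2 : ¬ (0 < h ∧ h ≤ t) := hh.2
    rw [hkneg (t - h) (by by_contra h3; exact h2 ⟨h1, by linarith⟩), mul_zero]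
  rw [e2, e3, ← intervalIntegral.integral_of_le ht]
  have e4 := intervalIntegral.integral_comp_sub_left (a := 0) (b := t)
    (fun u => Real.exp (-(r * (t - u))) * k u) t
  simp only [sub_sub_cancel, sub_self, sub_zero] at e4
  rw [e4, ← intervalIntegral.integral_const_mul]
  refine intervalIntegral.integral_congr fun u _ => ?_
  rw [← mul_assoc, ← Real.exp_add]
  congr 2
  ring

lemma intervalIntegrable_passage (a : ℕ) (s t : ℝ) :
    IntervalIntegrable (fun u => Real.exp ((lam (a + 1) + d (a + 1) : ℝ) * u) *
      (lam (a + 1) * passageCDF lam d (a + 2) u + d (a + 1) * passageCDF lam d a u)) volume s t := by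
  have h1 : ∀ b, IntervalIntegrable (passageCDF lam d b) volume s t := fun b =>
    (passageCDF_mono lam d b).intervalIntegrable
  exact (((h1 _).const_mul _).add ((h1 _).const_mul _)).continuousOn_mul (by fun_prop)

lemma continuous_passageCDF_succ (a : ℕ) : Continuous (passageCDF lam d (a + 1)) := by
  have h : passageCDF lam d (a + 1) = fun t => _ := funext (passageCDF_succ lam d a)
  rw [h]
  refine Continuous.mul (by fun_prop) ?_
  exact intervalIntegral.continuous_primitive (fun s t => intervalIntegrable_passage lam d a s t) 0

lemma passageCDF_succ_zero (a : ℕ) : passageCDF lam d (a + 1) 0 = 0 := by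
  rw [passageCDF_succ]; simp

lemma continuousAt_passageCDF (a : ℕ) {t : ℝ} (ht : 0 < t) :
    ContinuousAt (passageCDF lam d a) t := by
  cases a with
  | zero =>
    refine (continuousAt_const (y := (1 : ℝ))).congr ?_
    filter_upwards [lt_mem_nhds ht] with s hs
    rw [passageCDF_zero lam d hs.le]
  | succ a => exact (continuous_passageCDF_succ lam d a).continuousAt

/-- Kolmogorov's backward equation, obtained by differentiating `passageCDF_succ`. Only positive
times are allowed because the distribution function from state `0` jumps at `0`. -/
lemma hasDerivAt_passageCDF (a : ℕ) {t : ℝ} (ht : 0 < t) :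
    HasDerivAt (passageCDF lam d a) (passageDensity lam d a t) t := by
  cases a with
  | zero =>
    refine (hasDerivAt_const t (1 : ℝ)).congr_of_eventuallyEq ?_
    filter_upwards [lt_mem_nhds ht] with s hs
    rw [passageCDF_zero lam d hs.le]
  | succ a =>
    set r : ℝ := lam (a + 1) + d (a + 1) with hr
    set k : ℝ → ℝ := fun u => lam (a + 1) * passageCDF lam d (a + 2) u +
      d (a + 1) * passageCDF lam d a u with hk
    have hkm : Measurable k :=
      ((passageCDF_mono lam d (a + 2)).measurable.const_mul _).add
        ((passageCDF_mono lam d a).measurable.const_mul _)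
    have hkc : ContinuousAt k t :=
      ((continuousAt_passageCDF lam d _ ht).const_mul _).add
        ((continuousAt_passageCDF lam d _ ht).const_mul _)
    have h1 : HasDerivAt (fun t => ∫ u in (0 : ℝ)..t, Real.exp (r * u) * k u)
        (Real.exp (r * t) * k t) t :=
      intervalIntegral.integral_hasDerivAt_right (intervalIntegrable_passage lam d a 0 t)
        (Measurable.stronglyMeasurable (by fun_prop)).stronglyMeasurableAtFilter
        (ContinuousAt.mul (by fun_prop) hkc)
    have h2 : HasDerivAt (fun t => Real.exp (-(r * t))) (-r * Real.exp (-(r * t))) t := by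
      have := (((hasDerivAt_id t).const_mul r).neg).exp
      simp only [id, mul_one] at this
      rwa [mul_comm] at this
    have h3 := h2.mul h1
    have h : passageCDF lam d (a + 1) = fun t => _ := funext (passageCDF_succ lam d a)
    rw [h]
    refine h3.congr_deriv ?_
    have e : Real.exp (-(r * t)) * (Real.exp (r * t) * k t) = k t := by
      rw [← mul_assoc, ← Real.exp_add]; simp
    rw [e, mul_assoc, ← passageCDF_succ lam d a t]
    simp only [passageDensity, hk, hr]
    ring

lemma passageDensity_nonneg (a : ℕ) {t : ℝ} (ht : 0 < t) : 0 ≤ passageDensity lam d a t := by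
  rw [← (hasDerivAt_passageCDF lam d a ht).deriv]
  exact (passageCDF_mono lam d a).deriv_nonneg

lemma measurable_passageDensity (a : ℕ) : Measurable (passageDensity lam d a) := by
  cases a with
  | zero => exact measurable_const
  | succ a =>
    have h : ∀ b, Measurable (passageCDF lam d b) := fun b => (passageCDF_mono lam d b).measurable
    exact (((h _).sub (h _)).const_mul _).add (((h _).sub (h _)).const_mul _)

lemma abs_passageDensity_le (a : ℕ) (t : ℝ) :
    |passageDensity lam d a t| ≤ lam a + d a := by
  cases a with
  | zero => simp only [passageDensity, abs_zero]; positivity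
  | succ a =>
    have h : ∀ b c, |passageCDF lam d b t - passageCDF lam d c t| ≤ 1 := fun b c => by
      rw [abs_le]
      constructor <;> linarith [passageCDF_nonneg lam d b t, passageCDF_le_one lam d b t,
        passageCDF_nonneg lam d c t, passageCDF_le_one lam d c t]
    refine (abs_add_le _ _).trans (add_le_add ?_ ?_) <;>
    · rw [abs_mul, NNReal.abs_eq]
      exact mul_le_of_le_one_right NNReal.zero_le_coe (h _ _)

/-- The density is a linear combination of distribution functions, so the backward equation applies
once more. The resulting bounded second derivative of the distribution function is the source of the
`|s|⁻²` decay in the inversion. -/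
lemma hasDerivAt_passageDensity_succ (a : ℕ) {t : ℝ} (ht : 0 < t) :
    HasDerivAt (passageDensity lam d (a + 1))
      (lam (a + 1) * (passageDensity lam d (a + 2) t - passageDensity lam d (a + 1) t) +
      d (a + 1) * (passageDensity lam d a t - passageDensity lam d (a + 1) t)) t := by
  have h := fun b => hasDerivAt_passageCDF lam d b ht
  exact (((h _).sub (h _)).const_mul _).add (((h _).sub (h _)).const_mul _)

/-- The first-passage time from a positive state has a density. -/
lemma passageLaw_succ_eq_withDensity (a : ℕ) :
    passageLaw lam d (a + 1) = (volume.restrict (Set.Ioi 0)).withDensity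
      fun t => ENNReal.ofReal (passageDensity lam d (a + 1) t) := by
  refine Measure.ext_of_Iic _ _ fun t => ?_
  rw [withDensity_apply _ measurableSet_Iic, Measure.restrict_restrict measurableSet_Iic,
    Set.inter_comm, Set.Ioi_inter_Iic]
  rcases le_or_gt t 0 with ht | ht
  · rw [Set.Ioc_eq_empty (by simpa using ht)]
    have : (passageLaw lam d (a + 1)).real (Set.Iic t) = 0 := le_antisymm
      ((passageCDF_mono lam d (a + 1) ht).trans (passageCDF_succ_zero lam d a).le)
      measureReal_nonneg
    rw [measureReal_eq_zero_iff] at this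
    simp [this]
  · have hint : IntegrableOn (passageDensity lam d (a + 1)) (Set.Ioc 0 t) := by
      refine Measure.integrableOn_of_bounded (M := lam (a + 1) + d (a + 1)) (by simp)
        (measurable_passageDensity lam d _).aestronglyMeasurable (Eventually.of_forall fun s => ?_)
      exact abs_passageDensity_le lam d (a + 1) s
    rw [← ofReal_integral_eq_lintegral_ofReal hint ((ae_restrict_iff' measurableSet_Ioc).2
      (Eventually.of_forall fun s hs => passageDensity_nonneg lam d _ hs.1)),
      ← intervalIntegral.integral_of_le ht.le,
      intervalIntegral.integral_eq_sub_of_hasDerivAt_of_le ht.le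
        (continuous_passageCDF_succ lam d a).continuousOn
        (fun s hs => hasDerivAt_passageCDF lam d (a + 1) hs.1)
        ((intervalIntegrable_iff_integrableOn_Ioc_of_le ht.le).2 hint),
      passageCDF_succ_zero, sub_zero, passageCDF, ofReal_measureReal]

end BirthDeath

/-! ### The race between two birth-death processes and an exponential clock -/

section Race

lemma integrableOn_exp_neg_mul_bounded {κ : ℝ} (hκ : 0 < κ) {φ : ℝ → ℝ} (hφ : Measurable φ)
    {C : ℝ} (hC : ∀ t, 0 < t → |φ t| ≤ C) :
    IntegrableOn (fun t => Real.exp (-(κ * t)) * φ t) (Set.Ioi 0) := by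
  have h1 : IntegrableOn (fun t => Real.exp (-(κ * t))) (Set.Ioi 0) := by
    simpa only [neg_mul] using integrableOn_exp_mul_Ioi (neg_lt_zero.2 hκ) 0
  refine Integrable.mul_bdd (c := C) h1 hφ.aestronglyMeasurable ?_
  exact (ae_restrict_iff' measurableSet_Ioi).2 (Eventually.of_forall fun t ht => hC t ht)

/-- The integrand is the derivative of `e^{-κt} φ(t)`, which vanishes at infinity because `φ` is
bounded. With `φ` built from distribution functions, this yields the boundary value and the
first-step equation of the race. -/
lemma integral_exp_neg_mul_deriv {κ : ℝ} (hκ : 0 < κ) {φ φ' : ℝ → ℝ} (hφ : Measurable φ)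
    (hφ' : Measurable φ') {C : ℝ} (hC : ∀ t, 0 < t → |φ t| ≤ C) (hC' : ∀ t, 0 < t → |φ' t| ≤ C)
    (hcont : ContinuousWithinAt φ (Set.Ici 0) 0)
    (hderiv : ∀ t, 0 < t → HasDerivAt φ (φ' t) t) :
    ∫ t in Set.Ioi (0 : ℝ), Real.exp (-(κ * t)) * (φ' t - κ * φ t) = -φ 0 := by
  have hE : ∀ t, HasDerivAt (fun t => Real.exp (-(κ * t))) (-κ * Real.exp (-(κ * t))) t := by
    intro t
    have := (((hasDerivAt_id t).const_mul κ).neg).exp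
    simp only [id, mul_one] at this
    rwa [mul_comm] at this
  have h := integral_Ioi_of_hasDerivAt_of_tendsto (a := 0) (m := 0)
    (f := fun t => Real.exp (-(κ * t)) * φ t)
    (f' := fun t => Real.exp (-(κ * t)) * (φ' t - κ * φ t)) ?_ ?_ ?_ ?_
  · rw [h]; simp
  · exact ContinuousWithinAt.mul (by fun_prop) hcont
  · intro t ht
    refine ((hE t).mul (hderiv t ht)).congr_deriv ?_
    ring
  · refine integrableOn_exp_neg_mul_bounded hκ (by fun_prop) (C := C + κ * C) fun t ht => ?_
    refine (abs_sub _ _).trans (add_le_add (hC' t ht) ?_)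
    rw [abs_mul, abs_of_pos hκ]
    exact mul_le_mul_of_nonneg_left (hC t ht) hκ.le
  · have hexp : Tendsto (fun t => Real.exp (-(κ * t)) * C) atTop (𝓝 0) := by
      rw [← zero_mul C]
      refine Tendsto.mul_const _ (Real.tendsto_exp_neg_atTop_nhds_zero.comp ?_)
      exact tendsto_id.const_mul_atTop hκ
    refine squeeze_zero_norm' ?_ hexp
    filter_upwards [eventually_gt_atTop 0] with t ht
    rw [norm_mul, Real.norm_eq_abs, Real.abs_exp]
    exact mul_le_mul_of_nonneg_left (hC t ht) (Real.exp_pos _).le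

variable (lam d lam' d' : ℕ → ℝ≥0)

lemma continuousWithinAt_passageCDF_zero (a : ℕ) :
    ContinuousWithinAt (passageCDF lam d a) (Set.Ici 0) 0 := by
  cases a with
  | zero =>
    refine (continuousWithinAt_const (b := (1 : ℝ))).congr
      (fun t ht => passageCDF_zero lam d ht) (passageCDF_zero lam d le_rfl)
  | succ a => exact (continuous_passageCDF_succ lam d a).continuousWithinAt

lemma continuousWithinAt_passageDensity_zero (a : ℕ) :
    ContinuousWithinAt (passageDensity lam d a) (Set.Ici 0) 0 := by
  cases a with
  | zero => exact continuousWithinAt_const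
  | succ a =>
    have h := continuousWithinAt_passageCDF_zero lam d
    exact (((h _).sub (h _)).const_mul _).add (((h _).sub (h _)).const_mul _)

/-- Minus the derivative of `e^{-κt} (1 - G t)`, without its exponential factor. -/
def killedDensity (κ : ℝ) (b : ℕ) (t : ℝ) : ℝ :=
  κ * (1 - passageCDF lam d b t) + passageDensity lam d b t

lemma measurable_passageCDF (a : ℕ) : Measurable (passageCDF lam d a) :=
  (passageCDF_mono lam d a).measurable

lemma measurable_killedDensity (κ : ℝ) (b : ℕ) : Measurable (killedDensity lam d κ b) :=
  ((measurable_const.sub (measurable_passageCDF lam d b)).const_mul _).add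
    (measurable_passageDensity lam d b)

lemma killedDensity_nonneg {κ : ℝ} (hκ : 0 ≤ κ) (b : ℕ) {t : ℝ} (ht : 0 < t) :
    0 ≤ killedDensity lam d κ b t :=
  add_nonneg (mul_nonneg hκ (sub_nonneg.2 (passageCDF_le_one lam d b t)))
    (passageDensity_nonneg lam d b ht)

lemma killedDensity_zero (κ : ℝ) {t : ℝ} (ht : 0 ≤ t) : killedDensity lam d κ 0 t = 0 := by
  simp [killedDensity, passageCDF_zero lam d ht, passageDensity]

lemma abs_killedDensity_le {κ : ℝ} (hκ : 0 ≤ κ) (b : ℕ) (t : ℝ) :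
    |killedDensity lam d κ b t| ≤ κ + (lam b + d b) := by
  refine (abs_add_le _ _).trans (add_le_add ?_ (abs_passageDensity_le lam d b t))
  rw [abs_mul, abs_of_nonneg hκ, abs_of_nonneg (sub_nonneg.2 (passageCDF_le_one lam d b t))]
  exact mul_le_of_le_one_right hκ (by linarith [passageCDF_nonneg lam d b t])

/-- Probability that the first birth-death process, started at `a`, reaches `0` before both the
second one, started at `b`, and an exponential clock with parameter `κ`. -/
def raceValue (κ : ℝ) (a b : ℕ) : ℝ :=
  ∫ t in Set.Ioi (0 : ℝ),
    Real.exp (-(κ * t)) * (passageCDF lam d a t * killedDensity lam' d' κ b t)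

lemma abs_passageCDF_mul_le {κ : ℝ} (hκ : 0 ≤ κ) (a b : ℕ) (t : ℝ) :
    |passageCDF lam d a t * killedDensity lam' d' κ b t| ≤ κ + (lam' b + d' b) := by
  rw [abs_mul, abs_of_nonneg (passageCDF_nonneg lam d a t)]
  exact (mul_le_of_le_one_left (abs_nonneg _) (passageCDF_le_one lam d a t)).trans
    (abs_killedDensity_le lam' d' hκ b t)

lemma integrableOn_raceValue {κ : ℝ} (hκ : 0 < κ) (a b : ℕ) :
    IntegrableOn (fun t => Real.exp (-(κ * t)) *
      (passageCDF lam d a t * killedDensity lam' d' κ b t)) (Set.Ioi 0) :=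
  integrableOn_exp_neg_mul_bounded hκ
    ((measurable_passageCDF lam d a).mul (measurable_killedDensity lam' d' κ b))
    fun t _ => abs_passageCDF_mul_le lam d lam' d' hκ.le a b t

lemma raceValue_nonneg {κ : ℝ} (hκ : 0 ≤ κ) (a b : ℕ) : 0 ≤ raceValue lam d lam' d' κ a b :=
  setIntegral_nonneg measurableSet_Ioi fun t ht => mul_nonneg (Real.exp_pos _).le
    (mul_nonneg (passageCDF_nonneg lam d a t) (killedDensity_nonneg lam' d' hκ b ht))

lemma raceValue_right_zero (κ : ℝ) (a : ℕ) : raceValue lam d lam' d' κ a 0 = 0 := by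
  refine setIntegral_eq_zero_of_forall_eq_zero fun t ht => ?_
  rw [killedDensity_zero lam' d' κ (le_of_lt ht), mul_zero, mul_zero]

/-- With `F = 1` the integrand is minus the derivative of `e^{-κt} (1 - G(t))`, and `G(0) = 0`
because the second process starts from a positive state. -/
lemma raceValue_left_zero {κ : ℝ} (hκ : 0 < κ) (b : ℕ) :
    raceValue lam d lam' d' κ 0 (b + 1) = 1 := by
  have h := integral_exp_neg_mul_deriv hκ
    (φ := fun t => -(1 - passageCDF lam' d' (b + 1) t)) (φ' := passageDensity lam' d' (b + 1))
    (measurable_const.sub (measurable_passageCDF lam' d' _)).neg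
    (measurable_passageDensity lam' d' _) (C := 1 + (lam' (b + 1) + d' (b + 1))) ?_ ?_ ?_ ?_
  · rw [passageCDF_succ_zero] at h
    simp only [sub_zero, neg_neg] at h
    rw [← h, raceValue]
    refine setIntegral_congr_fun measurableSet_Ioi fun t ht => ?_
    simp only [passageCDF_zero lam d (le_of_lt ht), killedDensity]
    ring
  · intro t _
    rw [abs_neg, abs_of_nonneg (sub_nonneg.2 (passageCDF_le_one lam' d' _ t))]
    have := passageCDF_nonneg lam' d' (b + 1) t
    have : (0 : ℝ) ≤ lam' (b + 1) + d' (b + 1) := by positivity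
    linarith
  · intro t _
    linarith [abs_passageDensity_le lam' d' (b + 1) t]
  · exact (continuousWithinAt_const.sub (continuousWithinAt_passageCDF_zero lam' d' _)).neg
  · intro t ht
    refine ((hasDerivAt_passageCDF lam' d' (b + 1) ht).const_sub 1).neg.congr_deriv ?_
    ring

lemma raceValue_le_one {κ : ℝ} (hκ : 0 < κ) (a b : ℕ) : raceValue lam d lam' d' κ a b ≤ 1 := by
  cases b with
  | zero => rw [raceValue_right_zero]; exact zero_le_one
  | succ b =>
    rw [← raceValue_left_zero lam d lam' d' hκ b]
    refine setIntegral_mono_on (integrableOn_raceValue lam d lam' d' hκ _ _)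
      (integrableOn_raceValue lam d lam' d' hκ _ _) measurableSet_Ioi fun t ht => ?_
    refine mul_le_mul_of_nonneg_left (mul_le_mul_of_nonneg_right ?_
      (killedDensity_nonneg lam' d' hκ.le _ ht)) (Real.exp_pos _).le
    rw [passageCDF_zero lam d (le_of_lt ht)]
    exact passageCDF_le_one lam d a t

/-- First-step equation for the race. -/
lemma raceValue_step {κ : ℝ} (hκ : 0 < κ) (a b : ℕ) :
    (lam (a + 1) + d (a + 1) + lam' (b + 1) + d' (b + 1) + κ) *
        raceValue lam d lam' d' κ (a + 1) (b + 1) =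
      lam (a + 1) * raceValue lam d lam' d' κ (a + 2) (b + 1) +
      d (a + 1) * raceValue lam d lam' d' κ a (b + 1) +
      lam' (b + 1) * raceValue lam d lam' d' κ (a + 1) (b + 2) +
      d' (b + 1) * raceValue lam d lam' d' κ (a + 1) b := by
  set F := passageCDF lam d with hF
  set f := passageDensity lam d with hf
  set W := killedDensity lam' d' κ with hW
  set g := passageDensity lam' d' with hg
  set g' : ℝ → ℝ := fun t =>
    lam' (b + 1) * (g (b + 2) t - g (b + 1) t) + d' (b + 1) * (g b t - g (b + 1) t) with hg'
  have hFm : ∀ a, Measurable (F a) := measurable_passageCDF lam d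
  have hfm : ∀ a, Measurable (f a) := measurable_passageDensity lam d
  have hgm : ∀ a, Measurable (g a) := measurable_passageDensity lam' d'
  have hWm : ∀ a, Measurable (W a) := measurable_killedDensity lam' d' κ
  have hg'm : Measurable g' := by fun_prop
  obtain ⟨Cg, hCg⟩ : ∃ C, ∀ t, |g' t| ≤ C := by
    refine ⟨lam' (b + 1) * ((lam' (b + 2) + d' (b + 2)) + (lam' (b + 1) + d' (b + 1))) +
      d' (b + 1) * ((lam' b + d' b) + (lam' (b + 1) + d' (b + 1))), fun t => ?_⟩
    refine (abs_add_le _ _).trans (add_le_add ?_ ?_) <;>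
    · rw [abs_mul, NNReal.abs_eq]
      refine mul_le_mul_of_nonneg_left ?_ NNReal.zero_le_coe
      exact (abs_sub _ _).trans (add_le_add (abs_passageDensity_le lam' d' _ _)
        (abs_passageDensity_le lam' d' _ _))
  set CW : ℝ := κ + (lam' (b + 1) + d' (b + 1)) with hCW
  have hWb : ∀ t, |W (b + 1) t| ≤ CW := fun t => abs_killedDensity_le lam' d' hκ.le (b + 1) t
  have hCW0 : 0 ≤ CW := (abs_nonneg _).trans (hWb 0)
  -- Product rule for `F W`; the derivative of `W = κ (1 - G) + g` is `-κ g + g'`.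
  set φ' : ℝ → ℝ := fun t => f (a + 1) t * W (b + 1) t + F (a + 1) t * (-κ * g (b + 1) t + g' t)
  have hφb : ∀ t, |F (a + 1) t * W (b + 1) t| ≤ CW := fun t =>
    abs_passageCDF_mul_le lam d lam' d' hκ.le (a + 1) (b + 1) t
  have hφ'b : ∀ t, |φ' t| ≤
      (lam (a + 1) + d (a + 1)) * CW + (κ * (lam' (b + 1) + d' (b + 1)) + Cg) := by
    intro t
    refine (abs_add_le _ _).trans (add_le_add ?_ ?_)
    · rw [abs_mul]
      exact mul_le_mul (abs_passageDensity_le lam d _ _) (hWb t) (abs_nonneg _) (by positivity)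
    · rw [abs_mul, abs_of_nonneg (passageCDF_nonneg lam d _ t)]
      refine (mul_le_of_le_one_left (abs_nonneg _) (passageCDF_le_one lam d _ t)).trans ?_
      refine (abs_add_le _ _).trans (add_le_add ?_ (hCg t))
      rw [abs_mul, abs_neg, abs_of_pos hκ]
      exact mul_le_mul_of_nonneg_left (abs_passageDensity_le lam' d' _ _) hκ.le
  set C := max CW ((lam (a + 1) + d (a + 1)) * CW + (κ * (lam' (b + 1) + d' (b + 1)) + Cg))
  have key := integral_exp_neg_mul_deriv hκ (φ := fun t => F (a + 1) t * W (b + 1) t) (φ' := φ')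
    (by fun_prop) (by fun_prop) (C := C) (fun t _ => (hφb t).trans (le_max_left _ _))
    (fun t _ => (hφ'b t).trans (le_max_right _ _))
    ((continuousWithinAt_passageCDF_zero lam d _).mul
      (((continuousWithinAt_const.sub (continuousWithinAt_passageCDF_zero lam' d' _)).const_mul
        κ).add (continuousWithinAt_passageDensity_zero lam' d' _)))
    (fun t ht => by
      refine ((hasDerivAt_passageCDF lam d (a + 1) ht).mul
        ((((hasDerivAt_passageCDF lam' d' (b + 1) ht).const_sub 1).const_mul κ).add
          (hasDerivAt_passageDensity_succ lam' d' b ht))).congr_deriv ?_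
      simp only [φ', hF, hf, hg, hg', hW, killedDensity, Pi.add_apply]
      ring)
  -- The boundary term vanishes since the first process starts away from `0`.
  simp only [hF, passageCDF_succ_zero, zero_mul, neg_zero] at key
  have hI := integrableOn_raceValue lam d lam' d' hκ
  have hlin : ∫ t in Set.Ioi (0 : ℝ), Real.exp (-(κ * t)) *
      (φ' t - κ * (passageCDF lam d (a + 1) t * W (b + 1) t)) =
      ∫ t in Set.Ioi (0 : ℝ),
        ((lam (a + 1) * (Real.exp (-(κ * t)) * (F (a + 2) t * W (b + 1) t)) +
        d (a + 1) * (Real.exp (-(κ * t)) * (F a t * W (b + 1) t)) +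
        lam' (b + 1) * (Real.exp (-(κ * t)) * (F (a + 1) t * W (b + 2) t)) +
        d' (b + 1) * (Real.exp (-(κ * t)) * (F (a + 1) t * W b t))) -
        (lam (a + 1) + d (a + 1) + lam' (b + 1) + d' (b + 1) + κ) *
          (Real.exp (-(κ * t)) * (F (a + 1) t * W (b + 1) t))) := by
    refine setIntegral_congr_fun measurableSet_Ioi fun t ht => ?_
    have e1 : f (a + 1) t = lam (a + 1) * (F (a + 2) t - F (a + 1) t) +
        d (a + 1) * (F a t - F (a + 1) t) := rfl
    have e2 : g (b + 1) t =
        lam' (b + 1) * (passageCDF lam' d' (b + 2) t - passageCDF lam' d' (b + 1) t) +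
        d' (b + 1) * (passageCDF lam' d' b t - passageCDF lam' d' (b + 1) t) := rfl
    -- The backward operator annihilates constants and commutes with the time derivative, so `W`
    -- solves the backward equation of the second queue.
    have e3 : -κ * g (b + 1) t + g' t =
        lam' (b + 1) * (W (b + 2) t - W (b + 1) t) + d' (b + 1) * (W b t - W (b + 1) t) := by
      simp only [hW, killedDensity, hg', ← hg]
      linear_combination (-κ) * e2
    simp only [φ', e3, ← hF]
    rw [e1]
    ring
  rw [hlin, integral_sub, integral_add, integral_add, integral_add] at key
  · simp only [integral_const_mul] at key
    simp only [raceValue]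
    linarith
  all_goals first
    | exact (hI _ _).const_mul _
    | exact ((hI _ _).const_mul _).add ((hI _ _).const_mul _)
    | exact (((hI _ _).const_mul _).add ((hI _ _).const_mul _)).add ((hI _ _).const_mul _)
    | exact ((((hI _ _).const_mul _).add ((hI _ _).const_mul _)).add ((hI _ _).const_mul _)).add
        ((hI _ _).const_mul _)

end Race

/-! ### Continuity of the race in the rate of the clock -/

section RaceLimit

variable (lam d lam' d' : ℕ → ℝ≥0)

lemma integrableOn_passageDensity (b : ℕ) : IntegrableOn (passageDensity lam d b) (Set.Ioi 0) := by
  cases b with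
  | zero => exact integrableOn_zero
  | succ b =>
    refine ⟨(measurable_passageDensity lam d _).aestronglyMeasurable, ?_⟩
    rw [hasFiniteIntegral_iff_ofReal ((ae_restrict_iff' measurableSet_Ioi).2
      (Eventually.of_forall fun t ht => passageDensity_nonneg lam d _ ht))]
    have h := measure_lt_top (passageLaw lam d (b + 1)) Set.univ
    rwa [passageLaw_succ_eq_withDensity, withDensity_apply _ MeasurableSet.univ,
      Measure.restrict_univ] at h

lemma integrableOn_exp_mul_killedDensity {κ : ℝ} (hκ : 0 ≤ κ) (b : ℕ) :
    IntegrableOn (fun t => Real.exp (-(κ * t)) * killedDensity lam d κ b t) (Set.Ioi 0) := by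
  rcases hκ.eq_or_lt with rfl | hκ
  · simpa [killedDensity] using integrableOn_passageDensity lam d b
  · exact integrableOn_exp_neg_mul_bounded hκ (measurable_killedDensity lam d κ b)
      fun t _ => abs_killedDensity_le lam d hκ.le b t

/-- An Abelian argument: substituting `x = θ t` leaves `∫ e^{-x} m(x / θ) dx`, which is dominated by
`e^{-x}` and has integrand tending to `0`. -/
lemma tendsto_mul_integral_exp_neg {m : ℝ → ℝ} (hm : Measurable m) (hb : ∀ t, 0 < t → |m t| ≤ 1)
    (h0 : Tendsto m atTop (𝓝 0)) :
    Tendsto (fun θ : ℝ => θ * ∫ t in Set.Ioi (0 : ℝ), Real.exp (-(θ * t)) * m t)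
      (𝓝[>] 0) (𝓝 0) := by
  have h1 : ∀ θ : ℝ, 0 < θ → θ * ∫ t in Set.Ioi (0 : ℝ), Real.exp (-(θ * t)) * m t =
      ∫ x in Set.Ioi (0 : ℝ), Real.exp (-x) * m (θ⁻¹ * x) := by
    intro θ hθ
    have := integral_comp_mul_left_Ioi (fun x => Real.exp (-x) * m (θ⁻¹ * x)) 0 hθ
    simp only [mul_zero, inv_mul_cancel_left₀ hθ.ne', smul_eq_mul] at this
    rw [this, mul_inv_cancel_left₀ hθ.ne']
  have h2 : Tendsto (fun θ : ℝ => ∫ x in Set.Ioi (0 : ℝ), Real.exp (-x) * m (θ⁻¹ * x))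
      (𝓝[>] 0) (𝓝 (∫ x in Set.Ioi (0 : ℝ), 0)) := by
    refine tendsto_integral_filter_of_dominated_convergence (fun x => Real.exp (-x)) ?_ ?_ ?_ ?_
    · exact Eventually.of_forall fun θ => Measurable.aestronglyMeasurable (by fun_prop)
    · filter_upwards [self_mem_nhdsWithin] with θ hθ
      refine (ae_restrict_iff' measurableSet_Ioi).2 (Eventually.of_forall fun x hx => ?_)
      rw [norm_mul, Real.norm_eq_abs, Real.abs_exp]
      exact mul_le_of_le_one_right (Real.exp_pos _).le
        (hb _ (mul_pos (inv_pos.2 hθ) hx))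
    · exact integrableOn_exp_neg_Ioi 0
    · refine (ae_restrict_iff' measurableSet_Ioi).2 (Eventually.of_forall fun x hx => ?_)
      have h3 := Tendsto.const_mul (Real.exp (-x))
        (h0.comp (tendsto_inv_nhdsGT_zero.atTop_mul_const hx))
      rwa [mul_zero] at h3
  rw [integral_zero] at h2
  refine h2.congr' ?_
  filter_upwards [self_mem_nhdsWithin] with θ hθ using (h1 θ hθ).symm

/-- The integrand at `κ + θ` is `e^{-θt}` times the one at `κ`, plus `θ e^{-θt} m(t)`. The first
part converges by domination, the second vanishes by the Abelian lemma. For `κ = 0`, `htail` says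
that the second process almost surely reaches `0`; without it, the limit would also count paths on
which only the first one does. -/
lemma tendsto_raceValue {κ : ℝ} (hκ : 0 ≤ κ) (a b : ℕ)
    (htail : Tendsto (fun t => Real.exp (-(κ * t)) * (1 - passageCDF lam' d' b t)) atTop (𝓝 0)) :
    Tendsto (fun θ => raceValue lam d lam' d' (κ + θ) a b) (𝓝[>] 0)
      (𝓝 (raceValue lam d lam' d' κ a b)) := by
  set F := passageCDF lam d a with hF
  have hFm : Measurable F := measurable_passageCDF lam d a
  have hF0 : ∀ t, 0 ≤ F t := passageCDF_nonneg lam d a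
  have hF1 : ∀ t, F t ≤ 1 := passageCDF_le_one lam d a
  have hGm : Measurable (passageCDF lam' d' b) := measurable_passageCDF lam' d' b
  have hG0 : ∀ t, 0 ≤ passageCDF lam' d' b t := passageCDF_nonneg lam' d' b
  have hG1 : ∀ t, passageCDF lam' d' b t ≤ 1 := passageCDF_le_one lam' d' b
  set w : ℝ → ℝ := fun t => Real.exp (-(κ * t)) * (F t * killedDensity lam' d' κ b t) with hw
  set m : ℝ → ℝ := fun t => F t * (Real.exp (-(κ * t)) * (1 - passageCDF lam' d' b t)) with hm
  have hkm := measurable_killedDensity lam' d' κ b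
  have hwi : IntegrableOn w (Set.Ioi 0) := by
    refine (integrableOn_exp_mul_killedDensity lam' d' hκ b).mono'
      (Measurable.aestronglyMeasurable (by fun_prop)) ?_
    refine (ae_restrict_iff' measurableSet_Ioi).2 (Eventually.of_forall fun t ht => ?_)
    rw [hw, norm_mul, Real.norm_eq_abs, Real.abs_exp, Real.norm_eq_abs, abs_mul,
      abs_of_nonneg (hF0 t), abs_of_nonneg (killedDensity_nonneg lam' d' hκ b ht)]
    exact mul_le_mul_of_nonneg_left (mul_le_of_le_one_left
      (killedDensity_nonneg lam' d' hκ b ht) (hF1 t)) (Real.exp_pos _).le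
  have hmb : ∀ t, 0 < t → |m t| ≤ 1 := by
    intro t ht
    have h1 : Real.exp (-(κ * t)) ≤ 1 := Real.exp_le_one_iff.2 (by nlinarith)
    have h2 := (Real.exp_pos (-(κ * t))).le
    rw [hm, abs_of_nonneg (mul_nonneg (hF0 t) (mul_nonneg h2 (by linarith [hG1 t])))]
    exact mul_le_one₀ (hF1 t) (mul_nonneg h2 (by linarith [hG1 t]))
      (mul_le_one₀ h1 (by linarith [hG1 t]) (by linarith [hG0 t]))
  have hmm : Measurable m := by fun_prop
  have hm0 : Tendsto m atTop (𝓝 0) := by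
    refine squeeze_zero (fun t => mul_nonneg (hF0 t) (mul_nonneg (Real.exp_pos _).le
      (by linarith [hG1 t]))) (fun t => ?_) htail
    exact mul_le_of_le_one_left (mul_nonneg (Real.exp_pos _).le (by linarith [hG1 t])) (hF1 t)
  have hdom : ∀ θ : ℝ, 0 < θ → ∀ᵐ t ∂volume.restrict (Set.Ioi (0 : ℝ)),
      ‖Real.exp (-(θ * t)) * w t‖ ≤ ‖w t‖ := by
    intro θ hθ
    refine (ae_restrict_iff' measurableSet_Ioi).2 (Eventually.of_forall fun t ht => ?_)
    have ht : (0 : ℝ) < t := ht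
    rw [norm_mul, Real.norm_eq_abs, Real.abs_exp]
    exact mul_le_of_le_one_left (norm_nonneg _) (Real.exp_le_one_iff.2 (by nlinarith))
  have hwm : Measurable w := by fun_prop
  have h1 : Tendsto (fun θ => ∫ t in Set.Ioi (0 : ℝ), Real.exp (-(θ * t)) * w t) (𝓝[>] 0)
      (𝓝 (∫ t in Set.Ioi (0 : ℝ), w t)) := by
    refine tendsto_integral_filter_of_dominated_convergence (fun t => ‖w t‖) ?_ ?_ hwi.norm ?_
    · exact Eventually.of_forall fun θ => Measurable.aestronglyMeasurable (by fun_prop)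
    · filter_upwards [self_mem_nhdsWithin] with θ hθ using hdom θ hθ
    · refine Eventually.of_forall fun t => ?_
      have : Tendsto (fun θ : ℝ => Real.exp (-(θ * t)) * w t) (𝓝 0)
          (𝓝 (Real.exp (-(0 * t)) * w t)) := Continuous.tendsto (by fun_prop) 0
      simp only [zero_mul, neg_zero, Real.exp_zero, one_mul] at this
      exact this.mono_left nhdsWithin_le_nhds
  have h2 := h1.add (tendsto_mul_integral_exp_neg hmm hmb hm0)
  rw [add_zero] at h2
  refine h2.congr' ?_
  filter_upwards [self_mem_nhdsWithin] with θ hθ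
  have hθ : 0 < θ := hθ
  rw [← integral_const_mul, ← integral_add]
  · refine integral_congr_ae (Eventually.of_forall fun t => ?_)
    simp only [hw, hm, killedDensity]
    have : Real.exp (-((κ + θ) * t)) = Real.exp (-(θ * t)) * Real.exp (-(κ * t)) := by
      rw [← Real.exp_add]; congr 1; ring
    rw [this]
    ring
  · exact hwi.norm.mono' (Measurable.aestronglyMeasurable (by fun_prop)) (hdom θ hθ)
  · exact (integrableOn_exp_neg_mul_bounded hθ hmm hmb).const_mul _

end RaceLimit

/-! ### Discounted harmonic functions of jump processes -/

section Harmonic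

set_option linter.unusedSectionVars false

variable {E : Type*} [Countable E] {Ω : Type*} [MeasurableSpace Ω] {P : Measure Ω}
  [IsProbabilityMeasure P] {rate : E → E → ℝ≥0} {Y : ℕ → Ω → E} {H : ℕ → Ω → ℝ≥0∞}

/-- `e^{-θ t}`, with values in `[0, ∞]`. -/
def discount (θ t : ℝ) : ℝ≥0∞ := ENNReal.ofReal (Real.exp (-(θ * t)))

@[fun_prop]
lemma measurable_discount (θ : ℝ) : Measurable (discount θ) := by unfold discount; fun_prop

lemma discount_le_one {θ t : ℝ} (hθ : 0 ≤ θ) (ht : 0 ≤ t) : discount θ t ≤ 1 := by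
  rw [discount, ← ENNReal.ofReal_one]
  exact ENNReal.ofReal_le_ofReal (Real.exp_le_one_iff.2 (by nlinarith))

lemma lintegral_discount_expKernel (θ r s : ℝ) :
    ∫⁻ h, discount θ (s + h) ∂expKernel r = discount θ s * (ENNReal.ofReal (r + θ))⁻¹ := by
  rw [lintegral_expKernel _ (by fun_prop)]
  have : ∀ h : ℝ, ENNReal.ofReal (Real.exp (-(r * h))) * discount θ (s + h) =
      discount θ s * ENNReal.ofReal (Real.exp (-((r + θ) * h))) := by
    intro h
    rw [discount, discount, ← ENNReal.ofReal_mul (Real.exp_pos _).le,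
      ← ENNReal.ofReal_mul (Real.exp_pos _).le, ← Real.exp_add, ← Real.exp_add]
    congr 2
    ring
  simp only [this]
  rw [lintegral_const_mul _ (by fun_prop), lintegral_exp_neg_mul_Ioi]
  simp

/-- `∑_{y'} q(y, y') u(y') = (q(y) + θ) u(y)` off `D`. -/
def IsDiscountedHarmonic (rate : E → E → ℝ≥0) (D : E → Prop) (θ : ℝ) (u : E → ℝ≥0∞) : Prop :=
  ∀ y, ¬ D y → ∑' y', (rate y y' : ℝ≥0∞) * u y' = ENNReal.ofReal (exitRate rate y + θ) * u y

/-- A holding time contributes `1 / (r + θ)` under discounting, which cancels the factor in the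
harmonic equation. Thus `e^{-θs} u(y)` is preserved by a step taken off `D`. -/
lemma IsDiscountedHarmonic.stepOp_eq {D : E → Prop} {θ : ℝ} (hθ : 0 < θ) {u : E → ℝ≥0∞}
    (hu : IsDiscountedHarmonic rate D θ u) {y : E} (hy : ¬ D y) (s : ℝ) :
    stepOp rate D (fun y s => discount θ s * u y) y s = discount θ s * u y := by
  simp only [stepOp, hy, if_false]
  have h1 : ∀ y', ∫⁻ h, discount θ (s + h) * u y' ∂expKernel (exitRate rate y) =
      discount θ s * (ENNReal.ofReal (exitRate rate y + θ))⁻¹ * u y' := by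
    intro y'
    rw [lintegral_mul_const _ (by fun_prop), lintegral_discount_expKernel]
  simp only [h1]
  have h2 : ∀ y', (rate y y' : ℝ≥0∞) *
      (discount θ s * (ENNReal.ofReal (exitRate rate y + θ))⁻¹ * u y') =
      discount θ s * (ENNReal.ofReal (exitRate rate y + θ))⁻¹ * (rate y y' * u y') := by
    intro y'; ring
  simp only [h2]
  rw [ENNReal.tsum_mul_left, hu y hy, mul_assoc, ← mul_assoc (ENNReal.ofReal _)⁻¹,
    ENNReal.inv_mul_cancel, one_mul]
  · simp only [ne_eq, ENNReal.ofReal_eq_zero, not_le]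
    positivity
  · exact ENNReal.ofReal_ne_top

lemma tendsto_discount_jumpTime {θ : ℝ} (hθ : 0 < θ) {x : ℕ → ℝ≥0∞}
    (hx : Tendsto x atTop (𝓝 ⊤)) :
    Tendsto (fun n => vanishTop (discount θ) (x n)) atTop (𝓝 0) := by
  rw [ENNReal.tendsto_nhds_zero]
  intro ε hε
  have h1 : Tendsto (fun M : ℝ => discount θ M) atTop (𝓝 0) := by
    rw [← ENNReal.ofReal_zero]
    refine ENNReal.tendsto_ofReal (Real.tendsto_exp_neg_atTop_nhds_zero.comp ?_)
    exact tendsto_id.const_mul_atTop hθ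
  obtain ⟨M, hM, hM0⟩ := ((ENNReal.tendsto_nhds_zero.1 h1 ε hε).and (eventually_ge_atTop 0)).exists
  filter_upwards [hx.eventually (lt_mem_nhds (ENNReal.ofReal_lt_top (r := M)))] with n hn
  rw [vanishTop]
  split_ifs with ht
  · exact bot_le
  · refine le_trans (ENNReal.ofReal_le_ofReal (Real.exp_le_exp.2 ?_)) hM
    have := (ENNReal.ofReal_le_iff_le_toReal ht).1 hn.le
    nlinarith

lemma IsJumpSkeleton.measurable_vanishTop_state (h : IsJumpSkeleton P rate Y H)
    {g : E → ℝ → ℝ≥0∞} (hg : ∀ y, Measurable (g y)) (n : ℕ) :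
    Measurable fun ω => vanishTop (g (Y n ω)) (jumpTime H n ω) := by
  classical
  have : (fun ω => vanishTop (g (Y n ω)) (jumpTime H n ω)) = fun ω =>
      ∑' y, Set.indicator {ω | Y n ω = y} (fun ω => vanishTop (g y) (jumpTime H n ω)) ω := by
    ext ω
    rw [tsum_eq_single (Y n ω)]
    · simp [Set.indicator]
    · intro y hy
      simp [Set.indicator, hy.symm]
  rw [this]
  exact Measurable.tsum fun y => ((measurable_vanishTop (hg y)).comp
    (h.measurable_jumpTime n)).indicator (h.measurableSet_state n y)

lemma IsJumpSkeleton.measurableSet_avoid (h : IsJumpSkeleton P rate Y H) (D : E → Prop) (b : E)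
    (n : ℕ) : MeasurableSet {ω | Y 0 ω = b ∧ ∀ k < n, ¬ D (Y k ω)} := by
  have : {ω | Y 0 ω = b ∧ ∀ k < n, ¬ D (Y k ω)} =
      {ω | Y 0 ω = b} ∩ ⋂ k, ⋂ (_ : k < n), {ω | ¬ D (Y k ω)} := by ext; simp
  rw [this]
  exact (h.measurableSet_state 0 b).inter (MeasurableSet.iInter fun k =>
    MeasurableSet.iInter fun _ => h.measurableSet_of_state k fun y => ¬ D y)

open Classical in
/-- A bounded discounted harmonic function is the discounted probability of leaving the complement
of `D` through its boundary values. -/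
lemma IsJumpSkeleton.tsum_discount_eq (h : IsJumpSkeleton P rate Y H)
    (hs : ∀ y, Summable (rate y)) (htop : ∀ᵐ ω ∂P, ∑' n, H n ω = ⊤)
    {D G : E → Prop} (hGD : ∀ y, G y → D y) {θ : ℝ} (hθ : 0 < θ) {u : E → ℝ≥0∞}
    (hu : IsDiscountedHarmonic rate D θ u) (hu1 : ∀ y, u y ≤ 1) (huG : ∀ y, G y → u y = 1)
    (huD : ∀ y, D y → ¬ G y → u y = 0) (b : E) :
    ∑' n, ∫⁻ ω in {ω | Y 0 ω = b ∧ ∀ k < n, ¬ D (Y k ω)},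
      vanishTop (fun s => if G (Y n ω) then discount θ s else 0) (jumpTime H n ω) ∂P =
      P {ω | Y 0 ω = b} * u b := by
  set J : ℕ → ℝ≥0∞ := fun n => ∫⁻ ω in {ω | Y 0 ω = b ∧ ∀ k < n, ¬ D (Y k ω)},
    vanishTop (fun s => discount θ s * u (Y n ω)) (jumpTime H n ω) ∂P with hJ
  set I : ℕ → ℝ≥0∞ := fun n => ∫⁻ ω in {ω | Y 0 ω = b ∧ ∀ k < n, ¬ D (Y k ω)},
      vanishTop (fun s => if G (Y n ω) then discount θ s else 0) (jumpTime H n ω) ∂P with hI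
  have hg : ∀ y, Measurable fun s => discount θ s * u y := fun y => by fun_prop
  have hJ0 : J 0 = P {ω | Y 0 ω = b} * u b := by
    have := h.setLIntegral_avoid hs D b 0 hg
    simp only [Function.iterate_zero, id] at this
    simp only [hJ, this]
    simp [discount]
  -- At each step the mass in `G` is collected, the mass in the rest of `D` is lost, and the mass
  -- off `D` is carried to the next jump by harmonicity.
  have hrec : ∀ n, J n = I n + J (n + 1) := by
    intro n
    have hgI : ∀ y, Measurable fun s => if G y then discount θ s else 0 := fun y => by
      split_ifs <;> fun_prop
    rw [hJ, hI]
    simp only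
    rw [h.setLIntegral_avoid_succ hs hg, ← lintegral_add_left
      (h.measurable_vanishTop_state (g := fun y s => if G y then discount θ s else 0) hgI n)]
    refine lintegral_congr fun ω => ?_
    simp only [vanishTop]
    split_ifs with h1 h2
    · simp
    · rw [huG _ h2, mul_one]
      simp [stepOp, hGD _ h2]
    · by_cases hD : D (Y n ω)
      · rw [huD _ hD h2]
        simp [stepOp, hD]
      · rw [hu.stepOp_eq hθ hD, zero_add]
  have hsum : ∀ n, J 0 = ∑ k ∈ Finset.range n, I k + J n := by
    intro n
    induction n with
    | zero => simp
    | succ n ih => rw [ih, hrec n, Finset.sum_range_succ, add_assoc]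
  -- This is where `θ > 0` and non-explosion are needed: the jump times tend to infinity, so the
  -- discounted remainder vanishes.
  have hJlim : Tendsto J atTop (𝓝 0) := by
    have hle : ∀ n, J n ≤ ∫⁻ ω, vanishTop (discount θ) (jumpTime H n ω) ∂P := by
      intro n
      refine (setLIntegral_le_lintegral _ _).trans (lintegral_mono fun ω => ?_)
      simp only [vanishTop]
      split_ifs
      · exact le_rfl
      · exact mul_le_of_le_one_right' (hu1 _)
    have hlim : Tendsto (fun n => ∫⁻ ω, vanishTop (discount θ) (jumpTime H n ω) ∂P) atTop
        (𝓝 (∫⁻ _, 0 ∂P)) := by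
      refine tendsto_lintegral_of_dominated_convergence (fun _ => 1)
        (fun n => (measurable_vanishTop (by fun_prop)).comp (h.measurable_jumpTime n))
        (fun n => Eventually.of_forall fun ω => ?_) (by simp) ?_
      · simp only [vanishTop]
        split_ifs
        · exact zero_le_one
        · exact discount_le_one hθ.le ENNReal.toReal_nonneg
      · filter_upwards [htop] with ω hω
        refine tendsto_discount_jumpTime hθ ?_
        rw [← hω]
        exact ENNReal.tendsto_nat_tsum _
    rw [lintegral_zero] at hlim
    exact tendsto_of_tendsto_of_tendsto_of_le_of_le tendsto_const_nhds hlim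
      (fun _ => bot_le) hle
  rw [← hJ0]
  have hlim := (ENNReal.tendsto_nat_tsum I).add hJlim
  rw [add_zero] at hlim
  refine tendsto_nhds_unique hlim ?_
  simp only [← hsum]
  exact tendsto_const_nhds

/-- The probability of leaving the complement of `D` through `G`, as a limit of discounted harmonic
functions. -/
lemma IsJumpSkeleton.measure_exit_eq (h : IsJumpSkeleton P rate Y H)
    (hs : ∀ y, Summable (rate y)) (htop : ∀ᵐ ω ∂P, ∑' n, H n ω = ⊤)
    {D G : E → Prop} (hGD : ∀ y, G y → D y) {u : ℝ → E → ℝ≥0∞}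
    (hu : ∀ θ, 0 < θ → IsDiscountedHarmonic rate D θ (u θ)) (hu1 : ∀ θ, 0 < θ → ∀ y, u θ y ≤ 1)
    (huG : ∀ θ, 0 < θ → ∀ y, G y → u θ y = 1) (huD : ∀ θ, 0 < θ → ∀ y, D y → ¬ G y → u θ y = 0)
    (b : E) {v : ℝ≥0∞} (hv : Tendsto (fun θ => u θ b) (𝓝[>] 0) (𝓝 v)) :
    P {ω | Y 0 ω = b ∧ ∃ n, (∀ k < n, ¬ D (Y k ω)) ∧ G (Y n ω) ∧ jumpTime H n ω ≠ ⊤} =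
      P {ω | Y 0 ω = b} * v := by
  classical
  set I : ℝ → ℕ → ℝ≥0∞ := fun θ n => ∫⁻ ω in {ω | Y 0 ω = b ∧ ∀ k < n, ¬ D (Y k ω)},
      vanishTop (fun s => if G (Y n ω) then discount θ s else 0) (jumpTime H n ω) ∂P with hI
  have hgI : ∀ θ y, Measurable fun s => if G y then discount θ s else 0 := fun θ y => by
    split_ifs <;> fun_prop
  have hsum : ∀ θ, 0 < θ → ∑' n, I θ n = P {ω | Y 0 ω = b} * u θ b := fun θ hθ =>
    h.tsum_discount_eq hs htop hGD hθ (hu θ hθ) (hu1 θ hθ) (huG θ hθ) (huD θ hθ) b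
  have hle : ∀ θ, 0 ≤ θ → ∀ n ω,
      vanishTop (fun s => if G (Y n ω) then discount θ s else 0) (jumpTime H n ω) ≤ 1 := by
    intro θ hθ n ω
    simp only [vanishTop]
    split_ifs
    · exact zero_le_one
    · exact discount_le_one hθ ENNReal.toReal_nonneg
    · exact zero_le_one
  have hIlim : ∀ n, Tendsto (fun θ => I θ n) (𝓝[>] 0) (𝓝 (I 0 n)) := by
    intro n
    refine tendsto_lintegral_filter_of_dominated_convergence (fun _ => 1) ?_ ?_ (by simp) ?_
    · exact Eventually.of_forall fun θ => h.measurable_vanishTop_state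
        (g := fun y s => if G y then discount θ s else 0) (hgI θ) n
    · filter_upwards [self_mem_nhdsWithin] with θ hθ
      exact Eventually.of_forall fun ω => hle θ (le_of_lt hθ) n ω
    · refine Eventually.of_forall fun ω => ?_
      simp only [vanishTop]
      split_ifs
      · exact tendsto_const_nhds
      · refine Tendsto.mono_left ?_ nhdsWithin_le_nhds
        refine ENNReal.tendsto_ofReal (Continuous.tendsto ?_ 0)
        fun_prop
      · exact tendsto_const_nhds
  have hmono : ∀ θ, 0 < θ → ∑' n, I θ n ≤ ∑' n, I 0 n := by
    intro θ hθ
    refine ENNReal.tsum_le_tsum fun n => lintegral_mono fun ω => ?_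
    simp only [vanishTop]
    split_ifs
    · exact le_rfl
    · refine (discount_le_one hθ.le ENNReal.toReal_nonneg).trans ?_
      simp [discount]
    · exact le_rfl
  have hvlim : Tendsto (fun θ => P {ω | Y 0 ω = b} * u θ b) (𝓝[>] 0)
      (𝓝 (P {ω | Y 0 ω = b} * v)) :=
    ENNReal.Tendsto.const_mul hv (Or.inr (measure_ne_top _ _))
  -- Finite partial sums pass to the limit term by term and give the upper bound; monotonicity in
  -- `θ` gives the lower bound.
  have hI0 : ∑' n, I 0 n = P {ω | Y 0 ω = b} * v := by
    refine le_antisymm ?_ ?_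
    · rw [ENNReal.tsum_eq_iSup_nat]
      refine iSup_le fun N => ?_
      refine le_of_tendsto_of_tendsto (tendsto_finsetSum _ fun n _ => hIlim n) hvlim ?_
      filter_upwards [self_mem_nhdsWithin] with θ hθ
      rw [← hsum θ hθ]
      exact ENNReal.sum_le_tsum _
    · refine le_of_tendsto hvlim ?_
      filter_upwards [self_mem_nhdsWithin] with θ hθ
      rw [← hsum θ hθ]
      exact hmono θ hθ
  have hGm : ∀ n, MeasurableSet {ω | G (Y n ω) ∧ jumpTime H n ω ≠ ⊤} := fun n =>
    (h.measurableSet_of_state n G).inter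
      ((h.measurable_jumpTime n) (measurableSet_singleton ⊤)).compl
  have hI0' : ∀ n, I 0 n = P ({ω | Y 0 ω = b ∧ ∀ k < n, ¬ D (Y k ω)} ∩
      {ω | G (Y n ω) ∧ jumpTime H n ω ≠ ⊤}) := by
    intro n
    rw [Set.inter_comm, ← Measure.restrict_apply (hGm n), ← lintegral_indicator_one (hGm n)]
    refine lintegral_congr fun ω => ?_
    by_cases h1 : G (Y n ω) <;> by_cases h2 : jumpTime H n ω = ⊤ <;>
      simp [vanishTop, Set.indicator, h1, h2, discount]
  rw [← hI0]
  simp only [hI0']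
  -- The events are disjoint because the index of the first visit to `D` is unique.
  rw [← measure_iUnion]
  · congr 1
    ext ω
    simp only [Set.mem_ofPred_eq, Set.mem_iUnion, Set.mem_inter_iff]
    constructor
    · rintro ⟨h0, n, h1, h2⟩
      exact ⟨n, ⟨h0, h1⟩, h2⟩
    · rintro ⟨n, ⟨h0, h1⟩, h2⟩
      exact ⟨h0, n, h1, h2⟩
  · intro n m hnm
    refine Set.disjoint_left.2 fun ω h1 h2 => ?_
    rcases lt_or_gt_of_ne hnm with hlt | hlt
    · exact h2.1.2 n hlt (hGD _ h1.2.1)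
    · exact h1.1.2 m hlt (hGD _ h2.2.1)
  · exact fun n => (h.measurableSet_avoid D b n).inter (hGm n)

end Harmonic

/-! ### Best quotes -/

namespace Book

variable {N : ℕ} {b : Book N}

lemma queue_of_notMem {l : ℕ} (h : l ∉ Finset.Icc 1 N) : b.queue l = 0 := dif_neg h

/-- A description by queue signs alone, in which `p ≤ N` accounts for the default value `N + 1`. It
makes later statements about quotes accessible to linear arithmetic. -/
lemma lt_bestAsk_iff {p : ℕ} : p < b.bestAsk ↔ p ≤ N ∧ ∀ l ≤ p, b.queue l ≤ 0 := by
  rw [bestAsk]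
  constructor
  · intro h
    refine ⟨?_, fun l hl => ?_⟩
    · have := Nat.sInf_le (show N + 1 ∈ {l | 0 < b.queue l} ∪ {N + 1} from Or.inr rfl)
      omega
    · by_contra hq
      have := Nat.sInf_le (show l ∈ {l | 0 < b.queue l} ∪ {N + 1} from Or.inl (not_le.1 hq))
      omega
  · rintro ⟨h1, h2⟩
    rcases Nat.sInf_mem (s := {l | 0 < b.queue l} ∪ {N + 1}) ⟨_, Or.inr rfl⟩ with h | h
    · by_contra hlt
      exact absurd (h2 _ (not_lt.1 hlt)) (not_le.2 h)
    · have : sInf ({l | 0 < b.queue l} ∪ {N + 1}) = N + 1 := h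
      omega

lemma bestAsk_eq_iff {p : ℕ} (hp : p ≤ N) :
    b.bestAsk = p ↔ 0 < b.queue p ∧ ∀ l < p, b.queue l ≤ 0 := by
  constructor
  · rintro rfl
    refine ⟨?_, fun l hl => (lt_bestAsk_iff.1 hl).2 l le_rfl⟩
    by_contra hq
    refine lt_irrefl b.bestAsk (lt_bestAsk_iff.2 ⟨hp, fun l hl => ?_⟩)
    rcases hl.lt_or_eq with hl | hl
    · exact (lt_bestAsk_iff.1 hl).2 l le_rfl
    · rw [hl]; exact not_lt.1 hq
  · rintro ⟨h1, h2⟩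
    refine le_antisymm ?_ ?_
    · by_contra hlt
      exact absurd ((lt_bestAsk_iff.1 (not_le.1 hlt)).2 p le_rfl) (not_le.2 h1)
    · by_contra hlt
      have h3 : b.bestAsk < p := not_le.1 hlt
      rcases Nat.sInf_mem (s := {l | 0 < b.queue l} ∪ {N + 1}) ⟨_, Or.inr rfl⟩ with h | h
      · exact absurd (h2 _ h3) (not_le.2 h)
      · have : b.bestAsk = N + 1 := h
        omega

lemma bddAbove_bid (b : Book N) : BddAbove ({l | b.queue l < 0} ∪ {0}) := by
  refine ⟨N, ?_⟩
  rintro l (hl | hl)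
  · by_contra h
    have : b.queue l = 0 := queue_of_notMem (by simp only [Finset.mem_Icc]; omega)
    have hl : b.queue l < 0 := hl
    omega
  · have : l = 0 := hl
    omega

lemma bestBid_lt_iff {p : ℕ} : b.bestBid < p ↔ 0 < p ∧ ∀ l, p ≤ l → 0 ≤ b.queue l := by
  rw [bestBid]
  constructor
  · intro h
    refine ⟨by omega, fun l hl => ?_⟩
    by_contra hq
    have := le_csSup b.bddAbove_bid (show l ∈ {l | b.queue l < 0} ∪ {0} from Or.inl (not_le.1 hq))
    omega
  · rintro ⟨h1, h2⟩
    rcases Nat.sSup_mem (s := {l | b.queue l < 0} ∪ {0}) ⟨_, Or.inr rfl⟩ b.bddAbove_bid with h | h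
    · by_contra hlt
      exact absurd (h2 _ (not_lt.1 hlt)) (not_le.2 h)
    · have : sSup ({l | b.queue l < 0} ∪ {0}) = 0 := h
      omega

lemma bestBid_eq_iff {p : ℕ} (hp : 1 ≤ p) :
    b.bestBid = p ↔ b.queue p < 0 ∧ ∀ l, p < l → 0 ≤ b.queue l := by
  constructor
  · rintro rfl
    refine ⟨?_, fun l hl => (bestBid_lt_iff.1 hl).2 l le_rfl⟩
    by_contra hq
    refine lt_irrefl b.bestBid (bestBid_lt_iff.2 ⟨hp, fun l hl => ?_⟩)
    rcases hl.lt_or_eq with hl | hl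
    · exact (bestBid_lt_iff.1 hl).2 l le_rfl
    · rw [← hl]; exact not_lt.1 hq
  · rintro ⟨h1, h2⟩
    refine le_antisymm ?_ ?_
    · by_contra hlt
      rcases Nat.sSup_mem (s := {l | b.queue l < 0} ∪ {0}) ⟨_, Or.inr rfl⟩ b.bddAbove_bid
        with h | h
      · exact absurd (h2 _ (not_le.1 hlt)) (not_le.2 h)
      · have : b.bestBid = 0 := h
        omega
    · exact le_csSup b.bddAbove_bid (Or.inl h1)

/-- The book with `δ` added to the queue at level `l`. -/
def shift (b : Book N) (l : ℕ) (δ : ℤ) : Book N := fun m => if (m : ℕ) = l then b m + δ else b m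

lemma shift_eq_update (b : Book N) (l : Finset.Icc 1 N) (δ : ℤ) :
    b.shift l δ = Function.update b l (b l + δ) := by
  ext m
  simp only [shift, Function.update_apply]
  by_cases h : m = l
  · subst h; simp
  · rw [if_neg h, if_neg (fun h' => h (Subtype.ext h'))]

lemma queue_shift_self {l : ℕ} (hl : l ∈ Finset.Icc 1 N) (δ : ℤ) :
    (b.shift l δ).queue l = b.queue l + δ := by
  simp only [queue, hl, dif_pos, shift]
  simp

lemma queue_shift_of_ne {l m : ℕ} (h : m ≠ l) (δ : ℤ) : (b.shift l δ).queue m = b.queue m := by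
  by_cases hm : m ∈ Finset.Icc 1 N
  · simp only [queue, hm, dif_pos, shift]
    rw [if_neg h]
  · rw [queue_of_notMem hm, queue_of_notMem hm]

end Book

/-! ### Effect of a single order on functions of the top of the book -/

namespace OrderFlow

variable {N : ℕ} {𝒳 : Type*} (F : OrderFlow N 𝒳)

/-- Each level admits two moves, so the generator is a finite sum. The choice `c = 1` gives
summability of the rates and the exit rate. -/
lemma tsum_bookRate_mul (b : Book N) (c : Book N → ℝ≥0∞) :
    ∑' b', (F.bookRate b b' : ℝ≥0∞) * c b' =
      ∑ l ∈ Finset.Icc 1 N,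
        ((F.upRate b l : ℝ≥0∞) * c (b.shift l 1) + F.downRate b l * c (b.shift l (-1))) := by
  rw [← Finset.sum_coe_sort]
  have h1 : ∀ b', (F.bookRate b b' : ℝ≥0∞) * c b' = ∑ l : Finset.Icc 1 N,
      ((if b' = b.shift l 1 then (F.upRate b l : ℝ≥0∞) * c (b.shift l 1) else 0) +
        if b' = b.shift l (-1) then (F.downRate b l : ℝ≥0∞) * c (b.shift l (-1)) else 0) := by
    intro b'
    rw [bookRate, ENNReal.ofNNReal_finsetSum, Finset.sum_mul]
    refine Finset.sum_congr rfl fun l _ => ?_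
    rw [ENNReal.coe_add, add_mul, Book.shift_eq_update, Book.shift_eq_update, ← sub_eq_add_neg]
    congr 1 <;>
    · split_ifs with h
      · rw [h]
      · simp
  simp only [h1]
  rw [Summable.tsum_finsetSum fun _ _ => ENNReal.summable]
  refine Finset.sum_congr rfl fun l _ => ?_
  rw [ENNReal.tsum_add, tsum_ite_eq, tsum_ite_eq]

lemma summable_bookRate (b : Book N) : Summable (F.bookRate b) := by
  rw [← ENNReal.tsum_coe_ne_top_iff_summable]
  have := F.tsum_bookRate_mul b (fun _ => 1)
  simp only [mul_one] at this
  rw [this]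
  exact ENNReal.sum_ne_top.2 fun l _ => ENNReal.add_ne_top.2 ⟨ENNReal.coe_ne_top, ENNReal.coe_ne_top⟩

lemma exitRate_bookRate (b : Book N) :
    exitRate F.bookRate b = ∑ l ∈ Finset.Icc 1 N, (F.upRate b l + F.downRate b l) := by
  have := F.tsum_bookRate_mul b (fun _ => 1)
  simp only [mul_one] at this
  rw [← ENNReal.coe_tsum (F.summable_bookRate b)] at this
  exact_mod_cast this

/-- Value of a function of the sizes `(k_A, k_B)` at the quotes `(p_A, p_B)`, extended by constants
to the books in which exactly one quote has moved away from the other side, and by `0` to the other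
books with different quotes. -/
def topValue (W : ℕ → ℕ → ℝ) (vA vB : ℝ) (pA pB : ℕ) (b : Book N) : ℝ :=
  if b.bestAsk = pA ∧ b.bestBid = pB then W (b.size pA) (b.size pB)
  else if pA < b.bestAsk ∧ b.bestBid = pB then vA
  else if b.bestAsk = pA ∧ b.bestBid < pB then vB
  else 0

variable {W : ℕ → ℕ → ℝ} {vA vB : ℝ} {pA pB : ℕ} {b : Book N}

/-- If the removed order is the last one, the ask moves up to an unspecified level; this is
immaterial because `topValue` takes there the constant `vA`, which equals `W 0 (k + 1)`, the bid
queue being nonempty. -/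
lemma topValue_shift_ask (hpA : pA ≤ N) (hpB : 1 ≤ pB) (hlt : pB < pA)
    (hA : b.bestAsk = pA) (hB : b.bestBid = pB) (hW : ∀ k, W 0 (k + 1) = vA) :
    topValue W vA vB pA pB (b.shift pA 1) = W (b.size pA + 1) (b.size pB) ∧
      topValue W vA vB pA pB (b.shift pA (-1)) = W (b.size pA - 1) (b.size pB) := by
  have hmem : pA ∈ Finset.Icc 1 N := Finset.mem_Icc.2 ⟨by omega, hpA⟩
  obtain ⟨a1, a2⟩ := (Book.bestAsk_eq_iff hpA).1 hA
  obtain ⟨b1, b2⟩ := (Book.bestBid_eq_iff hpB).1 hB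
  have hself := fun δ => Book.queue_shift_self (b := b) hmem δ
  have hne := fun {m : ℕ} (h : m ≠ pA) δ => Book.queue_shift_of_ne (b := b) h δ
  have hbid : ∀ δ, 0 ≤ b.queue pA + δ → (b.shift pA δ).bestBid = pB := by
    intro δ hδ
    refine (Book.bestBid_eq_iff hpB).2 ⟨by rwa [hne (by omega)], fun l hl => ?_⟩
    by_cases hlp : l = pA
    · rw [hlp, hself]; exact hδ
    · rw [hne hlp]; exact b2 l hl
  have hask : ∀ δ, 0 < b.queue pA + δ → (b.shift pA δ).bestAsk = pA := by
    intro δ hδ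
    refine (Book.bestAsk_eq_iff hpA).2 ⟨by rwa [hself], fun l hl => ?_⟩
    rw [hne (by omega)]; exact a2 l hl
  have hsB : ∀ δ, (b.shift pA δ).size pB = b.size pB := fun δ => by
    rw [Book.size, Book.size, hne (by omega)]
  refine ⟨?_, ?_⟩
  · rw [topValue, if_pos ⟨hask 1 (by omega), hbid 1 (by omega)⟩, hsB]
    congr 1
    rw [Book.size, Book.size, hself]
    omega
  · by_cases h1 : b.queue pA = 1
    · have hask' : pA < (b.shift pA (-1)).bestAsk := by
        refine Book.lt_bestAsk_iff.2 ⟨hpA, fun l hl => ?_⟩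
        by_cases hlp : l = pA
        · rw [hlp, hself]; omega
        · rw [hne hlp]; exact a2 l (by omega)
      rw [topValue, if_neg (fun h => by omega), if_pos ⟨hask', hbid _ (by omega)⟩]
      have e1 : b.size pA - 1 = 0 := by rw [Book.size, h1]; rfl
      obtain ⟨k, hk⟩ : ∃ k, b.size pB = k + 1 := ⟨b.size pB - 1, by rw [Book.size]; omega⟩
      rw [e1, hk, hW]
    · rw [topValue, if_pos ⟨hask (-1) (by omega), hbid (-1) (by omega)⟩, hsB]
      congr 1
      rw [Book.size, Book.size, hself]
      omega

lemma topValue_shift_bid (hpA : pA ≤ N) (hpB : 1 ≤ pB) (hlt : pB < pA)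
    (hA : b.bestAsk = pA) (hB : b.bestBid = pB) (hW : ∀ k, W (k + 1) 0 = vB) :
    topValue W vA vB pA pB (b.shift pB (-1)) = W (b.size pA) (b.size pB + 1) ∧
      topValue W vA vB pA pB (b.shift pB 1) = W (b.size pA) (b.size pB - 1) := by
  have hmem : pB ∈ Finset.Icc 1 N := Finset.mem_Icc.2 ⟨hpB, by omega⟩
  obtain ⟨a1, a2⟩ := (Book.bestAsk_eq_iff hpA).1 hA
  obtain ⟨b1, b2⟩ := (Book.bestBid_eq_iff hpB).1 hB
  have hself := fun δ => Book.queue_shift_self (b := b) hmem δ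
  have hne := fun {m : ℕ} (h : m ≠ pB) δ => Book.queue_shift_of_ne (b := b) h δ
  have hask : ∀ δ, b.queue pB + δ ≤ 0 → (b.shift pB δ).bestAsk = pA := by
    intro δ hδ
    refine (Book.bestAsk_eq_iff hpA).2 ⟨by rwa [hne (by omega)], fun l hl => ?_⟩
    by_cases hlp : l = pB
    · rw [hlp, hself]; exact hδ
    · rw [hne hlp]; exact a2 l hl
  have hbid : ∀ δ, b.queue pB + δ < 0 → (b.shift pB δ).bestBid = pB := by
    intro δ hδ
    refine (Book.bestBid_eq_iff hpB).2 ⟨by rwa [hself], fun l hl => ?_⟩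
    rw [hne (by omega)]; exact b2 l hl
  have hsA : ∀ δ, (b.shift pB δ).size pA = b.size pA := fun δ => by
    rw [Book.size, Book.size, hne (by omega)]
  refine ⟨?_, ?_⟩
  · rw [topValue, if_pos ⟨hask (-1) (by omega), hbid (-1) (by omega)⟩, hsA]
    congr 1
    rw [Book.size, Book.size, hself]
    omega
  · by_cases h1 : b.queue pB = -1
    · have hbid' : (b.shift pB 1).bestBid < pB := by
        refine Book.bestBid_lt_iff.2 ⟨hpB, fun l hl => ?_⟩
        by_cases hlp : l = pB
        · rw [hlp, hself]; omega
        · rw [hne hlp]; exact b2 l (by omega)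
      have hask' := hask 1 (by omega)
      rw [topValue, if_neg (fun h => by omega), if_neg (fun h => by omega),
        if_pos ⟨hask', hbid'⟩]
      have e1 : b.size pB - 1 = 0 := by rw [Book.size, h1]; rfl
      obtain ⟨k, hk⟩ : ∃ k, b.size pA = k + 1 := ⟨b.size pA - 1, by rw [Book.size]; omega⟩
      rw [e1, hk, hW]
    · rw [topValue, if_pos ⟨hask 1 (by omega), hbid 1 (by omega)⟩, hsA]
      congr 1
      rw [Book.size, Book.size, hself]
      omega

/-- An order inside the spread moves one quote inwards, where the value is `0`. In the generator
these moves therefore act as killing. -/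
lemma topValue_shift_inside (hpA : pA ≤ N) (hpB : 1 ≤ pB) {l : ℕ} (hl1 : pB < l) (hl2 : l < pA)
    (hA : b.bestAsk = pA) (hB : b.bestBid = pB) :
    topValue W vA vB pA pB (b.shift l 1) = 0 ∧ topValue W vA vB pA pB (b.shift l (-1)) = 0 := by
  have hmem : l ∈ Finset.Icc 1 N := Finset.mem_Icc.2 ⟨by omega, by omega⟩
  obtain ⟨a1, a2⟩ := (Book.bestAsk_eq_iff hpA).1 hA
  obtain ⟨b1, b2⟩ := (Book.bestBid_eq_iff hpB).1 hB
  have h0 : b.queue l = 0 := le_antisymm (a2 l hl2) (b2 l hl1)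
  have hself := fun δ => Book.queue_shift_self (b := b) hmem δ
  have hne := fun {m : ℕ} (h : m ≠ l) δ => Book.queue_shift_of_ne (b := b) h δ
  refine ⟨?_, ?_⟩
  · have h1 : (b.shift l 1).bestAsk = l := by
      refine (Book.bestAsk_eq_iff (by omega)).2 ⟨by rw [hself]; omega, fun m hm => ?_⟩
      rw [hne (by omega)]; exact a2 m (by omega)
    rw [topValue, if_neg (fun h => by omega), if_neg (fun h => by omega),
      if_neg (fun h => by omega)]
  · have h1 : (b.shift l (-1)).bestBid = l := by
      refine (Book.bestBid_eq_iff (by omega)).2 ⟨by rw [hself]; omega, fun m hm => ?_⟩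
      rw [hne (by omega)]; exact b2 m (by omega)
    rw [topValue, if_neg (fun h => by omega), if_neg (fun h => by omega),
      if_neg (fun h => by omega)]

/-- The sign condition prevents a level beyond the ask from acquiring bids, or one below the bid
from acquiring asks. The quotes and the sizes at them then stay as they are. -/
lemma topValue_shift_outside (hpA : pA ≤ N) (hpB : 1 ≤ pB) (hlt : pB < pA) {l : ℕ}
    (hmem : l ∈ Finset.Icc 1 N) (hA : b.bestAsk = pA) (hB : b.bestBid = pB) {δ : ℤ}
    (h : (pA < l ∧ 0 ≤ b.queue l + δ) ∨ (l < pB ∧ b.queue l + δ ≤ 0)) :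
    topValue W vA vB pA pB (b.shift l δ) = topValue W vA vB pA pB b := by
  obtain ⟨a1, a2⟩ := (Book.bestAsk_eq_iff hpA).1 hA
  obtain ⟨b1, b2⟩ := (Book.bestBid_eq_iff hpB).1 hB
  have hself := fun δ => Book.queue_shift_self (b := b) hmem δ
  have hne := fun {m : ℕ} (h : m ≠ l) δ => Book.queue_shift_of_ne (b := b) h δ
  have hask : (b.shift l δ).bestAsk = pA := by
    refine (Book.bestAsk_eq_iff hpA).2 ⟨by rwa [hne (by omega)], fun m hm => ?_⟩
    by_cases hml : m = l
    · rw [hml, hself]; omega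
    · rw [hne hml]; exact a2 m hm
  have hbid : (b.shift l δ).bestBid = pB := by
    refine (Book.bestBid_eq_iff hpB).2 ⟨by rwa [hne (by omega)], fun m hm => ?_⟩
    by_cases hml : m = l
    · rw [hml, hself]; omega
    · rw [hne hml]; exact b2 m hm
  rw [topValue, topValue, if_pos ⟨hask, hbid⟩, if_pos ⟨hA, hB⟩, Book.size, Book.size, Book.size,
    Book.size, hne (by omega), hne (by omega)]

end OrderFlow

/-! ### The generator of the book on functions of the top queues -/

namespace OrderFlow

variable {N : ℕ} {𝒳 : Type*} (F : OrderFlow N 𝒳)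

lemma upRate_ask_quote {b : Book N} {pA pB : ℕ} (hpA : pA ≤ N) (hlt : pB < pA)
    (hA : b.bestAsk = pA) (hB : b.bestBid = pB) :
    F.upRate b pA = F.limitRate .ask (b.size pA) (F.factor b pA) := by
  obtain ⟨a1, a2⟩ := (Book.bestAsk_eq_iff hpA).1 hA
  rw [upRate, if_pos (by omega), if_neg (by omega), if_neg (by omega), add_zero, add_zero]

lemma downRate_ask_quote {b : Book N} {pA : ℕ} (hpA : pA ≤ N) (hA : b.bestAsk = pA) :
    F.downRate b pA = F.marketRate .ask (b.size pA) (F.factor b pA) +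
      F.cancelRate .ask (b.size pA) (F.factor b pA) := by
  obtain ⟨a1, a2⟩ := (Book.bestAsk_eq_iff hpA).1 hA
  rw [downRate, if_neg (by omega), if_pos (by omega), if_pos (by omega), zero_add]

lemma upRate_bid_quote {b : Book N} {pB : ℕ} (hpB : 1 ≤ pB) (hB : b.bestBid = pB) :
    F.upRate b pB = F.marketRate .bid (b.size pB) (F.factor b pB) +
      F.cancelRate .bid (b.size pB) (F.factor b pB) := by
  obtain ⟨b1, b2⟩ := (Book.bestBid_eq_iff hpB).1 hB
  rw [upRate, if_neg (by omega), if_pos (by omega), if_pos (by omega), zero_add]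

lemma downRate_bid_quote {b : Book N} {pA pB : ℕ} (hpB : 1 ≤ pB) (hlt : pB < pA)
    (hA : b.bestAsk = pA) (hB : b.bestBid = pB) :
    F.downRate b pB = F.limitRate .bid (b.size pB) (F.factor b pB) := by
  obtain ⟨b1, b2⟩ := (Book.bestBid_eq_iff hpB).1 hB
  rw [downRate, if_pos (by omega), if_neg (by omega), if_neg (by omega), add_zero, add_zero]

lemma rates_inside {b : Book N} {pA pB l : ℕ} (hpA : pA ≤ N) (hpB : 1 ≤ pB) (hl1 : pB < l)
    (hl2 : l < pA) (hA : b.bestAsk = pA) (hB : b.bestBid = pB) :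
    F.upRate b l = F.limitRate .ask 0 (F.factor b l) ∧
      F.downRate b l = F.limitRate .bid 0 (F.factor b l) := by
  obtain ⟨a1, a2⟩ := (Book.bestAsk_eq_iff hpA).1 hA
  obtain ⟨b1, b2⟩ := (Book.bestBid_eq_iff hpB).1 hB
  have h0 : b.queue l = 0 := le_antisymm (a2 l hl2) (b2 l hl1)
  have hs : b.size l = 0 := by rw [Book.size, h0]; rfl
  rw [upRate, downRate, hs, if_pos (by omega), if_neg (by omega), if_neg (by omega),
    if_pos (by omega), if_neg (by omega), if_neg (by omega)]
  simp

/-- First-step equation for functions of the sizes at the best quotes. -/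
lemma topValue_harmonic {W : ℕ → ℕ → ℝ} {vA vB θ : ℝ} {pA pB s₀ : ℕ} {b : Book N} {x : ℕ → 𝒳}
    {Λ : ℝ≥0} (hpA : pA ≤ N) (hpB : 1 ≤ pB) (hs₀ : 1 ≤ s₀) (hsp : pA = pB + s₀)
    (hA : b.bestAsk = pA) (hB : b.bestBid = pB) (hx : ∀ m ≤ s₀, F.factor b (pB + m) = x m)
    (hΛask : Λ = ∑ m ∈ Finset.Icc 1 (s₀ - 1), F.limitRate .ask 0 (x (s₀ - m)))
    (hΛbid : Λ = ∑ m ∈ Finset.Icc 1 (s₀ - 1), F.limitRate .bid 0 (x m))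
    (hWA : ∀ k, W 0 (k + 1) = vA) (hWB : ∀ k, W (k + 1) 0 = vB)
    (hstep : ∀ a k : ℕ, (F.limitRate .ask (a + 1) (x s₀) +
        ((F.marketRate .ask (a + 1) (x s₀) + F.cancelRate .ask (a + 1) (x s₀) : ℝ≥0) : ℝ) +
        F.limitRate .bid (k + 1) (x 0) +
        ((F.marketRate .bid (k + 1) (x 0) + F.cancelRate .bid (k + 1) (x 0) : ℝ≥0) : ℝ) +
        (2 * Λ + θ)) * W (a + 1) (k + 1) =
      F.limitRate .ask (a + 1) (x s₀) * W (a + 2) (k + 1) +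
        ((F.marketRate .ask (a + 1) (x s₀) + F.cancelRate .ask (a + 1) (x s₀) : ℝ≥0) : ℝ) *
          W a (k + 1) +
        F.limitRate .bid (k + 1) (x 0) * W (a + 1) (k + 2) +
        ((F.marketRate .bid (k + 1) (x 0) + F.cancelRate .bid (k + 1) (x 0) : ℝ≥0) : ℝ) *
          W (a + 1) k) :
    ∑ l ∈ Finset.Icc 1 N, ((F.upRate b l : ℝ) * topValue W vA vB pA pB (b.shift l 1) +
      F.downRate b l * topValue W vA vB pA pB (b.shift l (-1))) =
      (exitRate F.bookRate b + θ) * topValue W vA vB pA pB b := by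
  set T := topValue (N := N) W vA vB pA pB with hT
  have hlt : pB < pA := by omega
  obtain ⟨a1, a2⟩ := (Book.bestAsk_eq_iff hpA).1 hA
  obtain ⟨b1, b2⟩ := (Book.bestBid_eq_iff hpB).1 hB
  set h : ℕ → ℝ := fun l => F.upRate b l * (T (b.shift l 1) - T b) +
    F.downRate b l * (T (b.shift l (-1)) - T b) with hh
  -- In terms of increments of `T`, every level outside the quotes drops out, whatever its rates.
  suffices hmain : ∑ l ∈ Finset.Icc 1 N, h l = θ * T b by
    have : ∑ l ∈ Finset.Icc 1 N, h l =
        ∑ l ∈ Finset.Icc 1 N, ((F.upRate b l : ℝ) * T (b.shift l 1) +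
          F.downRate b l * T (b.shift l (-1))) - exitRate F.bookRate b * T b := by
      rw [exitRate_bookRate, NNReal.coe_sum, Finset.sum_mul, ← Finset.sum_sub_distrib]
      refine Finset.sum_congr rfl fun l _ => ?_
      rw [hh, NNReal.coe_add]
      ring
    linarith
  have hsub : Finset.Icc pB pA ⊆ Finset.Icc 1 N := Finset.Icc_subset_Icc hpB hpA
  rw [← Finset.sum_subset hsub]
  · have hset : Finset.Icc pB pA = insert pB (insert pA (Finset.Ioo pB pA)) := by
      ext l
      simp only [Finset.mem_Icc, Finset.mem_insert, Finset.mem_Ioo]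
      omega
    have hin : ∀ l ∈ Finset.Ioo pB pA, h l = -(F.limitRate .ask 0 (x (l - pB)) : ℝ) * T b +
        -(F.limitRate .bid 0 (x (l - pB)) : ℝ) * T b := by
      intro l hl
      rw [Finset.mem_Ioo] at hl
      obtain ⟨e1, e2⟩ := F.rates_inside hpA hpB hl.1 hl.2 hA hB
      obtain ⟨e3, e4⟩ := topValue_shift_inside (W := W) (vA := vA) (vB := vB) hpA hpB hl.1 hl.2
        hA hB
      have e5 : F.factor b l = x (l - pB) := by
        rw [← hx (l - pB) (by omega)]; congr 1; omega
      simp only [hh, hT, e1, e2, e3, e4, e5]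
      ring
    -- The ask-side sum counts levels down from the best ask: `m = pA - l` gives `s₀ - m = l - pB`.
    have hsumA : ∑ l ∈ Finset.Ioo pB pA, (F.limitRate .ask 0 (x (l - pB)) : ℝ) = Λ := by
      rw [hΛask, NNReal.coe_sum]
      refine Finset.sum_nbij' (fun l => pA - l) (fun m => pA - m) ?_ ?_ ?_ ?_ ?_
      · intro l hl; simp only [Finset.mem_Ioo, Finset.mem_Icc] at hl ⊢; omega
      · intro l hl; simp only [Finset.mem_Ioo, Finset.mem_Icc] at hl ⊢; omega
      · intro l hl; simp only [Finset.mem_Ioo] at hl; omega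
      · intro l hl; simp only [Finset.mem_Icc] at hl; omega
      · intro l hl
        simp only [Finset.mem_Ioo] at hl
        rw [show s₀ - (pA - l) = l - pB by omega]
    have hsumB : ∑ l ∈ Finset.Ioo pB pA, (F.limitRate .bid 0 (x (l - pB)) : ℝ) = Λ := by
      rw [hΛbid, NNReal.coe_sum]
      refine Finset.sum_nbij' (fun l => l - pB) (fun m => pB + m) ?_ ?_ ?_ ?_ ?_
      · intro l hl; simp only [Finset.mem_Ioo, Finset.mem_Icc] at hl ⊢; omega
      · intro l hl; simp only [Finset.mem_Ioo, Finset.mem_Icc] at hl ⊢; omega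
      · intro l hl; simp only [Finset.mem_Ioo] at hl; omega
      · intro l hl; simp only [Finset.mem_Icc] at hl; omega
      · intro l hl; rfl
    rw [hset, Finset.sum_insert (by simp [hlt.ne]), Finset.sum_insert (by simp),
      Finset.sum_congr rfl hin, Finset.sum_add_distrib, ← Finset.sum_mul, ← Finset.sum_mul,
      Finset.sum_neg_distrib, Finset.sum_neg_distrib, hsumA, hsumB]
    obtain ⟨a, ha⟩ : ∃ a, b.size pA = a + 1 := ⟨b.size pA - 1, by rw [Book.size]; omega⟩
    obtain ⟨k, hk⟩ : ∃ k, b.size pB = k + 1 := ⟨b.size pB - 1, by rw [Book.size]; omega⟩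
    have fA : F.factor b pA = x s₀ := by rw [← hx s₀ le_rfl, hsp]
    have fB : F.factor b pB = x 0 := by rw [← hx 0 (by omega), add_zero]
    obtain ⟨e1, e2⟩ := topValue_shift_ask (W := W) (vA := vA) (vB := vB) hpA hpB hlt hA hB hWA
    obtain ⟨e3, e4⟩ := topValue_shift_bid (W := W) (vA := vA) (vB := vB) hpA hpB hlt hA hB hWB
    have e5 : T b = W (a + 1) (k + 1) := by rw [hT, topValue, if_pos ⟨hA, hB⟩, ha, hk]
    have := hstep a k
    simp only [hh, F.upRate_ask_quote hpA hlt hA hB, F.downRate_ask_quote hpA hA,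
      F.upRate_bid_quote hpB hB, F.downRate_bid_quote hpB hlt hA hB, fA, fB, e5]
    rw [hT, e1, e2, e3, e4, ha, hk]
    simp only [Nat.add_sub_cancel]
    linear_combination -this
  · intro l hl hl'
    simp only [Finset.mem_Icc, not_and_or, not_le] at hl'
    -- The only upward moves excluded by the sign condition are at levels below the bid that hold no
    -- bids, and there the upward rate is zero. Downward moves above the ask are treated
    -- symmetrically.
    have hup : (F.upRate b l : ℝ) * (T (b.shift l 1) - T b) = 0 := by
      rcases hl' with hl' | hl'
      · by_cases hq : b.queue l < 0
        · rw [hT, topValue_shift_outside hpA hpB hlt hl hA hB (Or.inr ⟨hl', by omega⟩), sub_self,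
            mul_zero]
        · rw [upRate, if_neg (by omega), if_neg (by omega), if_neg hq]
          simp
      · rw [hT, topValue_shift_outside hpA hpB hlt hl hA hB
          (Or.inl ⟨hl', by linarith [b2 l (by omega)]⟩), sub_self, mul_zero]
    have hdown : (F.downRate b l : ℝ) * (T (b.shift l (-1)) - T b) = 0 := by
      rcases hl' with hl' | hl'
      · rw [hT, topValue_shift_outside hpA hpB hlt hl hA hB
          (Or.inr ⟨hl', by linarith [a2 l (by omega)]⟩), sub_self, mul_zero]
      · by_cases hq : 0 < b.queue l
        · rw [hT, topValue_shift_outside hpA hpB hlt hl hA hB (Or.inl ⟨hl', by omega⟩), sub_self,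
            mul_zero]
        · rw [downRate, if_neg (by omega), if_neg (by omega), if_neg hq]
          simp
    rw [hh]
    simp only
    rw [hup, hdown, add_zero]

end OrderFlow

/-! ### Which quote moves first -/

namespace OrderFlow

variable {N : ℕ} {𝒳 : Type*} (F : OrderFlow N 𝒳)

/-- Birth rates of the queue at the best quote of side `i`. -/
def quoteBirth (i : Side) (y : 𝒳) (k : ℕ) : ℝ≥0 := F.limitRate i k y

/-- Death rates of the queue at the best quote of side `i`. -/
def quoteDeath (i : Side) (y : 𝒳) (k : ℕ) : ℝ≥0 := F.marketRate i k y + F.cancelRate i k y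

lemma topValue_mem_Icc {W : ℕ → ℕ → ℝ} {vA vB : ℝ} (hW0 : ∀ a k, 0 ≤ W a k)
    (hW1 : ∀ a k, W a k ≤ 1) (hvA : vA ∈ Set.Icc (0 : ℝ) 1) (hvB : vB ∈ Set.Icc (0 : ℝ) 1)
    (pA pB : ℕ) (b : Book N) : topValue W vA vB pA pB b ∈ Set.Icc (0 : ℝ) 1 := by
  unfold topValue
  split_ifs
  exacts [⟨hW0 _ _, hW1 _ _⟩, hvA, hvB, ⟨le_rfl, zero_le_one⟩]

variable {Ω : Type*} [MeasurableSpace Ω] {P : Measure Ω} [IsProbabilityMeasure P]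
  {Y : ℕ → Ω → Book N} {H : ℕ → Ω → ℝ≥0∞}

/-- Nonempty queues at both quotes force these onto the grid, which rules out the defaults `N + 1`
and `0`. -/
lemma bestQuote_bounds {q : Side → ℕ} (hq : ∀ i, 1 ≤ q i) {s₀ : ℕ} {b : Book N}
    (hb : HasTop q s₀ b) : b.bestAsk ≤ N ∧ 1 ≤ b.bestBid ∧ b.bestAsk = b.bestBid + s₀ := by
  have hA : b.queue b.bestAsk ≠ 0 := by
    have := hb.1 .ask
    have h1 := hq .ask
    simp only [Book.bestQuote, Book.size] at this
    omega
  have hB : b.queue b.bestBid ≠ 0 := by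
    have := hb.1 .bid
    have h1 := hq .bid
    simp only [Book.bestQuote, Book.size] at this
    omega
  refine ⟨?_, ?_, ?_⟩
  · by_contra h
    exact hA (Book.queue_of_notMem (by simp only [Finset.mem_Icc]; omega))
  · by_contra h
    exact hB (Book.queue_of_notMem (by simp only [Finset.mem_Icc]; omega))
  · have := hb.2
    rw [Book.spread] at this
    omega

/-- Combines `topValue_harmonic` with the exit formula, `D` being the set of books with a displaced
quote. The boundary constants `vA`, `vB` and the target `G` are left free so that both sides of the
book are covered. -/
lemma measure_exit_quotes (hY : IsJumpSkeleton P F.bookRate Y H)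
    (htop : ∀ᵐ ω ∂P, ∑' n, H n ω = ⊤) {q : Side → ℕ} (hq : ∀ i, 1 ≤ q i) {s₀ : ℕ} (hs₀ : 1 ≤ s₀)
    {b₀ : Book N} (hb₀ : HasTop q s₀ b₀) {x : ℕ → 𝒳}
    (hx : ∀ b : Book N, b.bestAsk = b₀.bestAsk → b.bestBid = b₀.bestBid →
        ∀ m ≤ s₀, F.factor b (b.bestBid + m) = x m)
    {Λ : ℝ≥0} (hΛask : Λ = ∑ m ∈ Finset.Icc 1 (s₀ - 1), F.limitRate .ask 0 (x (s₀ - m)))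
    (hΛbid : Λ = ∑ m ∈ Finset.Icc 1 (s₀ - 1), F.limitRate .bid 0 (x m))
    {W : ℝ → ℕ → ℕ → ℝ} {vA vB w : ℝ} (hvA : vA ∈ Set.Icc (0 : ℝ) 1) (hvB : vB ∈ Set.Icc (0 : ℝ) 1)
    (hW0 : ∀ θ, 0 < θ → ∀ a k, 0 ≤ W θ a k) (hW1 : ∀ θ, 0 < θ → ∀ a k, W θ a k ≤ 1)
    (hWA : ∀ θ, 0 < θ → ∀ k, W θ 0 (k + 1) = vA) (hWB : ∀ θ, 0 < θ → ∀ k, W θ (k + 1) 0 = vB)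
    (hstep : ∀ θ, 0 < θ → ∀ a k : ℕ, (F.quoteBirth .ask (x s₀) (a + 1) +
        F.quoteDeath .ask (x s₀) (a + 1) + F.quoteBirth .bid (x 0) (k + 1) +
        F.quoteDeath .bid (x 0) (k + 1) + (2 * Λ + θ)) * W θ (a + 1) (k + 1) =
      F.quoteBirth .ask (x s₀) (a + 1) * W θ (a + 2) (k + 1) +
        F.quoteDeath .ask (x s₀) (a + 1) * W θ a (k + 1) +
        F.quoteBirth .bid (x 0) (k + 1) * W θ (a + 1) (k + 2) +
        F.quoteDeath .bid (x 0) (k + 1) * W θ (a + 1) k)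
    (hlim : Tendsto (fun θ => W θ (q .ask) (q .bid)) (𝓝[>] 0) (𝓝 w))
    {G : Book N → Prop}
    (hGD : ∀ b, G b → ¬ (b.bestAsk = b₀.bestAsk ∧ b.bestBid = b₀.bestBid))
    (hG1 : ∀ W' b, G b → topValue W' vA vB b₀.bestAsk b₀.bestBid b = 1)
    (hG0 : ∀ W' b, ¬ (b.bestAsk = b₀.bestAsk ∧ b.bestBid = b₀.bestBid) → ¬ G b →
      topValue W' vA vB b₀.bestAsk b₀.bestBid b = 0) :
    P {ω | Y 0 ω = b₀ ∧ ∃ n, (∀ k < n, ¬ ¬ ((Y k ω).bestAsk = b₀.bestAsk ∧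
      (Y k ω).bestBid = b₀.bestBid)) ∧ G (Y n ω) ∧ jumpTime H n ω ≠ ⊤} =
      P {ω | Y 0 ω = b₀} * ENNReal.ofReal w := by
  obtain ⟨hpA, hpB, hsp⟩ := bestQuote_bounds hq hb₀
  set pA := b₀.bestAsk
  set pB := b₀.bestBid
  have hIcc := fun θ hθ => topValue_mem_Icc (N := N) (hW0 θ hθ) (hW1 θ hθ) hvA hvB pA pB
  refine hY.measure_exit_eq F.summable_bookRate htop
    (D := fun b => ¬ (b.bestAsk = pA ∧ b.bestBid = pB)) hGD
    (u := fun θ b => ENNReal.ofReal (topValue (W θ) vA vB pA pB b)) ?_ ?_ ?_ ?_ b₀ ?_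
  · intro θ hθ b hb
    obtain ⟨hA, hB⟩ := not_not.1 hb
    have hfac : ∀ m ≤ s₀, F.factor b (pB + m) = x m := by
      intro m hm
      rw [← hB]
      exact hx b hA hB m hm
    have key := F.topValue_harmonic hpA hpB hs₀ hsp hA hB hfac hΛask hΛbid (hWA θ hθ) (hWB θ hθ)
      (hstep θ hθ)
    have hpos : (0 : ℝ) ≤ exitRate F.bookRate b + θ := by positivity
    rw [tsum_bookRate_mul, ← ENNReal.ofReal_mul hpos, ← key, ENNReal.ofReal_sum_of_nonneg]
    · refine Finset.sum_congr rfl fun l _ => ?_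
      rw [ENNReal.ofReal_add (mul_nonneg NNReal.zero_le_coe (hIcc θ hθ _).1)
        (mul_nonneg NNReal.zero_le_coe (hIcc θ hθ _).1), ENNReal.ofReal_mul NNReal.zero_le_coe,
        ENNReal.ofReal_mul NNReal.zero_le_coe, ENNReal.ofReal_coe_nnreal,
        ENNReal.ofReal_coe_nnreal]
    · exact fun l _ => add_nonneg (mul_nonneg NNReal.zero_le_coe (hIcc θ hθ _).1)
        (mul_nonneg NNReal.zero_le_coe (hIcc θ hθ _).1)
  · intro θ hθ b
    rw [← ENNReal.ofReal_one]
    exact ENNReal.ofReal_le_ofReal (hIcc θ hθ b).2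
  · intro θ _ b hb
    simp [hG1 (W θ) b hb]
  · intro θ _ b hb hb'
    simp [hG0 (W θ) b hb hb']
  · refine ENNReal.tendsto_ofReal (hlim.congr fun θ => ?_)
    rw [topValue, if_pos ⟨rfl, rfl⟩]
    congr 1
    exacts [(hb₀.1 .ask).symm, (hb₀.1 .bid).symm]

/-- Probability that the best quote of side `i` moves first, for a given initial book. -/
lemma measure_quoteTime_lt_otherTime (hY : IsJumpSkeleton P F.bookRate Y H)
    {Q : ℝ≥0 → Ω → Book N}
    (hp : ∀ᵐ ω ∂P, IsJumpPath (fun t => Q t ω) (fun n => Y n ω) (fun n => H n ω))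
    {q : Side → ℕ} (hq : ∀ i, 1 ≤ q i) {s₀ : ℕ} (hs₀ : 1 ≤ s₀)
    {b₀ : Book N} (hb₀ : HasTop q s₀ b₀) {x : ℕ → 𝒳}
    (hx : ∀ b : Book N, b.bestAsk = b₀.bestAsk → b.bestBid = b₀.bestBid →
        ∀ m ≤ s₀, F.factor b (b.bestBid + m) = x m)
    {Λ : ℝ≥0} (hΛask : Λ = ∑ m ∈ Finset.Icc 1 (s₀ - 1), F.limitRate .ask 0 (x (s₀ - m)))
    (hΛbid : Λ = ∑ m ∈ Finset.Icc 1 (s₀ - 1), F.limitRate .bid 0 (x m))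
    (i : Side)
    (htail : Tendsto (fun t => Real.exp (-(2 * Λ * t)) *
      (1 - passageCDF (F.quoteBirth i.other (x (quoteOffset s₀ i.other)))
        (F.quoteDeath i.other (x (quoteOffset s₀ i.other))) (q i.other) t)) atTop (𝓝 0)) :
    NullMeasurableSet ({ω | Y 0 ω = b₀} ∩
        {ω | quoteTime i (fun t => Q t ω) < otherTime i (fun t => Q t ω)}) P ∧
      P ({ω | Y 0 ω = b₀} ∩ {ω | quoteTime i (fun t => Q t ω) < otherTime i (fun t => Q t ω)}) =
        P {ω | Y 0 ω = b₀} * ENNReal.ofReal (raceValue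
          (F.quoteBirth i (x (quoteOffset s₀ i))) (F.quoteDeath i (x (quoteOffset s₀ i)))
          (F.quoteBirth i.other (x (quoteOffset s₀ i.other)))
          (F.quoteDeath i.other (x (quoteOffset s₀ i.other))) (2 * Λ) (q i) (q i.other)) := by
  have htop : ∀ᵐ ω ∂P, ∑' n, H n ω = ⊤ := hp.mono fun ω hω => hω.tsum_eq_top
  have hκ : ∀ θ : ℝ, 0 < θ → (0 : ℝ) < 2 * Λ + θ := fun θ hθ => by positivity
  have hκ0 : (0 : ℝ) ≤ 2 * Λ := by positivity
  have hmeas : ∀ G : Book N → Prop, MeasurableSet {ω | Y 0 ω = b₀ ∧ ∃ n,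
      (∀ k < n, ¬ ¬ ((Y k ω).bestAsk = b₀.bestAsk ∧ (Y k ω).bestBid = b₀.bestBid)) ∧
        G (Y n ω) ∧ jumpTime H n ω ≠ ⊤} := by
    intro G
    have : {ω | Y 0 ω = b₀ ∧ ∃ n,
        (∀ k < n, ¬ ¬ ((Y k ω).bestAsk = b₀.bestAsk ∧ (Y k ω).bestBid = b₀.bestBid)) ∧
        G (Y n ω) ∧ jumpTime H n ω ≠ ⊤} = ⋃ n, ({ω | Y 0 ω = b₀ ∧ ∀ k < n,
          ¬ ¬ ((Y k ω).bestAsk = b₀.bestAsk ∧ (Y k ω).bestBid = b₀.bestBid)} ∩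
          ({ω | G (Y n ω)} ∩ {ω | jumpTime H n ω ≠ ⊤})) := by
      ext ω
      simp only [Set.mem_ofPred_eq, Set.mem_iUnion, Set.mem_inter_iff]
      constructor
      · rintro ⟨h0, n, h1, h2⟩
        exact ⟨n, ⟨h0, h1⟩, h2⟩
      · rintro ⟨n, ⟨h0, h1⟩, h2⟩
        exact ⟨h0, n, h1, h2⟩
    rw [this]
    exact MeasurableSet.iUnion fun n => (hY.measurableSet_avoid
      (fun b => ¬ (b.bestAsk = b₀.bestAsk ∧ b.bestBid = b₀.bestBid)) b₀ n).inter
      ((hY.measurableSet_of_state n G).inter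
        ((hY.measurable_jumpTime n) (measurableSet_singleton ⊤)).compl)
  cases i with
  | ask =>
    -- Almost surely, the comparison of the two times says that at the first displacement of a quote
    -- the ask has gone up and the bid has stayed.
    have hae : ({ω | Y 0 ω = b₀} ∩ {ω | quoteTime .ask (fun t => Q t ω) <
        otherTime .ask (fun t => Q t ω)} : Set Ω) =ᵐ[P] {ω | Y 0 ω = b₀ ∧ ∃ n,
        (∀ k < n, ¬ ¬ ((Y k ω).bestAsk = b₀.bestAsk ∧ (Y k ω).bestBid = b₀.bestBid)) ∧
        (fun b : Book N => b₀.bestAsk < b.bestAsk ∧ b.bestBid = b₀.bestBid) (Y n ω) ∧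
          jumpTime H n ω ≠ ⊤} := by
      filter_upwards [hp] with ω hω
      refine propext (and_congr_right fun h0 => ?_)
      have h0 : Y 0 ω = b₀ := h0
      have hQ0 : Q 0 ω = b₀ := hω.zero_eq.trans h0
      have key := hω.firstTime_lt_firstTime_iff (fun b => b₀.bestAsk < b.bestAsk)
        (fun b => b.bestAsk < b₀.bestAsk ∨ b.bestBid ≠ b₀.bestBid)
      change quoteTime .ask (fun t => Q t ω) < otherTime .ask (fun t => Q t ω) ↔ _
      simp only [quoteTime, otherTime, hQ0]
      refine key.trans (exists_congr fun n => and_congr ?_ (and_congr ?_ Iff.rfl))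
      · refine forall₂_congr fun k _ => not_congr ?_
        omega
      · omega
    refine ⟨(hmeas fun b => b₀.bestAsk < b.bestAsk ∧
      b.bestBid = b₀.bestBid).nullMeasurableSet.congr hae.symm, ?_⟩
    rw [measure_congr hae]
    refine F.measure_exit_quotes hY htop hq hs₀ hb₀ hx hΛask hΛbid
      (W := fun θ a k => raceValue (F.quoteBirth .ask (x s₀)) (F.quoteDeath .ask (x s₀))
        (F.quoteBirth .bid (x 0)) (F.quoteDeath .bid (x 0)) (2 * Λ + θ) a k)
      (vA := 1) (vB := 0) (G := fun b => b₀.bestAsk < b.bestAsk ∧ b.bestBid = b₀.bestBid) (by simp) (by simp)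
      (fun θ hθ a k => raceValue_nonneg _ _ _ _ (hκ θ hθ).le a k)
      (fun θ hθ a k => raceValue_le_one _ _ _ _ (hκ θ hθ) a k)
      (fun θ hθ k => raceValue_left_zero _ _ _ _ (hκ θ hθ) k)
      (fun θ hθ k => raceValue_right_zero _ _ _ _ _ _)
      (fun θ hθ a k => raceValue_step _ _ _ _ (hκ θ hθ) a k)
      (tendsto_raceValue _ _ _ _ hκ0 _ _ htail) ?_ ?_ ?_
    · intro b hb h; omega
    · intro W' b hb
      rw [topValue, if_neg (by omega), if_pos hb]
    · intro W' b hb hG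
      rw [topValue, if_neg hb, if_neg hG]
      split_ifs <;> rfl
  | bid =>
    have hae : ({ω | Y 0 ω = b₀} ∩ {ω | quoteTime .bid (fun t => Q t ω) <
        otherTime .bid (fun t => Q t ω)} : Set Ω) =ᵐ[P] {ω | Y 0 ω = b₀ ∧ ∃ n,
        (∀ k < n, ¬ ¬ ((Y k ω).bestAsk = b₀.bestAsk ∧ (Y k ω).bestBid = b₀.bestBid)) ∧
        (fun b : Book N => b.bestAsk = b₀.bestAsk ∧ b.bestBid < b₀.bestBid) (Y n ω) ∧
          jumpTime H n ω ≠ ⊤} := by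
      filter_upwards [hp] with ω hω
      refine propext (and_congr_right fun h0 => ?_)
      have h0 : Y 0 ω = b₀ := h0
      have hQ0 : Q 0 ω = b₀ := hω.zero_eq.trans h0
      have key := hω.firstTime_lt_firstTime_iff (fun b => b.bestBid < b₀.bestBid)
        (fun b => b₀.bestBid < b.bestBid ∨ b.bestAsk ≠ b₀.bestAsk)
      change quoteTime .bid (fun t => Q t ω) < otherTime .bid (fun t => Q t ω) ↔ _
      simp only [quoteTime, otherTime, hQ0]
      refine key.trans (exists_congr fun n => and_congr ?_ (and_congr ?_ Iff.rfl))
      · refine forall₂_congr fun k _ => not_congr ?_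
        omega
      · omega
    refine ⟨(hmeas fun b => b.bestAsk = b₀.bestAsk ∧
      b.bestBid < b₀.bestBid).nullMeasurableSet.congr hae.symm, ?_⟩
    rw [measure_congr hae]
    -- The first argument of `W` is always the ask size, so the race is written with its arguments
    -- exchanged.
    refine F.measure_exit_quotes hY htop hq hs₀ hb₀ hx hΛask hΛbid
      (W := fun θ a k => raceValue (F.quoteBirth .bid (x 0)) (F.quoteDeath .bid (x 0))
        (F.quoteBirth .ask (x s₀)) (F.quoteDeath .ask (x s₀)) (2 * Λ + θ) k a)
      (vA := 0) (vB := 1) (G := fun b => b.bestAsk = b₀.bestAsk ∧ b.bestBid < b₀.bestBid) (by simp) (by simp)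
      (fun θ hθ a k => raceValue_nonneg _ _ _ _ (hκ θ hθ).le k a)
      (fun θ hθ a k => raceValue_le_one _ _ _ _ (hκ θ hθ) k a)
      (fun θ hθ k => raceValue_right_zero _ _ _ _ _ _)
      (fun θ hθ k => raceValue_left_zero _ _ _ _ (hκ θ hθ) k)
      (fun θ hθ a k => ?_)
      (tendsto_raceValue _ _ _ _ hκ0 _ _ htail) ?_ ?_ ?_
    · have := raceValue_step (F.quoteBirth .bid (x 0)) (F.quoteDeath .bid (x 0))
        (F.quoteBirth .ask (x s₀)) (F.quoteDeath .ask (x s₀)) (hκ θ hθ) k a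
      linear_combination this
    · intro b hb h; omega
    · intro W' b hb
      rw [topValue, if_neg (by omega), if_neg (by omega), if_pos hb]
    · intro W' b hb hG
      rw [topValue, if_neg hb]
      split_ifs <;> rfl

/-- Conditional probability that the best quote of side `i` moves first. -/
lemma cond_quoteTime_lt_otherTime {Q : ℝ≥0 → Ω → Book N}
    (hQ : IsMarkovJumpProcess P F.bookRate Q)
    {q : Side → ℕ} (hq : ∀ i, 1 ≤ q i) {s₀ : ℕ} (hs₀ : 1 ≤ s₀)
    (hinit : P {ω | HasTop q s₀ (Q 0 ω)} ≠ 0) {x : ℕ → 𝒳}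
    (hx : ∀ b₀ : Book N, HasTop q s₀ b₀ → P {ω | Q 0 ω = b₀} ≠ 0 →
      ∀ b : Book N, b.bestAsk = b₀.bestAsk → b.bestBid = b₀.bestBid →
        ∀ m ≤ s₀, F.factor b (b.bestBid + m) = x m)
    {Λ : ℝ≥0} (hΛask : Λ = ∑ m ∈ Finset.Icc 1 (s₀ - 1), F.limitRate .ask 0 (x (s₀ - m)))
    (hΛbid : Λ = ∑ m ∈ Finset.Icc 1 (s₀ - 1), F.limitRate .bid 0 (x m))
    (i : Side)
    (htail : Tendsto (fun t => Real.exp (-(2 * Λ * t)) *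
      (1 - passageCDF (F.quoteBirth i.other (x (quoteOffset s₀ i.other)))
        (F.quoteDeath i.other (x (quoteOffset s₀ i.other))) (q i.other) t)) atTop (𝓝 0)) :
    (P[|{ω | HasTop q s₀ (Q 0 ω)}]).real
        {ω | quoteTime i (fun t => Q t ω) < otherTime i (fun t => Q t ω)} =
      raceValue
          (F.quoteBirth i (x (quoteOffset s₀ i))) (F.quoteDeath i (x (quoteOffset s₀ i)))
          (F.quoteBirth i.other (x (quoteOffset s₀ i.other)))
          (F.quoteDeath i.other (x (quoteOffset s₀ i.other))) (2 * Λ) (q i) (q i.other) := by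
  classical
  obtain ⟨Y, H, hY, hp⟩ := hQ.exists_skeleton
  set Ev := {ω | quoteTime i (fun t => Q t ω) < otherTime i (fun t => Q t ω)} with hEv
  set w := raceValue
          (F.quoteBirth i (x (quoteOffset s₀ i))) (F.quoteDeath i (x (quoteOffset s₀ i)))
          (F.quoteBirth i.other (x (quoteOffset s₀ i.other)))
          (F.quoteDeath i.other (x (quoteOffset s₀ i.other))) (2 * Λ) (q i) (q i.other) with hw
  have hw0 : 0 ≤ w := raceValue_nonneg _ _ _ _ (by positivity) _ _
  have h0 : ∀ᵐ ω ∂P, Q 0 ω = Y 0 ω := hp.mono fun ω hω => hω.zero_eq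
  have hT : ({ω | HasTop q s₀ (Q 0 ω)} : Set Ω) =ᵐ[P] {ω | HasTop q s₀ (Y 0 ω)} := by
    filter_upwards [h0] with ω hω
    exact congrArg (HasTop q s₀) hω
  have hTm : MeasurableSet {ω | HasTop q s₀ (Y 0 ω)} := hY.measurableSet_of_state 0 _
  -- The event about `Q 0` need not be measurable; it is replaced by its almost sure version in
  -- terms of the jump chain.
  have hcond : P[|{ω | HasTop q s₀ (Q 0 ω)}] = P[|{ω | HasTop q s₀ (Y 0 ω)}] := by
    rw [ProbabilityTheory.cond, ProbabilityTheory.cond, measure_congr hT,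
      Measure.restrict_congr_set hT]
  have hb : ∀ b₀ : Book N, HasTop q s₀ b₀ →
      NullMeasurableSet ({ω | Y 0 ω = b₀} ∩ Ev) P ∧
      P ({ω | Y 0 ω = b₀} ∩ Ev) = P {ω | Y 0 ω = b₀} * ENNReal.ofReal w := by
    intro b₀ hb₀
    -- The factors are prescribed only for initial books of positive probability; the others
    -- contribute nothing.
    by_cases hP : P {ω | Y 0 ω = b₀} = 0
    · have h1 : P ({ω | Y 0 ω = b₀} ∩ Ev) = 0 := measure_mono_null Set.inter_subset_left hP
      exact ⟨NullMeasurableSet.of_null h1, by rw [h1, hP, zero_mul]⟩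
    · have hP' : P {ω | Q 0 ω = b₀} ≠ 0 := by
        have : ({ω | Q 0 ω = b₀} : Set Ω) =ᵐ[P] {ω | Y 0 ω = b₀} := by
          filter_upwards [h0] with ω hω
          exact congrArg (· = b₀) hω
        rwa [measure_congr this]
      exact F.measure_quoteTime_lt_otherTime hY hp hq hs₀ hb₀ (hx b₀ hb₀ hP') hΛask hΛbid i htail
  -- The exit probability is the same for all admissible initial books, so summing over them gives a
  -- common factor which conditioning isolates.
  have hsum : P ({ω | HasTop q s₀ (Y 0 ω)} ∩ Ev) =
      P {ω | HasTop q s₀ (Y 0 ω)} * ENNReal.ofReal w := by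
    have hU : {ω | HasTop q s₀ (Y 0 ω)} = ⋃ b₀ : {b : Book N // HasTop q s₀ b},
        {ω | Y 0 ω = b₀} := by
      ext ω; simp
    have hdisj : Pairwise (Function.onFun Disjoint
        fun b₀ : {b : Book N // HasTop q s₀ b} => {ω | Y 0 ω = b₀}) := by
      intro b b' hbb
      refine Set.disjoint_left.2 fun ω h1 h2 => hbb (Subtype.ext ?_)
      have h1 : Y 0 ω = b := h1
      have h2 : Y 0 ω = b' := h2
      rw [← h1, h2]
    rw [hU, Set.iUnion_inter, measure_iUnion₀, measure_iUnion hdisj, ← ENNReal.tsum_mul_right]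
    · exact tsum_congr fun b => (hb b b.2).2
    · exact fun b => hY.measurableSet_state 0 b
    · exact fun b b' hbb => ((hdisj hbb).mono Set.inter_subset_left
        Set.inter_subset_left).aedisjoint
    · exact fun b => (hb b b.2).1
  rw [hcond, Measure.real, ProbabilityTheory.cond_apply hTm, hsum, ← mul_assoc,
    ENNReal.inv_mul_cancel (by rwa [measure_congr hT] at hinit) (measure_ne_top _ _), one_mul,
    ENNReal.toReal_ofReal hw0]

end OrderFlow

/-! ### Laplace transforms -/

section Laplace

lemma norm_cexp_neg_mul (s : ℂ) (t : ℝ) :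
    ‖Complex.exp (-s * (t : ℂ))‖ = Real.exp (-(s.re * t)) := by
  rw [Complex.norm_exp]; simp

lemma hasDerivAt_cexp_neg_mul (s : ℂ) (t : ℝ) :
    HasDerivAt (fun t : ℝ => Complex.exp (-s * (t : ℂ))) (-s * Complex.exp (-s * (t : ℂ))) t := by
  have := ((hasDerivAt_id (t : ℂ)).const_mul (-s)).cexp.comp_ofReal
  simp only [id, mul_one] at this
  rwa [mul_comm] at this

/-- Absolute convergence involves only the modulus of `e^{-st}`, so it is a property of the vertical
line through `s`. -/
lemma laplaceConverges_iff {f : ℝ → ℝ} (hf : Measurable f) (s : ℂ) :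
    LaplaceConverges f s ↔ IntegrableOn (fun t => Real.exp (-(s.re * t)) * f t) (Set.Ioi 0) := by
  have h1 : AEStronglyMeasurable (fun t : ℝ => Complex.exp (-s * (t : ℂ)) * (f t : ℂ))
      (volume.restrict (Set.Ioi 0)) := Measurable.aestronglyMeasurable (by fun_prop)
  have h2 : AEStronglyMeasurable (fun t : ℝ => Real.exp (-(s.re * t)) * f t)
      (volume.restrict (Set.Ioi 0)) := Measurable.aestronglyMeasurable (by fun_prop)
  rw [LaplaceConverges, IntegrableOn, IntegrableOn]
  rw [← integrable_norm_iff h1, ← integrable_norm_iff h2]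
  refine integrable_congr (Eventually.of_forall fun t => ?_)
  simp only
  rw [norm_mul, norm_cexp_neg_mul, norm_mul, Complex.norm_real, Real.norm_eq_abs (Real.exp _),
    Real.abs_exp]

lemma laplace_deriv {φ φ' : ℝ → ℝ} {s : ℂ} (hφ : LaplaceConverges φ s)
    (hφ' : LaplaceConverges φ' s) (hcont : ContinuousWithinAt φ (Set.Ici 0) 0)
    (hderiv : ∀ t, 0 < t → HasDerivAt φ (φ' t) t)
    (h0 : Tendsto (fun t => Real.exp (-(s.re * t)) * φ t) atTop (𝓝 0)) :
    laplace φ' s = s * laplace φ s - φ 0 := by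
  have hint : IntegrableOn (fun t : ℝ => -s * (Complex.exp (-s * (t : ℂ)) * (φ t : ℂ)) +
      Complex.exp (-s * (t : ℂ)) * (φ' t : ℂ)) (Set.Ioi 0) := (hφ.const_mul _).add hφ'
  have key := integral_Ioi_of_hasDerivAt_of_tendsto (a := 0) (m := (0 : ℂ))
    (f := fun t : ℝ => Complex.exp (-s * (t : ℂ)) * (φ t : ℂ))
    (f' := fun t : ℝ => -s * (Complex.exp (-s * (t : ℂ)) * (φ t : ℂ)) +
      Complex.exp (-s * (t : ℂ)) * (φ' t : ℂ)) ?_ ?_ hint ?_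
  · rw [integral_add (hφ.const_mul _) hφ', integral_const_mul] at key
    simp only [laplace]
    simp only [Complex.ofReal_zero, mul_zero, Complex.exp_zero, one_mul] at key
    linear_combination key
  · refine ContinuousWithinAt.mul (by fun_prop) ?_
    exact Complex.continuous_ofReal.continuousAt.comp_continuousWithinAt hcont
  · intro t ht
    refine ((hasDerivAt_cexp_neg_mul s t).mul (hderiv t ht).ofReal_comp).congr_deriv ?_
    ring
  · rw [tendsto_zero_iff_norm_tendsto_zero]
    refine (tendsto_zero_iff_norm_tendsto_zero.1 h0).congr fun t => ?_
    rw [norm_mul, norm_mul, norm_cexp_neg_mul, Complex.norm_real, Real.norm_eq_abs (Real.exp _),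
      Real.abs_exp]

lemma laplaceConverges_of_bounded {φ : ℝ → ℝ} (hφ : Measurable φ) {C : ℝ}
    (hC : ∀ t, 0 < t → |φ t| ≤ C) {s : ℂ} (hs : 0 < s.re) : LaplaceConverges φ s :=
  (laplaceConverges_iff hφ s).2 (integrableOn_exp_neg_mul_bounded hs hφ hC)

lemma tendsto_exp_neg_mul_bounded {φ : ℝ → ℝ} {C : ℝ} (hC : ∀ t, 0 < t → |φ t| ≤ C) {r : ℝ}
    (hr : 0 < r) : Tendsto (fun t => Real.exp (-(r * t)) * φ t) atTop (𝓝 0) := by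
  have hexp : Tendsto (fun t => Real.exp (-(r * t)) * C) atTop (𝓝 0) := by
    rw [← zero_mul C]
    refine Tendsto.mul_const _ (Real.tendsto_exp_neg_atTop_nhds_zero.comp ?_)
    exact tendsto_id.const_mul_atTop hr
  refine squeeze_zero_norm' ?_ hexp
  filter_upwards [eventually_gt_atTop 0] with t ht
  rw [norm_mul, Real.norm_eq_abs, Real.abs_exp]
  exact mul_le_mul_of_nonneg_left (hC t ht) (Real.exp_pos _).le

lemma norm_laplace_le {φ : ℝ → ℝ} {C : ℝ} (hC : ∀ t, 0 < t → |φ t| ≤ C) {s : ℂ}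
    (hs : 0 < s.re) : ‖laplace φ s‖ ≤ C / s.re := by
  have hint : IntegrableOn (fun t => Real.exp (-(s.re * t)) * C) (Set.Ioi 0) := by
    have := (integrableOn_exp_mul_Ioi (neg_lt_zero.2 hs) 0).mul_const C
    simp only [neg_mul] at this
    exact this
  refine (norm_integral_le_of_norm_le hint ?_).trans_eq ?_
  · refine (ae_restrict_iff' measurableSet_Ioi).2 (Eventually.of_forall fun t ht => ?_)
    rw [norm_mul, norm_cexp_neg_mul, Complex.norm_real]
    exact mul_le_mul_of_nonneg_left (hC t ht) (Real.exp_pos _).le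
  · rw [integral_mul_const]
    have := integral_exp_mul_Ioi (neg_lt_zero.2 hs) 0
    simp only [neg_mul, mul_zero, Real.exp_zero] at this
    rw [this]
    field_simp

variable (lam d : ℕ → ℝ≥0)

/-- There is no boundary term, as the distribution function vanishes at `0`. The factor `s` cancels
the `1 / s` in `quoteTransform`. -/
lemma laplace_passageDensity_succ (a : ℕ) {s : ℂ} (hs : 0 < s.re) :
    laplace (passageDensity lam d (a + 1)) s = s * laplace (passageCDF lam d (a + 1)) s := by
  have hb : ∀ t, 0 < t → |passageCDF lam d (a + 1) t| ≤ 1 := fun t _ => by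
    rw [abs_of_nonneg (passageCDF_nonneg lam d _ t)]; exact passageCDF_le_one lam d _ t
  rw [laplace_deriv (laplaceConverges_of_bounded (measurable_passageCDF lam d _) hb hs)
    (laplaceConverges_of_bounded (measurable_passageDensity lam d _)
      (fun t _ => abs_passageDensity_le lam d (a + 1) t) hs)
    (continuousWithinAt_passageCDF_zero lam d _)
    (fun t ht => hasDerivAt_passageCDF lam d _ ht) (tendsto_exp_neg_mul_bounded hb hs),
    passageCDF_succ_zero]
  simp

/-- Quadratic decay of the Laplace transform of the distribution function on vertical lines. -/
lemma exists_norm_laplace_passageCDF_le (a : ℕ) {γ : ℝ} (hγ : 0 < γ) :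
    ∃ C : ℝ, ∀ s : ℂ, s.re = γ → ‖laplace (passageCDF lam d (a + 1)) s‖ ≤ C / ‖s‖ ^ 2 := by
  set g' : ℝ → ℝ := fun t =>
    lam (a + 1) * (passageDensity lam d (a + 2) t - passageDensity lam d (a + 1) t) +
      d (a + 1) * (passageDensity lam d a t - passageDensity lam d (a + 1) t)
  have hg'm : Measurable g' := by
    have := measurable_passageDensity lam d
    exact (((this _).sub (this _)).const_mul _).add (((this _).sub (this _)).const_mul _)
  obtain ⟨Cg, hCg⟩ : ∃ C, ∀ t, |g' t| ≤ C := by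
    refine ⟨lam (a + 1) * ((lam (a + 2) + d (a + 2)) + (lam (a + 1) + d (a + 1))) +
      d (a + 1) * ((lam a + d a) + (lam (a + 1) + d (a + 1))), fun t => ?_⟩
    refine (abs_add_le _ _).trans (add_le_add ?_ ?_) <;>
    · rw [abs_mul, NNReal.abs_eq]
      refine mul_le_mul_of_nonneg_left ?_ NNReal.zero_le_coe
      exact (abs_sub _ _).trans (add_le_add (abs_passageDensity_le lam d _ _)
        (abs_passageDensity_le lam d _ _))
  have hb : ∀ t, 0 < t → |passageDensity lam d (a + 1) t| ≤ lam (a + 1) + d (a + 1) :=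
    fun t _ => abs_passageDensity_le lam d (a + 1) t
  refine ⟨Cg / γ + |passageDensity lam d (a + 1) 0|, fun s hs => ?_⟩
  have hs' : 0 < s.re := by rw [hs]; exact hγ
  have hs0 : s ≠ 0 := by rintro rfl; simp at hs'
  have h1 := laplace_deriv (s := s)
    (laplaceConverges_of_bounded (measurable_passageDensity lam d (a + 1)) hb hs')
    (laplaceConverges_of_bounded hg'm (fun t _ => hCg t) hs')
    (continuousWithinAt_passageDensity_zero lam d _)
    (fun t ht => hasDerivAt_passageDensity_succ lam d a ht) (tendsto_exp_neg_mul_bounded hb hs')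
  rw [laplace_passageDensity_succ lam d a hs'] at h1
  -- Two integrations by parts: one from the distribution function to the density, one from the
  -- density to its bounded derivative.
  have h2 : laplace (passageCDF lam d (a + 1)) s =
      (laplace g' s + (passageDensity lam d (a + 1) 0 : ℂ)) / s ^ 2 := by
    rw [h1]; field_simp; ring
  rw [h2, norm_div, norm_pow]
  gcongr
  refine (norm_add_le _ _).trans (add_le_add ?_ ?_)
  · rw [← hs]; exact norm_laplace_le (fun t _ => hCg t) hs'
  · rw [Complex.norm_real]; rfl

lemma measurable_laplace_line {φ : ℝ → ℝ} (hφ : Measurable φ) (γ : ℝ) :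
    StronglyMeasurable fun u : ℝ => laplace φ ((γ : ℂ) + (u : ℂ) * Complex.I) := by
  unfold laplace
  refine StronglyMeasurable.integral_prod_right (f := fun (u : ℝ) (t : ℝ) =>
    Complex.exp (-((γ : ℂ) + (u : ℂ) * Complex.I) * (t : ℂ)) * (φ t : ℂ)) ?_
  exact Measurable.stronglyMeasurable (by fun_prop)

lemma integrable_laplace_passageCDF_line (a : ℕ) {γ : ℝ} (hγ : 0 < γ) :
    Integrable fun u : ℝ =>
      laplace (passageCDF lam d (a + 1)) ((γ : ℂ) + (u : ℂ) * Complex.I) := by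
  obtain ⟨C, hC⟩ := exists_norm_laplace_passageCDF_le lam d a hγ
  have hre : ∀ u : ℝ, ((γ : ℂ) + (u : ℂ) * Complex.I).re = γ := fun u => by simp
  have hnorm : ∀ u : ℝ, ‖(γ : ℂ) + (u : ℂ) * Complex.I‖ ^ 2 = γ ^ 2 * (1 + (γ⁻¹ * u) ^ 2) := by
    intro u
    rw [Complex.sq_norm, Complex.normSq_add_mul_I]
    field_simp
  have hint : Integrable fun u : ℝ => C / γ ^ 2 * (1 + (γ⁻¹ * u) ^ 2)⁻¹ :=
    (integrable_inv_one_add_sq.comp_mul_left' (inv_ne_zero hγ.ne')).const_mul _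
  refine hint.mono' (measurable_laplace_line (measurable_passageCDF lam d _) γ).aestronglyMeasurable
    (Eventually.of_forall fun u => ?_)
  refine (hC _ (hre u)).trans_eq ?_
  rw [hnorm, div_mul_eq_div_div, div_eq_mul_inv (C / γ ^ 2)]

/-- Laplace inversion for the distribution function of the first-passage time. -/
lemma integral_laplace_passageCDF_line (a : ℕ) {γ : ℝ} (hγ : 0 < γ) (v : ℝ) :
    ∫ u : ℝ, Complex.exp (((u * v : ℝ) : ℂ) * Complex.I) *
        laplace (passageCDF lam d (a + 1)) ((γ : ℂ) + (u : ℂ) * Complex.I) =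
      2 * Real.pi * (Real.exp (-(γ * v)) * passageCDF lam d (a + 1) v : ℝ) := by
  set F := passageCDF lam d (a + 1) with hF
  -- Since `F` vanishes on `(-∞, 0]` and is continuous, so is `h`, and Fourier inversion holds at
  -- every `v` without averaging over a jump.
  set h : ℝ → ℂ := fun v => ((Real.exp (-(γ * v)) * F v : ℝ) : ℂ) with hh
  have hFc : Continuous F := continuous_passageCDF_succ lam d a
  have hF0 : ∀ v ≤ 0, F v = 0 := fun v hv => le_antisymm
    ((passageCDF_mono lam d (a + 1) hv).trans (passageCDF_succ_zero lam d a).le)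
    (passageCDF_nonneg lam d _ _)
  have hcont : Continuous h := by fun_prop
  have hIoi : ∀ G : ℝ → ℂ, (∀ v ≤ 0, G v = 0) → ∫ v, G v = ∫ v in Set.Ioi 0, G v := by
    intro G hG
    rw [setIntegral_eq_integral_of_forall_compl_eq_zero]
    intro v hv
    exact hG v (not_lt.1 hv)
  have hint : Integrable h := by
    have h1 : IntegrableOn h (Set.Ioi 0) := by
      refine Integrable.ofReal ?_
      refine integrableOn_exp_neg_mul_bounded hγ (measurable_passageCDF lam d _) (C := 1)
        fun t _ => ?_
      rw [abs_of_nonneg (passageCDF_nonneg lam d _ t)]; exact passageCDF_le_one lam d _ t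
    refine (integrableOn_iff_integrable_of_support_subset ?_).1 h1
    intro v hv
    by_contra hv'
    exact hv (by simp [hh, hF0 v (not_lt.1 hv')])
  have hfour : ∀ ξ : ℝ, FourierTransform.fourier h ξ =
      laplace F ((γ : ℂ) + ((2 * Real.pi * ξ : ℝ) : ℂ) * Complex.I) := by
    intro ξ
    rw [Real.fourier_real_eq_integral_exp_smul, hIoi, laplace]
    · refine integral_congr_ae (Eventually.of_forall fun t => ?_)
      simp only [hh, smul_eq_mul]
      push_cast
      rw [← mul_assoc, ← Complex.exp_add]
      congr 2
      ring
    · intro v hv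
      simp [hh, hF0 v hv]
  have hL := integrable_laplace_passageCDF_line lam d a hγ
  have h2π : (2 * Real.pi : ℝ) ≠ 0 := by positivity
  have hfint : Integrable (FourierTransform.fourier h) := by
    have : FourierTransform.fourier h = fun ξ : ℝ =>
        laplace F ((γ : ℂ) + ((2 * Real.pi * ξ : ℝ) : ℂ) * Complex.I) := funext hfour
    rw [this]
    exact hL.comp_mul_left' h2π
  have key := hint.fourierInv_fourier_eq hfint (v := v) hcont.continuousAt
  rw [Real.fourierInv_eq_fourier_neg, Real.fourier_real_eq_integral_exp_smul] at key
  -- The substitution `u = 2πξ` between frequency and imaginary part produces the factor `2π`.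
  have hcv := Measure.integral_comp_mul_left (fun u : ℝ =>
    Complex.exp (((u * v : ℝ) : ℂ) * Complex.I) *
      laplace F ((γ : ℂ) + (u : ℂ) * Complex.I)) (2 * Real.pi)
  have hkey2 : ∫ ξ : ℝ, Complex.exp ((((2 * Real.pi * ξ) * v : ℝ) : ℂ) * Complex.I) *
      laplace F ((γ : ℂ) + ((2 * Real.pi * ξ : ℝ) : ℂ) * Complex.I) = h v := by
    rw [← key]
    refine integral_congr_ae (Eventually.of_forall fun ξ => ?_)
    simp only [hfour, smul_eq_mul]
    congr 3
    push_cast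
    ring
  rw [hkey2] at hcv
  rw [abs_of_pos (by positivity)] at hcv
  rw [← show h v = ((Real.exp (-(γ * v)) * F v : ℝ) : ℂ) from rfl, hcv, Complex.real_smul]
  push_cast
  rw [← mul_assoc]
  have : (2 * Real.pi : ℂ) ≠ 0 := by exact_mod_cast h2π
  rw [mul_inv_cancel₀ this, one_mul]

end Laplace

/-! ### The Bromwich integral of the transform -/

section Bromwich

variable (lam d lam' d' : ℕ → ℝ≥0)

lemma laplaceConverges_congr_re {f : ℝ → ℝ} (hf : Measurable f) {s s' : ℂ} (h : s.re = s'.re) :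
    LaplaceConverges f s ↔ LaplaceConverges f s' := by
  rw [laplaceConverges_iff hf, laplaceConverges_iff hf, h]

lemma measurable_passageTail (b : ℕ) : Measurable fun t => 1 - passageCDF lam d b t :=
  measurable_const.sub (measurable_passageCDF lam d b)

lemma laplaceConverges_killedDensity (κ : ℝ) (b : ℕ) {w : ℂ}
    (hg : LaplaceConverges (passageDensity lam d b) w)
    (htail : LaplaceConverges (fun t => 1 - passageCDF lam d b t) w) :
    LaplaceConverges (killedDensity lam d κ b) w := by
  refine ((htail.const_mul (κ : ℂ)).add hg).congr (Eventually.of_forall fun t => ?_)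
  simp only [killedDensity, Pi.add_apply]
  push_cast
  ring

/-- Laplace transform of the killed density, through that of the first-passage density. -/
lemma laplace_killedDensity_succ (κ : ℝ) (b : ℕ) {w : ℂ} (hw : w ≠ 0)
    (hg : LaplaceConverges (passageDensity lam d (b + 1)) w)
    (htail : LaplaceConverges (fun t => 1 - passageCDF lam d (b + 1) t) w)
    (h0 : Tendsto (fun t => Real.exp (-(w.re * t)) * (1 - passageCDF lam d (b + 1) t)) atTop
      (𝓝 0)) :
    laplace (killedDensity lam d κ (b + 1)) w =
      laplace (passageDensity lam d (b + 1)) w +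
        κ / w * (1 - laplace (passageDensity lam d (b + 1)) w) := by
  have hneg : LaplaceConverges (fun t => -passageDensity lam d (b + 1) t) w := by
    refine hg.neg.congr (Eventually.of_forall fun t => ?_)
    simp
  have h1 := laplace_deriv htail hneg
    (continuousWithinAt_const.sub (continuousWithinAt_passageCDF_zero lam d (b + 1)))
    (fun t ht => (hasDerivAt_passageCDF lam d (b + 1) ht).const_sub 1) h0
  have h2 : laplace (fun t => -passageDensity lam d (b + 1) t) w =
      -laplace (passageDensity lam d (b + 1)) w := by
    rw [laplace, laplace, ← integral_neg]
    refine integral_congr_ae (Eventually.of_forall fun t => ?_)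
    simp
  have h3 : laplace (killedDensity lam d κ (b + 1)) w =
      κ * laplace (fun t => 1 - passageCDF lam d (b + 1) t) w +
        laplace (passageDensity lam d (b + 1)) w := by
    rw [laplace, laplace, laplace, ← integral_const_mul, ← integral_add (htail.const_mul _) hg]
    refine integral_congr_ae (Eventually.of_forall fun t => ?_)
    simp only [killedDensity]
    push_cast
    ring
  rw [passageCDF_succ_zero, h2] at h1
  rw [h3]
  field_simp
  push_cast at h1
  linear_combination (-(κ : ℂ)) * h1

/-- The Bromwich integral of the transform is the value of the race. -/
lemma hasInverseLaplaceAt_quoteTransform (a b : ℕ) {Λ γ : ℝ} (hγ : 0 < γ) (hΛγ : γ ≠ 2 * Λ)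
    (hg : LaplaceConverges (passageDensity lam' d' (b + 1)) (2 * Λ - γ : ℝ))
    (htail : LaplaceConverges (fun t => 1 - passageCDF lam' d' (b + 1) t) (2 * Λ - γ : ℝ))
    (h0 : Tendsto (fun t => Real.exp (-((2 * Λ - γ) * t)) * (1 - passageCDF lam' d' (b + 1) t))
      atTop (𝓝 0)) :
    HasInverseLaplaceAt (quoteTransform (laplace (passageDensity lam d (a + 1)))
      (laplace (passageDensity lam' d' (b + 1))) Λ) γ 0
      (raceValue lam d lam' d' (2 * Λ) (a + 1) (b + 1) : ℂ) := by
  set F := passageCDF lam d (a + 1) with hF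
  set k := killedDensity lam' d' (2 * Λ) (b + 1) with hk
  set S : ℝ → ℂ := fun u => (γ : ℂ) + (u : ℂ) * Complex.I with hS
  have hSre : ∀ u, (S u).re = γ := fun u => by simp [hS]
  have hwre : ∀ u, (2 * (Λ : ℂ) - S u).re = 2 * Λ - γ := fun u => by simp [hS]
  have hkc : LaplaceConverges k (2 * Λ - γ : ℝ) :=
    laplaceConverges_killedDensity lam' d' _ _ hg htail
  -- The factor `1 / s` turns `f̂_i` into the transform of `F`, and the bracket is the transform of
  -- `k` at `2Λ - s`. On the line `s = γ + iu` the latter carries the oscillation `e^{iuv}`.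
  have hint : bromwichIntegrand (quoteTransform (laplace (passageDensity lam d (a + 1)))
      (laplace (passageDensity lam' d' (b + 1))) Λ) γ 0 = fun u => ∫ v in Set.Ioi (0 : ℝ),
        (laplace F (S u) * (Complex.exp (-((2 * Λ - γ : ℝ) : ℂ) * (v : ℂ)) * (k v : ℂ))) *
          Complex.exp (((u * v : ℝ) : ℂ) * Complex.I) := by
    funext u
    have hs : 0 < (S u).re := by rw [hSre]; exact hγ
    have hs0 : S u ≠ 0 := by intro h; rw [h] at hs; simp at hs
    have hw0 : 2 * (Λ : ℂ) - S u ≠ 0 := by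
      intro h
      have := hwre u
      rw [h] at this
      exact hΛγ (by simp at this; linarith)
    have hre : (2 * (Λ : ℂ) - S u).re = (((2 * Λ - γ : ℝ) : ℂ)).re := by rw [hwre]; simp
    have hk1 := laplace_killedDensity_succ lam' d' (2 * Λ) b hw0
      ((laplaceConverges_congr_re (measurable_passageDensity lam' d' _) hre).2 hg)
      ((laplaceConverges_congr_re (measurable_passageTail lam' d' _) hre).2 htail)
      (by rw [hwre]; exact h0)
    simp only [bromwichIntegrand, quoteTransform]
    change Complex.exp (S u * _) * (1 / S u * _ * _) = _
    rw [laplace_passageDensity_succ lam d a hs]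
    push_cast at hk1
    rw [← hk1, Complex.ofReal_zero, mul_zero, Complex.exp_zero, one_mul]
    have : 1 / S u * (S u * laplace (passageCDF lam d (a + 1)) (S u)) = laplace F (S u) := by
      rw [← mul_assoc, one_div, inv_mul_cancel₀ hs0, one_mul]
    rw [this]
    conv_lhs => rw [laplace.eq_def (killedDensity lam' d' (2 * Λ) (b + 1)), ← integral_const_mul]
    refine integral_congr_ae (Eventually.of_forall fun v => ?_)
    simp only [mul_assoc]
    congr 1
    rw [mul_comm (k v : ℂ), ← mul_assoc, ← Complex.exp_add]
    congr 2
    simp only [hS]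
    push_cast
    ring
  have hL := integrable_laplace_passageCDF_line lam d a hγ
  -- Fubini applies: up to a factor of modulus one the integrand is a product of an integrable
  -- function of `u` and one of `v`.
  have hprod : Integrable (fun p : ℝ × ℝ => (laplace F (S p.1) *
      (Complex.exp (-((2 * Λ - γ : ℝ) : ℂ) * (p.2 : ℂ)) * (k p.2 : ℂ))) *
          Complex.exp (((p.1 * p.2 : ℝ) : ℂ) * Complex.I))
      (volume.prod (volume.restrict (Set.Ioi 0))) := by
    refine (hL.mul_prod hkc).mul_bdd (c := 1) ?_ ?_
    · exact Measurable.aestronglyMeasurable (by fun_prop)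
    · exact Eventually.of_forall fun p => (Complex.norm_exp_ofReal_mul_I _).le
  refine ⟨by rw [hint]; exact hprod.integral_prod_left, ?_⟩
  rw [hint, integral_integral_swap hprod]
  have hinner : ∀ v : ℝ, ∫ u : ℝ, (laplace F (S u) *
      (Complex.exp (-((2 * Λ - γ : ℝ) : ℂ) * (v : ℂ)) * (k v : ℂ))) *
          Complex.exp (((u * v : ℝ) : ℂ) * Complex.I) =
        2 * Real.pi * ((Real.exp (-(2 * Λ * v)) * (F v * k v) : ℝ) : ℂ) := by
    intro v
    have h1 : ∀ u : ℝ, (laplace F (S u) *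
      (Complex.exp (-((2 * Λ - γ : ℝ) : ℂ) * (v : ℂ)) * (k v : ℂ))) *
          Complex.exp (((u * v : ℝ) : ℂ) * Complex.I) =
        (Complex.exp (((u * v : ℝ) : ℂ) * Complex.I) * laplace F (S u)) *
          (Complex.exp (-((2 * Λ - γ : ℝ) : ℂ) * (v : ℂ)) * (k v : ℂ)) := fun u => by ring
    simp only [h1]
    rw [integral_mul_const, integral_laplace_passageCDF_line lam d a hγ v]
    -- The weight `e^{-γv}` from the inversion recombines with `e^{-(2Λ-γ)v}`; the abscissa `γ`
    -- disappears from the result.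
    have h2 : Real.exp (-(2 * Λ * v)) = Real.exp (-(γ * v)) * Real.exp (-(2 * Λ - γ) * v) := by
      rw [← Real.exp_add]; congr 1; ring
    rw [h2]
    push_cast
    ring
  simp only [hinner]
  rw [integral_const_mul, integral_complex_ofReal, raceValue, ← mul_assoc]
  have : (1 / (2 * Real.pi) * (2 * Real.pi) : ℂ) = 1 := by
    have : (Real.pi : ℂ) ≠ 0 := by exact_mod_cast Real.pi_ne_zero
    field_simp
  rw [this, one_mul]

end Bromwich

/-! ### Tails and exponential moments of first-passage times -/

section Tail

variable (lam d : ℕ → ℝ≥0)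

lemma abs_passageTail_le (b : ℕ) (t : ℝ) : |1 - passageCDF lam d b t| ≤ 1 := by
  rw [abs_of_nonneg (sub_nonneg.2 (passageCDF_le_one lam d b t))]
  linarith [passageCDF_nonneg lam d b t]

lemma setIntegral_passageDensity_Ioi (b : ℕ)
    (h1 : Tendsto (passageCDF lam d (b + 1)) atTop (𝓝 1)) {t : ℝ} (ht : 0 ≤ t) :
    ∫ u in Set.Ioi t, passageDensity lam d (b + 1) u = 1 - passageCDF lam d (b + 1) t :=
  integral_Ioi_of_hasDerivAt_of_tendsto (continuous_passageCDF_succ lam d b).continuousWithinAt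
    (fun _ hu => hasDerivAt_passageCDF lam d _ (ht.trans_lt hu))
    ((integrableOn_passageDensity lam d _).mono_set (Set.Ioi_subset_Ioi ht)) h1

/-- Exponential moments of the first-passage time control its tail. -/
lemma tendsto_exp_mul_passageTail (b : ℕ)
    (h1 : Tendsto (passageCDF lam d (b + 1)) atTop (𝓝 1)) {η : ℝ} (hη : 0 ≤ η)
    (hg : IntegrableOn (fun t => Real.exp (η * t) * passageDensity lam d (b + 1) t) (Set.Ioi 0)) :
    Tendsto (fun t => Real.exp (η * t) * (1 - passageCDF lam d (b + 1) t)) atTop (𝓝 0) := by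
  have hlim : Tendsto (fun t => (∫ u in Set.Ioi (0 : ℝ),
      Real.exp (η * u) * passageDensity lam d (b + 1) u) -
      ∫ u in (0 : ℝ)..t, Real.exp (η * u) * passageDensity lam d (b + 1) u) atTop (𝓝 0) := by
    have := (tendsto_const_nhds (x := ∫ u in Set.Ioi (0 : ℝ),
      Real.exp (η * u) * passageDensity lam d (b + 1) u)).sub
      (intervalIntegral_tendsto_integral_Ioi 0 hg tendsto_id)
    rwa [sub_self] at this
  refine tendsto_of_tendsto_of_tendsto_of_le_of_le' tendsto_const_nhds hlim
    (Eventually.of_forall fun t => mul_nonneg (Real.exp_pos _).le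
      (sub_nonneg.2 (passageCDF_le_one lam d _ t))) ?_
  filter_upwards [eventually_ge_atTop 0] with t ht
  have hgt := hg.mono_set (Set.Ioi_subset_Ioi ht)
  -- The tail is the integral of the density over `(t, ∞)`, where `e^{ηt} ≤ e^{ηu}`; this bounds it
  -- by the remainder of a convergent integral.
  rw [← intervalIntegral.integral_Ioi_sub_Ioi hg ht, sub_sub_cancel,
    ← setIntegral_passageDensity_Ioi lam d b h1 ht, ← integral_const_mul]
  refine setIntegral_mono_on (((integrableOn_passageDensity lam d _).mono_set
    (Set.Ioi_subset_Ioi ht)).const_mul _) hgt measurableSet_Ioi fun u hu => ?_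
  refine mul_le_mul_of_nonneg_right (Real.exp_le_exp.2 ?_)
    (passageDensity_nonneg lam d _ (ht.trans_lt hu))
  exact mul_le_mul_of_nonneg_left (le_of_lt hu) hη

/-- Integration by parts: `e^{ηt} (1 - G(t)) + ∫₀ᵗ e^{ηu} g(u) du` has the nonnegative derivative `η
e^{ηt} (1 - G(t))` and a finite limit, so this derivative is integrable. -/
lemma integrableOn_exp_mul_passageTail (b : ℕ)
    (h1 : Tendsto (passageCDF lam d (b + 1)) atTop (𝓝 1)) {η : ℝ} (hη : 0 < η)
    (hg : IntegrableOn (fun t => Real.exp (η * t) * passageDensity lam d (b + 1) t) (Set.Ioi 0)) :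
    IntegrableOn (fun t => Real.exp (η * t) * (1 - passageCDF lam d (b + 1) t)) (Set.Ioi 0) := by
  have hii : ∀ s t, IntervalIntegrable
      (fun u => Real.exp (η * u) * passageDensity lam d (b + 1) u) volume s t := by
    intro s t
    have hc : ∀ c, IntervalIntegrable (passageCDF lam d c) volume s t := fun c =>
      (passageCDF_mono lam d c).intervalIntegrable
    refine IntervalIntegrable.continuousOn_mul ?_ (by fun_prop)
    exact (((hc _).sub (hc _)).const_mul _).add (((hc _).sub (hc _)).const_mul _)
  have hder : IntegrableOn (fun t => η * (Real.exp (η * t) * (1 - passageCDF lam d (b + 1) t)))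
      (Set.Ioi 0) := by
    refine integrableOn_Ioi_deriv_of_nonneg
      (g := fun t => Real.exp (η * t) * (1 - passageCDF lam d (b + 1) t) +
        ∫ u in (0 : ℝ)..t, Real.exp (η * u) * passageDensity lam d (b + 1) u)
      (l := 0 + ∫ u in Set.Ioi (0 : ℝ), Real.exp (η * u) * passageDensity lam d (b + 1) u)
      ?_ ?_ ?_ ?_
    · have := continuous_passageCDF_succ lam d b
      have h2 := intervalIntegral.continuous_primitive hii 0
      exact Continuous.continuousWithinAt (by fun_prop)
    · intro t ht
      have hE : HasDerivAt (fun t => Real.exp (η * t)) (Real.exp (η * t) * η) t := by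
        have := ((hasDerivAt_id t).const_mul η).exp
        simpa only [id, mul_one] using this
      have hcont : ContinuousAt (fun u => Real.exp (η * u) * passageDensity lam d (b + 1) u) t :=
        ContinuousAt.mul (by fun_prop) (hasDerivAt_passageDensity_succ lam d b ht).continuousAt
      have hmeas : Measurable fun u => Real.exp (η * u) * passageDensity lam d (b + 1) u := by
        have := measurable_passageDensity lam d (b + 1)
        fun_prop
      have hI := intervalIntegral.integral_hasDerivAt_right (hii 0 t)
        hmeas.stronglyMeasurable.stronglyMeasurableAtFilter hcont
      refine ((hE.mul ((hasDerivAt_passageCDF lam d (b + 1) ht).const_sub 1)).add hI).congr_deriv ?_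
      ring
    · exact fun t _ => mul_nonneg hη.le (mul_nonneg (Real.exp_pos _).le
        (sub_nonneg.2 (passageCDF_le_one lam d _ t)))
    · exact (tendsto_exp_mul_passageTail lam d b h1 hη.le hg).add
        (intervalIntegral_tendsto_integral_Ioi 0 hg tendsto_id)
  refine (hder.const_mul η⁻¹).congr (Eventually.of_forall fun t => ?_)
  simp only
  rw [← mul_assoc, inv_mul_cancel₀ hη.ne', one_mul]

/-- Convergence of the transforms in the strip on which the Bromwich integral is taken. -/
lemma laplaceConverges_passageTail (b : ℕ) {r : ℝ}
    (h : 0 < r ∨ (r < 0 ∧ Tendsto (passageCDF lam d (b + 1)) atTop (𝓝 1) ∧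
      LaplaceConverges (passageDensity lam d (b + 1)) (r : ℝ))) :
    LaplaceConverges (passageDensity lam d (b + 1)) (r : ℝ) ∧
    LaplaceConverges (fun t => 1 - passageCDF lam d (b + 1) t) (r : ℝ) ∧
    Tendsto (fun t => Real.exp (-(r * t)) * (1 - passageCDF lam d (b + 1) t)) atTop (𝓝 0) := by
  rcases h with hr | ⟨hr, h1, hg⟩
  · refine ⟨laplaceConverges_of_bounded (measurable_passageDensity lam d _)
      (fun t _ => abs_passageDensity_le lam d (b + 1) t) (by simpa using hr),
      laplaceConverges_of_bounded (measurable_passageTail lam d _)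
        (fun t _ => abs_passageTail_le lam d (b + 1) t) (by simpa using hr),
      tendsto_exp_neg_mul_bounded (fun t _ => abs_passageTail_le lam d (b + 1) t) hr⟩
  · have hη : 0 < -r := neg_pos.2 hr
    have hg' := (laplaceConverges_iff (measurable_passageDensity lam d _) _).1 hg
    simp only [Complex.ofReal_re, ← neg_mul] at hg'
    refine ⟨hg, (laplaceConverges_iff (measurable_passageTail lam d _) _).2 ?_, ?_⟩
    · simp only [Complex.ofReal_re, ← neg_mul]
      exact integrableOn_exp_mul_passageTail lam d b h1 hη hg'
    · simp only [← neg_mul]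
      exact tendsto_exp_mul_passageTail lam d b h1 hη.le hg'

end Tail

/-! ### From the Radon-Nikodym density to the explicit one -/

section DensityLink

variable {lam d : ℕ → ℝ≥0} {Ω : Type*} [MeasurableSpace Ω] {P : Measure Ω} {σ : Ω → ℝ≥0∞}

/-- The Radon-Nikodym derivative is determined only almost everywhere, which suffices because it is
used only through Laplace integrals. -/
lemma density_ae_eq_passageDensity {a : ℕ} (h : finiteLaw P σ = passageLaw lam d (a + 1)) :
    density P σ =ᵐ[volume.restrict (Set.Ioi 0)] passageDensity lam d (a + 1) := by
  have h1 : finiteLaw P σ = volume.withDensity ((Set.Ioi (0 : ℝ)).indicator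
      fun t => ENNReal.ofReal (passageDensity lam d (a + 1) t)) := by
    rw [h, passageLaw_succ_eq_withDensity, withDensity_indicator measurableSet_Ioi]
  have h2 := Measure.rnDeriv_withDensity (volume : Measure ℝ)
    ((measurable_passageDensity lam d (a + 1)).ennreal_ofReal.indicator
      (measurableSet_Ioi (a := (0 : ℝ))))
  rw [← h1] at h2
  rw [EventuallyEq, ae_restrict_iff' measurableSet_Ioi]
  filter_upwards [h2] with t ht ht0
  rw [density, ht, Set.indicator_of_mem ht0,
    ENNReal.toReal_ofReal (passageDensity_nonneg lam d _ ht0)]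

lemma finiteLaw_absolutelyContinuous {a : ℕ} (h : finiteLaw P σ = passageLaw lam d (a + 1)) :
    finiteLaw P σ ≪ volume := by
  rw [h, passageLaw_succ_eq_withDensity]
  exact (withDensity_absolutelyContinuous _ _).trans Measure.absolutelyContinuous_restrict

lemma laplace_density_eq {a : ℕ} (h : finiteLaw P σ = passageLaw lam d (a + 1)) :
    laplace (density P σ) = laplace (passageDensity lam d (a + 1)) := by
  funext s
  refine integral_congr_ae ?_
  filter_upwards [density_ae_eq_passageDensity h] with t ht
  rw [ht]

lemma laplaceConverges_density_iff {a : ℕ} (h : finiteLaw P σ = passageLaw lam d (a + 1)) (s : ℂ) :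
    LaplaceConverges (density P σ) s ↔ LaplaceConverges (passageDensity lam d (a + 1)) s := by
  refine integrable_congr ?_
  filter_upwards [density_ae_eq_passageDensity h] with t ht
  rw [ht]

lemma tendsto_passageCDF_one [IsProbabilityMeasure P] {a : ℕ}
    (h : finiteLaw P σ = passageLaw lam d a) (hσm : AEMeasurable σ P)
    (hσ : ∀ᵐ ω ∂P, σ ω < ⊤) : Tendsto (passageCDF lam d a) atTop (𝓝 1) := by
  have h1 : passageLaw lam d a Set.univ = 1 := by
    rw [← h, finiteLaw, Measure.restrict_eq_self_of_ae_mem (s := {ω | σ ω < ⊤}) hσ,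
      Measure.map_apply_of_aemeasurable hσm.ennreal_toReal MeasurableSet.univ]
    simp
  have h2 := tendsto_measure_Iic_atTop (passageLaw lam d a)
  rw [h1] at h2
  exact (ENNReal.tendsto_toReal ENNReal.one_ne_top).comp h2

end DensityLink

/-! ### Three-term recurrences and continued fractions -/

section Recurrence

/-- Approximants of the continued fraction `m i / (b i - p i * (m (i + 1) / (b (i + 1) - ⋯)))`. -/
def ratioApprox {K : Type*} [Field K] (p m b : ℕ → K) : ℕ → ℕ → K
  | 0, _ => 0
  | n + 1, i => m i / (b i - p i * ratioApprox p m b n (i + 1))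

/-- Pulling `-lam i` out of each numerator leaves the recursion of `ratioApprox`; the factor pulled
out of the next level becomes `p i` in the denominator. -/
lemma convs'Aux_eq_ratioApprox {K : Type*} [Field K] (p m b lam : ℕ → K) (hp : ∀ i, p i = lam (i + 1))
    (n i : ℕ) :
    GenContFract.convs'Aux (Stream'.Seq.ofStream fun k =>
      (⟨-lam (i + k) * m (i + k), b (i + k)⟩ : GenContFract.Pair K)) n =
      -lam i * ratioApprox p m b n i := by
  induction n generalizing i with
  | zero => simp [GenContFract.convs'Aux, ratioApprox]
  | succ n ih =>
    have hhead : (Stream'.Seq.ofStream fun k =>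
        (⟨-lam (i + k) * m (i + k), b (i + k)⟩ : GenContFract.Pair K)).head =
          some ⟨-lam i * m i, b i⟩ := rfl
    have htail : (Stream'.Seq.ofStream fun k =>
        (⟨-lam (i + k) * m (i + k), b (i + k)⟩ : GenContFract.Pair K)).tail =
          Stream'.Seq.ofStream fun k =>
            (⟨-lam (i + 1 + k) * m (i + 1 + k), b (i + 1 + k)⟩ : GenContFract.Pair K) := by
      refine Stream'.Seq.ext fun k => ?_
      change some _ = some _
      simp only [Stream'.get, add_assoc, add_comm 1 k]
    rw [GenContFract.convs'Aux_succ_some hhead, htail, ih, ratioApprox, hp]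
    simp only
    rw [neg_mul (lam (i + 1)), ← sub_eq_add_neg, mul_div_assoc]

/-- Data of a three-term recurrence `b i * X (i + 1) = p i * X (i + 2) + m i * X i` with positive
coefficients, whose solution `X` is the sum over `n` of the weights `T n` of the paths of length
`n` from a level to `0`. -/
structure IsPathSum (p m b : ℕ → ℝ) (T : ℕ → ℕ → ℝ) (X : ℕ → ℝ) : Prop where
  p_pos : ∀ i, 0 < p i
  m_pos : ∀ i, 0 < m i
  b_pos : ∀ i, 0 < b i
  nonneg : ∀ n a, 0 ≤ T n a
  zero_zero : T 0 0 = 1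
  zero_succ : ∀ a, T 0 (a + 1) = 0
  succ_zero : ∀ n, T (n + 1) 0 = 0
  succ_succ : ∀ n a, b a * T (n + 1) (a + 1) = p a * T n (a + 2) + m a * T n a
  hasSum : ∀ a, HasSum (fun n => T n a) (X a)

namespace IsPathSum

variable {p m b : ℕ → ℝ} {T : ℕ → ℕ → ℝ} {X : ℕ → ℝ} (h : IsPathSum p m b T X)
include h

lemma zero_eq : X 0 = 1 := by
  refine (h.hasSum 0).unique ?_
  rw [← h.zero_zero]
  refine hasSum_single 0 ?_
  rintro (_ | n) hn
  · exact absurd rfl hn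
  · exact h.succ_zero n

lemma recurrence (a : ℕ) : b a * X (a + 1) = p a * X (a + 2) + m a * X a := by
  have h1 := ((h.hasSum (a + 2)).mul_left (p a)).add ((h.hasSum a).mul_left (m a))
  simp only [← h.succ_succ] at h1
  refine HasSum.unique ?_ h1
  refine HasSum.mul_left (b a) ?_
  have := (hasSum_nat_add_iff' 1).2 (h.hasSum (a + 1))
  simpa [h.zero_succ] using this

lemma X_nonneg (a : ℕ) : 0 ≤ X a := (h.hasSum a).nonneg fun n => h.nonneg n a

lemma X_pos (a : ℕ) : 0 < X a := by
  induction a with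
  | zero => rw [h.zero_eq]; exact one_pos
  | succ a ih =>
    refine pos_of_mul_pos_right (a := b a) ?_ (h.b_pos a).le
    rw [h.recurrence]
    exact add_pos_of_nonneg_of_pos (mul_nonneg (h.p_pos a).le (h.X_nonneg _))
      (mul_pos (h.m_pos a) ih)

/-- The recurrence divided by `X (i + 1)`: the exact ratios solve the recursion that the
approximants truncate. -/
lemma sub_ratio_eq (i : ℕ) :
    b i - p i * (X (i + 2) / X (i + 1)) = m i / (X (i + 1) / X i) := by
  have h1 := (h.X_pos i).ne'
  have h2 := (h.X_pos (i + 1)).ne'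
  field_simp
  linear_combination h.recurrence i

lemma ratio_pos (i : ℕ) : 0 < X (i + 1) / X i := div_pos (h.X_pos _) (h.X_pos _)

/-- Truncation replaces a positive ratio by `0`, and each step of the recursion is increasing in its
tail, so the exact ratios stay above and keep the denominators positive. -/
lemma approx_mem (n i : ℕ) :
    0 ≤ ratioApprox p m b n i ∧ ratioApprox p m b n i ≤ X (i + 1) / X i := by
  induction n generalizing i with
  | zero => exact ⟨le_rfl, (h.ratio_pos i).le⟩
  | succ n ih =>
    have h1 : m i / (X (i + 1) / X i) ≤ b i - p i * ratioApprox p m b n (i + 1) := by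
      rw [← h.sub_ratio_eq]
      exact sub_le_sub_left (mul_le_mul_of_nonneg_left (ih (i + 1)).2 (h.p_pos i).le) _
    have h2 : 0 < m i / (X (i + 1) / X i) := div_pos (h.m_pos i) (h.ratio_pos i)
    refine ⟨div_nonneg (h.m_pos i).le (h2.le.trans h1), ?_⟩
    rw [ratioApprox, div_le_iff₀ (h2.trans_le h1)]
    rw [div_le_iff₀ (h.ratio_pos i)] at h1
    linarith

lemma approx_denom_pos (n i : ℕ) : 0 < b i - p i * ratioApprox p m b n (i + 1) := by
  refine (div_pos (h.m_pos i) (h.ratio_pos i)).trans_le ?_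
  rw [← h.sub_ratio_eq]
  exact sub_le_sub_left (mul_le_mul_of_nonneg_left (h.approx_mem n (i + 1)).2 (h.p_pos i).le) _

lemma approx_mono (i : ℕ) : Monotone fun n => ratioApprox p m b n i := by
  refine monotone_nat_of_le_succ fun n => ?_
  induction n generalizing i with
  | zero => exact (h.approx_mem 1 i).1
  | succ n ih =>
    exact div_le_div_of_nonneg_left (h.m_pos i).le (h.approx_denom_pos (n + 1) i)
      (sub_le_sub_left (mul_le_mul_of_nonneg_left (ih (i + 1)) (h.p_pos i).le) _)

/-- The path sum is dominated by every nonnegative solution of the recurrence. -/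
lemma le_of_recurrence {x : ℕ → ℝ} (hx : ∀ a, 0 ≤ x a) (hx0 : x 0 = 1)
    (hrec : ∀ a, b a * x (a + 1) = p a * x (a + 2) + m a * x a) (a : ℕ) : X a ≤ x a := by
  have key : ∀ N a, ∑ n ∈ Finset.range N, T n a ≤ x a := by
    intro N
    induction N with
    | zero => intro a; simpa using hx a
    | succ N ih =>
      intro a
      rw [Finset.sum_range_succ']
      cases a with
      | zero => simp [h.succ_zero, h.zero_zero, hx0]
      | succ a =>
        rw [h.zero_succ, add_zero]
        refine le_of_mul_le_mul_left ?_ (h.b_pos a)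
        rw [hrec, Finset.mul_sum]
        simp only [h.succ_succ]
        rw [Finset.sum_add_distrib, ← Finset.mul_sum, ← Finset.mul_sum]
        exact add_le_add (mul_le_mul_of_nonneg_left (ih _) (h.p_pos a).le)
          (mul_le_mul_of_nonneg_left (ih _) (h.m_pos a).le)
  exact le_of_tendsto' (h.hasSum a).tendsto_sum_nat fun N => key N a

/-- The approximants increase to limits `g i` no larger than the exact ratios. The products of the
`g i` form a nonnegative solution, hence dominate `X` by minimality; since they are also at most
`X`, equality holds. -/
lemma tendsto_approx (i : ℕ) :
    Tendsto (fun n => ratioApprox p m b n i) atTop (𝓝 (X (i + 1) / X i)) := by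
  have hlim : ∀ i, ∃ g, Tendsto (fun n => ratioApprox p m b n i) atTop (𝓝 g) := fun i =>
    ⟨_, tendsto_atTop_ciSup (h.approx_mono i)
      ⟨X (i + 1) / X i, by rintro _ ⟨n, rfl⟩; exact (h.approx_mem n i).2⟩⟩
  choose g hg using hlim
  have hg0 : ∀ i, 0 ≤ g i := fun i => ge_of_tendsto' (hg i) fun n => (h.approx_mem n i).1
  have hgle : ∀ i, g i ≤ X (i + 1) / X i := fun i =>
    le_of_tendsto' (hg i) fun n => (h.approx_mem n i).2
  have hgrec : ∀ i, g i * (b i - p i * g (i + 1)) = m i := by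
    intro i
    have h1 : Tendsto (fun n => ratioApprox p m b (n + 1) i *
        (b i - p i * ratioApprox p m b n (i + 1))) atTop (𝓝 (g i * (b i - p i * g (i + 1)))) :=
      ((tendsto_add_atTop_iff_nat 1).2 (hg i)).mul
        (tendsto_const_nhds.sub ((hg (i + 1)).const_mul _))
    refine tendsto_nhds_unique h1 (tendsto_const_nhds.congr fun n => ?_)
    rw [ratioApprox, div_mul_cancel₀ _ (h.approx_denom_pos n i).ne']
  set x : ℕ → ℝ := fun a => ∏ i ∈ Finset.range a, g i with hx
  have hxs : ∀ a, x (a + 1) = x a * g a := fun a => Finset.prod_range_succ _ _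
  have hX := h.le_of_recurrence (x := x) (fun a => Finset.prod_nonneg fun i _ => hg0 i)
    (by simp [hx]) (fun a => by rw [hxs (a + 1), hxs a]; linear_combination x a * hgrec a)
  have hx' : ∀ a, x a ≤ X a := by
    intro a
    induction a with
    | zero => simp [hx, h.zero_eq]
    | succ a ih =>
      rw [hxs]
      refine (mul_le_mul ih (hgle a) (hg0 a) (h.X_nonneg a)).trans_eq ?_
      rw [mul_div_cancel₀ _ (h.X_pos a).ne']
  have heq : ∀ a, x a = X a := fun a => le_antisymm (hx' a) (hX a)
  have hgi : g i = X (i + 1) / X i := by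
    rw [eq_div_iff (h.X_pos i).ne', ← heq, ← heq, hxs, mul_comm]
  rw [← hgi]
  exact hg i

/-- Iterating the recurrence `n` times bounds a homogeneous solution by the tail of the path
sum. -/
lemma norm_le_tail {D : ℕ → ℂ} {C : ℝ} {B : ℕ → ℂ} (hB : ∀ i, b i ≤ ‖B i‖) (hD0 : D 0 = 0)
    (hD : ∀ a, ‖D a‖ ≤ C * X a)
    (hrec : ∀ a, B a * D (a + 1) = p a * D (a + 2) + m a * D a) (n a : ℕ) :
    ‖D a‖ ≤ C * (X a - ∑ k ∈ Finset.range n, T k a) := by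
  induction n generalizing a with
  | zero => simpa using hD a
  | succ n ih =>
    cases a with
    | zero =>
      rw [hD0, norm_zero, Finset.sum_range_succ', h.zero_eq]
      simp [h.succ_zero, h.zero_zero]
    | succ a =>
      refine le_of_mul_le_mul_left ?_ (h.b_pos a)
      have h1 : b a * ‖D (a + 1)‖ ≤ p a * ‖D (a + 2)‖ + m a * ‖D a‖ := by
        calc b a * ‖D (a + 1)‖ ≤ ‖B a‖ * ‖D (a + 1)‖ :=
              mul_le_mul_of_nonneg_right (hB a) (norm_nonneg _)
          _ = ‖(p a : ℂ) * D (a + 2) + m a * D a‖ := by rw [← norm_mul, hrec]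
          _ ≤ _ := by
              refine (norm_add_le _ _).trans_eq ?_
              rw [norm_mul, norm_mul, Complex.norm_real, Complex.norm_real, Real.norm_eq_abs,
                Real.norm_eq_abs, abs_of_pos (h.p_pos a), abs_of_pos (h.m_pos a)]
      refine h1.trans ((add_le_add (mul_le_mul_of_nonneg_left (ih (a + 2)) (h.p_pos a).le)
        (mul_le_mul_of_nonneg_left (ih a) (h.m_pos a).le)).trans_eq ?_)
      rw [Finset.sum_range_succ', h.zero_succ, add_zero]
      have h2 : b a * ∑ k ∈ Finset.range n, T (k + 1) (a + 1) =
          p a * ∑ k ∈ Finset.range n, T k (a + 2) + m a * ∑ k ∈ Finset.range n, T k a := by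
        rw [Finset.mul_sum]
        simp only [h.succ_succ]
        rw [Finset.sum_add_distrib, Finset.mul_sum, Finset.mul_sum]
      linear_combination (-C) * h.recurrence a + C * h2

/-- The real fraction is a majorant: `‖B i‖ ≥ b i` makes the complex denominators at least as large
in modulus, and differences of approximants satisfy the same recursion on both sides. -/
lemma norm_approx_sub_le {B : ℕ → ℂ} (hB : ∀ i, b i ≤ ‖B i‖) (n k i : ℕ) :
    ‖ratioApprox (fun i => (p i : ℂ)) (fun i => (m i : ℂ)) B (n + k) i -
      ratioApprox (fun i => (p i : ℂ)) (fun i => (m i : ℂ)) B n i‖ ≤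
      ratioApprox p m b (n + k) i - ratioApprox p m b n i := by
  set g := ratioApprox p m b with hg
  set gc := ratioApprox (fun i => (p i : ℂ)) (fun i => (m i : ℂ)) B with hgc
  have hp : ∀ i, ‖(p i : ℂ)‖ = p i := fun i => by
    rw [Complex.norm_real, Real.norm_eq_abs, abs_of_pos (h.p_pos i)]
  have hm : ∀ i, ‖(m i : ℂ)‖ = m i := fun i => by
    rw [Complex.norm_real, Real.norm_eq_abs, abs_of_pos (h.m_pos i)]
  have hden' : ∀ n i, ‖gc n (i + 1)‖ ≤ g n (i + 1) →
      b i - p i * g n (i + 1) ≤ ‖B i - p i * gc n (i + 1)‖ := by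
    intro n i hi
    refine le_trans ?_ (norm_sub_norm_le _ _)
    rw [norm_mul, hp]
    exact sub_le_sub (hB i) (mul_le_mul_of_nonneg_left hi (h.p_pos i).le)
  have hnorm : ∀ n i, ‖gc n i‖ ≤ g n i := by
    intro n
    induction n with
    | zero => intro i; simp [hg, hgc, ratioApprox]
    | succ n ih =>
      intro i
      rw [hgc, hg, ratioApprox, ratioApprox, norm_div, hm]
      exact div_le_div_of_nonneg_left (h.m_pos i).le (h.approx_denom_pos n i)
        (hden' n i (ih (i + 1)))
  have hden : ∀ n i, b i - p i * g n (i + 1) ≤ ‖B i - p i * gc n (i + 1)‖ := fun n i =>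
    hden' n i (hnorm n (i + 1))
  induction n generalizing i with
  | zero =>
    have h0 : gc 0 i = 0 := rfl
    have h1 : g 0 i = 0 := rfl
    rw [h0, h1, sub_zero, sub_zero]
    exact hnorm _ _
  | succ n ih =>
    have hpos := h.approx_denom_pos
    have hne : ∀ n i, B i - p i * gc n (i + 1) ≠ 0 := fun n i =>
      norm_pos_iff.1 ((hpos n i).trans_le (hden n i))
    have hc : gc (n + 1 + k) i - gc (n + 1) i = m i * p i * (gc (n + k) (i + 1) - gc n (i + 1)) /
        ((B i - p i * gc (n + k) (i + 1)) * (B i - p i * gc n (i + 1))) := by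
      rw [Nat.add_right_comm, hgc, ratioApprox, ratioApprox, ← hgc,
        div_sub_div _ _ (hne (n + k) i) (hne n i)]
      congr 1
      ring
    have hr : g (n + 1 + k) i - g (n + 1) i = m i * p i * (g (n + k) (i + 1) - g n (i + 1)) /
        ((b i - p i * g (n + k) (i + 1)) * (b i - p i * g n (i + 1))) := by
      rw [Nat.add_right_comm, hg, ratioApprox, ratioApprox, ← hg,
        div_sub_div _ _ (hpos (n + k) i).ne' (hpos n i).ne']
      congr 1
      ring
    rw [hc, hr, norm_div, norm_mul, norm_mul, norm_mul, hp, hm]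
    have hmp : 0 ≤ m i * p i := mul_nonneg (h.m_pos i).le (h.p_pos i).le
    refine div_le_div₀ (mul_nonneg hmp ((norm_nonneg _).trans (ih (i + 1))))
      (mul_le_mul_of_nonneg_left (ih (i + 1)) hmp) (mul_pos (hpos _ _) (hpos _ _)) ?_
    exact mul_le_mul (hden _ _) (hden _ _) (hpos _ _).le (norm_nonneg _)

/-- A solution of the complex recurrence which is dominated by the path sum is the product of
the values of the continued fractions, which converge. -/
theorem exists_tendsto_approx {B : ℕ → ℂ} (hB : ∀ i, b i ≤ ‖B i‖) {Φ : ℕ → ℂ} (hΦ0 : Φ 0 = 1)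
    (hΦ : ∀ a, ‖Φ a‖ ≤ X a)
    (hrec : ∀ a, B a * Φ (a + 1) = p a * Φ (a + 2) + m a * Φ a) :
    ∃ G : ℕ → ℂ, (∀ i, Tendsto (fun n =>
      ratioApprox (fun i => (p i : ℂ)) (fun i => (m i : ℂ)) B n i) atTop (𝓝 (G i))) ∧
      ∀ a, Φ a = ∏ i ∈ Finset.range a, G i := by
  set gc := ratioApprox (fun i => (p i : ℂ)) (fun i => (m i : ℂ)) B with hgc
  have hle := h.norm_approx_sub_le hB
  have hcauchy : ∀ i, ∃ G, Tendsto (fun n => gc n i) atTop (𝓝 G) := by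
    intro i
    refine cauchySeq_tendsto_of_complete (Metric.cauchySeq_iff'.2 fun ε hε => ?_)
    obtain ⟨N, hN⟩ := Metric.cauchySeq_iff'.1 (h.tendsto_approx i).cauchySeq ε hε
    refine ⟨N, fun n hn => ?_⟩
    obtain ⟨k, rfl⟩ := Nat.exists_eq_add_of_le hn
    refine lt_of_le_of_lt ?_ (hN (N + k) hn)
    rw [dist_eq_norm, dist_eq_norm, Real.norm_eq_abs]
    exact (hle N k i).trans (le_abs_self _)
  choose G hG using hcauchy
  have hnorm : ∀ n i, ‖gc n i‖ ≤ ratioApprox p m b n i := by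
    intro n i
    have := hle 0 n i
    simpa [ratioApprox] using this
  have hne : ∀ n i, B i - p i * gc n (i + 1) ≠ 0 := by
    intro n i
    refine norm_pos_iff.1 ((h.approx_denom_pos n i).trans_le ?_)
    refine le_trans ?_ (norm_sub_norm_le _ _)
    rw [norm_mul, Complex.norm_real, Real.norm_eq_abs, abs_of_pos (h.p_pos i)]
    exact sub_le_sub (hB i) (mul_le_mul_of_nonneg_left (hnorm _ _) (h.p_pos i).le)
  have hGrec : ∀ i, G i * (B i - p i * G (i + 1)) = m i := by
    intro i
    have h1 : Tendsto (fun n => gc (n + 1) i * (B i - p i * gc n (i + 1))) atTop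
        (𝓝 (G i * (B i - p i * G (i + 1)))) :=
      ((tendsto_add_atTop_iff_nat 1).2 (hG i)).mul
        (tendsto_const_nhds.sub ((hG (i + 1)).const_mul _))
    refine tendsto_nhds_unique h1 (tendsto_const_nhds.congr fun n => ?_)
    rw [hgc, ratioApprox, ← hgc, div_mul_cancel₀ _ (hne n i)]
  have hGle : ∀ i, ‖G i‖ ≤ X (i + 1) / X i := fun i =>
    le_of_tendsto' (hG i).norm fun n => (hnorm n i).trans (h.approx_mem n i).2
  set x : ℕ → ℂ := fun a => ∏ i ∈ Finset.range a, G i with hx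
  have hxs : ∀ a, x (a + 1) = x a * G a := fun a => Finset.prod_range_succ _ _
  have hxX : ∀ a, ‖x a‖ ≤ X a := by
    intro a
    induction a with
    | zero => simp [hx, h.zero_eq]
    | succ a ih =>
      rw [hxs, norm_mul]
      refine (mul_le_mul ih (hGle a) (norm_nonneg _) (h.X_nonneg a)).trans_eq ?_
      rw [mul_div_cancel₀ _ (h.X_pos a).ne']
  refine ⟨G, hG, fun a => ?_⟩
  -- Both `Φ` and the product of the limits solve the recurrence, equal `1` at `0` and are bounded
  -- by `X`, whence the constant `2` for their difference.
  have htail := h.norm_le_tail (D := fun a => Φ a - x a) (C := 2) hB (by simp [hΦ0, hx])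
    (fun a => (norm_sub_le _ _).trans (by linarith [hΦ a, hxX a]))
    (fun a => by
      rw [hxs (a + 1), hxs a]
      linear_combination hrec a - x a * hGrec a)
  have hz : Tendsto (fun n => 2 * (X a - ∑ k ∈ Finset.range n, T k a)) atTop (𝓝 0) := by
    have := (tendsto_const_nhds (x := X a)).sub (h.hasSum a).tendsto_sum_nat
    rw [sub_self] at this
    simpa using this.const_mul 2
  have := ge_of_tendsto' hz fun n => htail n a
  exact sub_eq_zero.1 (norm_le_zero_iff.1 this)

end IsPathSum
end Recurrence

/-! ### Exponential moments of first-passage times as continued fractions -/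

section ContinuedFraction

lemma lintegral_exp_conv_expKernel (r θ : ℝ) (μ : Measure ℝ) [SFinite μ] :
    ∫⁻ t, ENNReal.ofReal (Real.exp (-(θ * t))) ∂(expKernel r ∗ μ) =
      (ENNReal.ofReal (r + θ))⁻¹ * ∫⁻ t, ENNReal.ofReal (Real.exp (-(θ * t))) ∂μ := by
  rw [Measure.lintegral_conv (by fun_prop)]
  have h1 : ∀ h t : ℝ, ENNReal.ofReal (Real.exp (-(θ * (h + t)))) =
      ENNReal.ofReal (Real.exp (-(θ * h))) * ENNReal.ofReal (Real.exp (-(θ * t))) := by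
    intro h t
    rw [← ENNReal.ofReal_mul (Real.exp_pos _).le, ← Real.exp_add]
    congr 2
    ring
  simp only [h1]
  simp only [lintegral_const_mul _ (measurable_ofReal_exp_neg_mul θ)]
  rw [lintegral_mul_const _ (measurable_ofReal_exp_neg_mul θ),
    lintegral_expKernel _ (measurable_ofReal_exp_neg_mul θ)]
  congr 1
  have h2 : ∀ h : ℝ, ENNReal.ofReal (Real.exp (-(r * h))) * ENNReal.ofReal (Real.exp (-(θ * h))) =
      ENNReal.ofReal (Real.exp (-((r + θ) * h))) := by
    intro h
    rw [← ENNReal.ofReal_mul (Real.exp_pos _).le, ← Real.exp_add]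
    congr 2
    ring
  simp only [h2]
  rw [lintegral_exp_neg_mul_Ioi]
  simp

lemma integral_cexp_expKernel {r : ℝ} {s : ℂ} (hs : 0 < r + s.re) :
    ∫ t, Complex.exp (-s * (t : ℂ)) ∂expKernel r = ((r : ℂ) + s)⁻¹ := by
  rw [expKernel, integral_withDensity_eq_integral_toReal_smul (by fun_prop)
    (Eventually.of_forall fun _ => ENNReal.ofReal_lt_top)]
  have h1 : ∀ t : ℝ, (ENNReal.ofReal (Real.exp (-(r * t)))).toReal • Complex.exp (-s * (t : ℂ)) =
      Complex.exp (-((r : ℂ) + s) * (t : ℂ)) := by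
    intro t
    rw [ENNReal.toReal_ofReal (Real.exp_pos _).le, Complex.real_smul, Complex.ofReal_exp,
      ← Complex.exp_add]
    congr 1
    push_cast
    ring
  simp only [h1]
  rw [integral_exp_mul_complex_Ioi (by rw [Complex.neg_re, Complex.add_re, Complex.ofReal_re]; linarith)]
  rw [Complex.ofReal_zero, mul_zero, Complex.exp_zero, neg_div_neg_eq, one_div]

lemma integral_cexp_conv_expKernel {r : ℝ} {s : ℂ} (hs : 0 < r + s.re) (μ : Measure ℝ)
    [SFinite μ] :
    ∫ t, Complex.exp (-s * (t : ℂ)) ∂(expKernel r ∗ μ) =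
      ((r : ℂ) + s)⁻¹ * ∫ t, Complex.exp (-s * (t : ℂ)) ∂μ := by
  rw [Measure.conv, integral_map (by fun_prop)
    (Measurable.aestronglyMeasurable (by fun_prop))]
  have h1 : ∀ z : ℝ × ℝ, Complex.exp (-s * ((z.1 + z.2 : ℝ) : ℂ)) =
      Complex.exp (-s * (z.1 : ℂ)) * Complex.exp (-s * (z.2 : ℂ)) := by
    intro z
    rw [← Complex.exp_add]
    congr 1
    push_cast
    ring
  simp only [h1]
  rw [integral_prod_mul (fun t : ℝ => Complex.exp (-s * (t : ℂ)))
    (fun t : ℝ => Complex.exp (-s * (t : ℂ))), integral_cexp_expKernel hs]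

variable (lam d : ℕ → ℝ≥0)

lemma passageLaw_succ (a : ℕ) :
    passageLaw lam d (a + 1) =
      (lam (a + 1) : ℝ≥0∞) •
        (expKernel ((lam (a + 1) + d (a + 1) : ℝ≥0) : ℝ) ∗ passageLaw lam d (a + 2)) +
      (d (a + 1) : ℝ≥0∞) •
        (expKernel ((lam (a + 1) + d (a + 1) : ℝ≥0) : ℝ) ∗ passageLaw lam d a) := by
  refine Measure.ext_of_lintegral _ fun ψ hψ => ?_
  rw [lintegral_passageLaw_succ lam d a hψ, lintegral_add_measure, lintegral_smul_measure,
    lintegral_smul_measure, Measure.lintegral_conv hψ, Measure.lintegral_conv hψ]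
  rfl

/-- The exponential moment of the first-passage time on the event that it happens at the `n`-th
jump. -/
def expMomentAt (θ : ℝ) (n a : ℕ) : ℝ≥0∞ :=
  ∫⁻ t, ENNReal.ofReal (Real.exp (-(θ * t))) ∂passageLawAt lam d n a

/-- The exponential moment of the first-passage time. -/
def expMoment (θ : ℝ) (a : ℕ) : ℝ≥0∞ :=
  ∫⁻ t, ENNReal.ofReal (Real.exp (-(θ * t))) ∂passageLaw lam d a

lemma expMoment_eq_tsum (θ : ℝ) (a : ℕ) :
    expMoment lam d θ a = ∑' n, expMomentAt lam d θ n a := by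
  rw [expMoment, passageLaw, lintegral_sum_measure]; rfl

lemma expMoment_zero (θ : ℝ) : expMoment lam d θ 0 = 1 := by
  rw [expMoment, passageLaw_zero, lintegral_dirac]; simp

lemma expMomentAt_succ_succ (θ : ℝ) (n a : ℕ) :
    expMomentAt lam d θ (n + 1) (a + 1) =
      (ENNReal.ofReal (((lam (a + 1) + d (a + 1) : ℝ≥0) : ℝ) + θ))⁻¹ *
        (lam (a + 1) * expMomentAt lam d θ n (a + 2) + d (a + 1) * expMomentAt lam d θ n a) := by
  rw [expMomentAt, passageLawAt, lintegral_add_measure, lintegral_smul_measure,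
    lintegral_smul_measure, lintegral_exp_conv_expKernel, lintegral_exp_conv_expKernel]
  simp only [expMomentAt, smul_eq_mul]
  ring

lemma expMoment_succ (θ : ℝ) (a : ℕ) :
    expMoment lam d θ (a + 1) =
      (ENNReal.ofReal (((lam (a + 1) + d (a + 1) : ℝ≥0) : ℝ) + θ))⁻¹ *
        (lam (a + 1) * expMoment lam d θ (a + 2) + d (a + 1) * expMoment lam d θ a) := by
  rw [expMoment, passageLaw_succ, lintegral_add_measure, lintegral_smul_measure,
    lintegral_smul_measure, lintegral_exp_conv_expKernel, lintegral_exp_conv_expKernel]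
  simp only [expMoment, smul_eq_mul]
  ring

variable {lam d}

/-- Ensures that an infinite prefactor in `expMoment_succ` is not multiplied by zero. -/
lemma expMoment_ne_zero (hd : ∀ k, 0 < d (k + 1)) (θ : ℝ) (a : ℕ) : expMoment lam d θ a ≠ 0 := by
  induction a with
  | zero => rw [expMoment_zero]; exact one_ne_zero
  | succ a ih =>
    rw [expMoment_succ]
    refine mul_ne_zero (ENNReal.inv_ne_zero.2 ENNReal.ofReal_ne_top) ?_
    intro h
    rw [add_eq_zero] at h
    exact mul_ne_zero (by exact_mod_cast (hd a).ne') ih h.2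

/-- As the rates are positive, an infinite neighbouring moment or a nonpositive `λ + d + θ` would
make the right side of `expMoment_succ` infinite. -/
lemma expMoment_neighbours_ne_top (hlam : ∀ k, 0 < lam k) (hd : ∀ k, 0 < d (k + 1)) {θ : ℝ} {a : ℕ}
    (h : expMoment lam d θ (a + 1) ≠ ⊤) :
    expMoment lam d θ (a + 2) ≠ ⊤ ∧ expMoment lam d θ a ≠ ⊤ ∧
      0 < ((lam (a + 1) + d (a + 1) : ℝ≥0) : ℝ) + θ := by
  rw [expMoment_succ] at h
  have hd' : (d (a + 1) : ℝ≥0∞) ≠ 0 := by exact_mod_cast (hd a).ne'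
  have hl' : (lam (a + 1) : ℝ≥0∞) ≠ 0 := by exact_mod_cast (hlam (a + 1)).ne'
  have hinv : (ENNReal.ofReal (((lam (a + 1) + d (a + 1) : ℝ≥0) : ℝ) + θ))⁻¹ ≠ 0 :=
    ENNReal.inv_ne_zero.2 ENNReal.ofReal_ne_top
  refine ⟨fun h2 => h ?_, fun h0 => h ?_, ?_⟩
  · rw [h2, ENNReal.mul_top hl', top_add, ENNReal.mul_top hinv]
  · rw [h0, ENNReal.mul_top hd', add_top, ENNReal.mul_top hinv]
  · by_contra hneg
    refine h ?_
    rw [ENNReal.ofReal_of_nonpos (not_lt.1 hneg), ENNReal.inv_zero, ENNReal.top_mul]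
    intro h0
    rw [add_eq_zero] at h0
    exact mul_ne_zero hd' (expMoment_ne_zero hd θ a) h0.2

/-- Finiteness passes between neighbours: down to state `1`, then up to every state. Convergence for
one starting state therefore gives the whole recurrence. -/
lemma expMoment_ne_top (hlam : ∀ k, 0 < lam k) (hd : ∀ k, 0 < d (k + 1)) {θ : ℝ} {a : ℕ}
    (h : expMoment lam d θ (a + 1) ≠ ⊤) (c : ℕ) : expMoment lam d θ c ≠ ⊤ := by
  have h1 : expMoment lam d θ 1 ≠ ⊤ := by
    induction a with
    | zero => exact h
    | succ a ih => exact ih (expMoment_neighbours_ne_top hlam hd h).2.1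
  have h2 : ∀ c, expMoment lam d θ (c + 1) ≠ ⊤ := by
    intro c
    induction c with
    | zero => exact h1
    | succ c ih => exact (expMoment_neighbours_ne_top hlam hd ih).1
  cases c with
  | zero => rw [expMoment_zero]; exact ENNReal.one_ne_top
  | succ c => exact h2 c

/-- The exponent `θ` may be negative; positivity of the coefficients `b` is then a consequence of
finite moments. -/
lemma isPathSum_expMoment (hlam : ∀ k, 0 < lam k) (hd : ∀ k, 0 < d (k + 1)) {θ : ℝ} {a : ℕ}
    (h : expMoment lam d θ (a + 1) ≠ ⊤) :
    IsPathSum (fun i => (lam (i + 1) : ℝ)) (fun i => (d (i + 1) : ℝ))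
      (fun i => (lam (i + 1) : ℝ) + d (i + 1) + θ) (fun n a => (expMomentAt lam d θ n a).toReal)
      (fun a => (expMoment lam d θ a).toReal) := by
  have htop := expMoment_ne_top hlam hd h
  have htop' : ∀ n a, expMomentAt lam d θ n a ≠ ⊤ := fun n a =>
    ne_top_of_le_ne_top (htop a) (by rw [expMoment_eq_tsum]; exact ENNReal.le_tsum n)
  have hb : ∀ i, 0 < (lam (i + 1) : ℝ) + d (i + 1) + θ := fun i => by
    have := (expMoment_neighbours_ne_top hlam hd (htop (i + 1))).2.2
    simpa only [NNReal.coe_add] using this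
  refine ⟨fun i => hlam _, fun i => hd _, hb, fun n a => ENNReal.toReal_nonneg, ?_, ?_, ?_, ?_, ?_⟩
  · simp [expMomentAt, passageLawAt]
  · intro a; simp [expMomentAt, passageLawAt]
  · intro n; simp [expMomentAt, passageLawAt]
  · intro n a
    rw [expMomentAt_succ_succ, ENNReal.toReal_mul, ENNReal.toReal_inv, NNReal.coe_add,
      ENNReal.toReal_ofReal (hb a).le, mul_inv_cancel_left₀ (hb a).ne',
      ENNReal.toReal_add (ENNReal.mul_ne_top ENNReal.coe_ne_top (htop' _ _))
        (ENNReal.mul_ne_top ENNReal.coe_ne_top (htop' _ _)), ENNReal.toReal_mul, ENNReal.toReal_mul]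
    rfl
  · intro a
    have := htop a
    rw [expMoment_eq_tsum] at this
    rw [expMoment_eq_tsum, ENNReal.tsum_toReal_eq fun n => htop' n a]
    exact ENNReal.hasSum_toReal this

lemma integrable_cexp_passageLaw {s : ℂ} {a : ℕ} (h : expMoment lam d s.re a ≠ ⊤) :
    Integrable (fun t : ℝ => Complex.exp (-s * (t : ℂ))) (passageLaw lam d a) := by
  refine ⟨Measurable.aestronglyMeasurable (by fun_prop), ?_⟩
  rw [hasFiniteIntegral_iff_norm]
  simp only [norm_cexp_neg_mul]
  exact lt_top_iff_ne_top.2 h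

lemma norm_integral_cexp_le {s : ℂ} {a : ℕ} :
    ‖∫ t, Complex.exp (-s * (t : ℂ)) ∂passageLaw lam d a‖ ≤ (expMoment lam d s.re a).toReal := by
  refine (norm_integral_le_lintegral_norm _).trans_eq ?_
  simp only [norm_cexp_neg_mul]
  rfl

lemma integral_cexp_passageLaw_succ {s : ℂ} {a : ℕ}
    (h : expMoment lam d s.re (a + 1) ≠ ⊤) (hs : 0 < ((lam (a + 1) + d (a + 1) : ℝ≥0) : ℝ) + s.re) :
    ((lam (a + 1) : ℝ) + (d (a + 1) : ℝ) + s) *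
        ∫ t, Complex.exp (-s * (t : ℂ)) ∂passageLaw lam d (a + 1) =
      ((lam (a + 1) : ℝ) : ℂ) * ∫ t, Complex.exp (-s * (t : ℂ)) ∂passageLaw lam d (a + 2) +
      ((d (a + 1) : ℝ) : ℂ) * ∫ t, Complex.exp (-s * (t : ℂ)) ∂passageLaw lam d a := by
  have hint := integrable_cexp_passageLaw h
  rw [passageLaw_succ, integrable_add_measure] at hint
  have hne : ((lam (a + 1) : ℝ) : ℂ) + (d (a + 1) : ℝ) + s ≠ 0 := by
    intro h0
    have := congrArg Complex.re h0
    simp at this hs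
    linarith
  rw [passageLaw_succ, integral_add_measure hint.1 hint.2, integral_smul_measure,
    integral_smul_measure, integral_cexp_conv_expKernel hs, integral_cexp_conv_expKernel hs]
  simp only [ENNReal.coe_toReal, NNReal.coe_add, Complex.ofReal_add, Complex.real_smul]
  field_simp

lemma laplace_passageDensity_eq_integral (a : ℕ) (s : ℂ) :
    laplace (passageDensity lam d (a + 1)) s =
      ∫ t, Complex.exp (-s * (t : ℂ)) ∂passageLaw lam d (a + 1) := by
  have hm := measurable_passageDensity lam d (a + 1)
  rw [passageLaw_succ_eq_withDensity, integral_withDensity_eq_integral_toReal_smul (by fun_prop)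
    (Eventually.of_forall fun _ => ENNReal.ofReal_lt_top), laplace]
  refine setIntegral_congr_fun measurableSet_Ioi fun t ht => ?_
  rw [ENNReal.toReal_ofReal (passageDensity_nonneg lam d _ ht), Complex.real_smul, mul_comm]

lemma expMoment_ne_top_of_laplaceConverges {a : ℕ} {s : ℂ}
    (h : LaplaceConverges (passageDensity lam d (a + 1)) s) :
    expMoment lam d s.re (a + 1) ≠ ⊤ := by
  have hm := measurable_passageDensity lam d (a + 1)
  have h1 := ((laplaceConverges_iff hm s).1 h).lintegral_lt_top
  rw [expMoment, passageLaw_succ_eq_withDensity,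
    lintegral_withDensity_eq_lintegral_mul _ (by fun_prop) (by fun_prop)]
  refine (lt_of_eq_of_lt (lintegral_congr fun t => ?_) h1).ne
  rw [Pi.mul_apply, mul_comm, ENNReal.ofReal_mul (Real.exp_pos _).le]

/-- The Laplace transform of the first-passage density is a product of continued fractions. -/
theorem exists_hasContFractValue (hlam : ∀ k, 0 < lam k) (hd : ∀ k, 0 < d (k + 1)) {a : ℕ}
    {s : ℂ} (h : LaplaceConverges (passageDensity lam d (a + 1)) s) :
    ∃ K : ℕ → ℂ,
      (∀ j, 1 ≤ j → HasContFractValue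
        (fun k => -((lam (k - 1) : ℝ) : ℂ) * ((d k : ℝ) : ℂ))
        (fun k => ((lam k : ℝ) : ℂ) + ((d k : ℝ) : ℂ) + s) j (K j)) ∧
      laplace (passageDensity lam d (a + 1)) s =
        ∏ j ∈ Finset.Icc 1 (a + 1), (-(1 / ((lam (j - 1) : ℝ) : ℂ)) * K j) := by
  have hmom := expMoment_ne_top_of_laplaceConverges h
  have htop := expMoment_ne_top hlam hd hmom
  obtain ⟨G, hG, hprod⟩ := (isPathSum_expMoment hlam hd hmom).exists_tendsto_approx
    (B := fun i => ((lam (i + 1) : ℝ) : ℂ) + ((d (i + 1) : ℝ) : ℂ) + s)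
    (Φ := fun a => ∫ t, Complex.exp (-s * (t : ℂ)) ∂passageLaw lam d a)
    -- The real part of `B i` is the coefficient `b i` at `Re s`, so its modulus is at least `b i`.
    (fun i => by
      refine le_trans (le_of_eq ?_) (Complex.re_le_norm _)
      simp)
    (by simp only [passageLaw_zero, integral_dirac]; simp)
    (fun a => norm_integral_cexp_le)
    (fun a => integral_cexp_passageLaw_succ (htop (a + 1))
      (expMoment_neighbours_ne_top hlam hd (htop (a + 1))).2.2)
  -- Level `j` of the continued fraction is index `i = j - 1` of the recurrence.
  refine ⟨fun j => -((lam (j - 1) : ℝ) : ℂ) * G (j - 1), fun j hj => ?_, ?_⟩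
  · obtain ⟨i, rfl⟩ := Nat.exists_eq_add_of_le' hj
    rw [HasContFractValue]
    simp only [Nat.add_sub_cancel]
    refine ((hG i).const_mul _).congr fun n => ?_
    rw [GenContFract.convs', zero_add]
    rw [← convs'Aux_eq_ratioApprox _ _ _ (fun k => ((lam k : ℝ) : ℂ)) fun i => rfl]
    congr 2
    funext k
    have h1 : i + 1 + k = i + k + 1 := by ring
    simp only [h1, Nat.add_sub_cancel]
  · rw [laplace_passageDensity_eq_integral]
    refine (hprod (a + 1)).trans ?_
    have hIcc : ∏ j ∈ Finset.Icc 1 (a + 1), G (j - 1) = ∏ i ∈ Finset.range (a + 1), G i := by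
      rw [← Finset.Ico_add_one_right_eq_Icc, Finset.prod_Ico_eq_prod_range]
      simp
    rw [← hIcc]
    refine Finset.prod_congr rfl fun j _ => ?_
    have : ((lam (j - 1) : ℝ) : ℂ) ≠ 0 := by exact_mod_cast (hlam (j - 1)).ne'
    field_simp

end ContinuedFraction

end LimitOrderBook

end

/-! ### Proof of the proposition -/

open LimitOrderBook in
theorem mainTheorem4 {N : ℕ} {𝒳 : Type*} (F : OrderFlow N 𝒳)
    -- the order book process
    {Ω : Type*} [MeasurableSpace Ω] (P : Measure Ω) [IsProbabilityMeasure P]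
    (Q : ℝ≥0 → Ω → Book N) (hQ : IsMarkovJumpProcess P F.bookRate Q)
    -- the initial queue sizes at the best quotes and the initial spread
    (q : Side → ℕ) (hq : ∀ i, 1 ≤ q i) (s₀ : ℕ) (hs₀ : 1 ≤ s₀)
    (hinit : P {ω | HasTop q s₀ (Q 0 ω)} ≠ 0)
    -- `x m` is the factor vector of level `p_B + m`, unchanged as long as the quotes do not move
    (x : ℕ → 𝒳)
    (hx : ∀ b₀ : Book N, HasTop q s₀ b₀ → P {ω | Q 0 ω = b₀} ≠ 0 →
      ∀ b : Book N, b.bestAsk = b₀.bestAsk → b.bestBid = b₀.bestBid →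
        ∀ m ≤ s₀, F.factor b (b.bestBid + m) = x m)
    -- the total rate `Λ` of limit orders inside the spread, the same for both sides
    (Λ : ℝ≥0)
    (hΛask : Λ = ∑ m ∈ Finset.Icc 1 (s₀ - 1), F.limitRate .ask 0 (x (s₀ - m)))
    (hΛbid : Λ = ∑ m ∈ Finset.Icc 1 (s₀ - 1), F.limitRate .bid 0 (x m))
    -- the birth-death queues at the best quotes and their first-passage times to `0`
    {Ω' : Type*} [MeasurableSpace Ω'] (P' : Measure Ω') [IsProbabilityMeasure P']
    (Z : Side → ℝ≥0 → Ω' → ℕ)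
    (hZ : ∀ i, IsMarkovJumpProcess P' (F.quoteRate i (x (quoteOffset s₀ i))) (Z i))
    (hZ0 : ∀ i, ∀ᵐ ω ∂P', Z i 0 ω = q i)
    (σ : Side → Ω' → ℝ≥0∞) (hσ : ∀ i ω, σ i ω = firstTime fun t => Z i t ω = 0)
    (fhat : Side → ℂ → ℂ) (hfhat : ∀ i, fhat i = laplace (density P' (σ i))) :
    -- the first-passage times have densities
    (∀ i, AEMeasurable (σ i) P' ∧ finiteLaw P' (σ i) ≪ volume) ∧
    -- the continued fraction for their Laplace transforms
    (∀ i, ∀ lam d : ℕ → ℝ≥0,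
      (∀ k, lam k = F.limitRate i k (x (quoteOffset s₀ i))) →
      (∀ k, d k = F.marketRate i k (x (quoteOffset s₀ i)) +
        F.cancelRate i k (x (quoteOffset s₀ i))) →
      (∀ k, 0 < lam k) → (∀ k, 1 ≤ k → 0 < d k) →
      ∀ s : ℂ, LaplaceConverges (density P' (σ i)) s →
        ∃ K : ℕ → ℂ,
          (∀ j ∈ Finset.Icc 1 (q i), HasContFractValue
            (fun k => -((lam (k - 1) : ℝ) : ℂ) * ((d k : ℝ) : ℂ))
            (fun k => ((lam k : ℝ) : ℂ) + ((d k : ℝ) : ℂ) + s) j (K j)) ∧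
          fhat i s = ∏ j ∈ Finset.Icc 1 (q i), (-(1 / ((lam (j - 1) : ℝ) : ℂ)) * K j)) ∧
    -- the probability, by Laplace inversion at `0` on any line in the strip of convergence
    (∀ i, ∀ γ : ℝ, 0 < γ →
      (γ < 2 * (Λ : ℝ) ∨
        (2 * (Λ : ℝ) < γ ∧ (∀ᵐ ω ∂P', σ i.other ω < ⊤) ∧
          LaplaceConverges (density P' (σ i.other)) (2 * (Λ : ℝ) - γ : ℝ))) →
      HasInverseLaplaceAt (quoteTransform (fhat i) (fhat i.other) Λ) γ 0
        ((P[|{ω | HasTop q s₀ (Q 0 ω)}]).real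
          {ω | quoteTime i (fun t => Q t ω) < otherTime i (fun t => Q t ω)} : ℂ)) ∧
    -- the case of spread `1`
    (s₀ = 1 → ∀ i, ∀ s : ℂ,
      quoteTransform (fhat i) (fhat i.other) Λ s = 1 / s * fhat i s * fhat i.other (-s)) := by
  have hlaw : ∀ i, AEMeasurable (σ i) P' ∧ finiteLaw P' (σ i) =
      passageLaw (F.quoteBirth i (x (quoteOffset s₀ i))) (F.quoteDeath i (x (quoteOffset s₀ i)))
        (q i) := by
    intro i
    have hσi : σ i = fun ω => firstTime fun t => Z i t ω = 0 := funext (hσ i)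
    rw [hσi]
    exact finiteLaw_firstTime_birthDeath (hZ i) (hZ0 i)
  -- The density exists only from positive states; from `0` the passage law is a point mass.
  have hsucc : ∀ i, ∃ a, q i = a + 1 := fun i => Nat.exists_eq_add_of_le' (hq i)
  choose a ha using hsucc
  have hlaw' : ∀ i, finiteLaw P' (σ i) =
      passageLaw (F.quoteBirth i (x (quoteOffset s₀ i))) (F.quoteDeath i (x (quoteOffset s₀ i)))
        (a i + 1) := fun i => by rw [(hlaw i).2, ha i]
  refine ⟨fun i => ⟨(hlaw i).1, finiteLaw_absolutelyContinuous (hlaw' i)⟩, ?_, ?_, ?_⟩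
  · intro i lam d hlam hd hlam_pos hd_pos s hs
    obtain rfl : lam = F.quoteBirth i (x (quoteOffset s₀ i)) := funext hlam
    obtain rfl : d = F.quoteDeath i (x (quoteOffset s₀ i)) := funext hd
    rw [laplaceConverges_density_iff (hlaw' i)] at hs
    obtain ⟨K, hK, hprod⟩ :=
      exists_hasContFractValue hlam_pos (fun k => hd_pos (k + 1) (Nat.le_add_left 1 k)) hs
    refine ⟨K, fun j hj => hK j (Finset.mem_Icc.1 hj).1, ?_⟩
    rw [hfhat, laplace_density_eq (hlaw' i), ha i]
    exact hprod
  · intro i γ hγ hstrip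
    have hΛ0 : (0 : ℝ) ≤ Λ := Λ.2
    have hconv := laplaceConverges_passageTail (F.quoteBirth i.other (x (quoteOffset s₀ i.other)))
      (F.quoteDeath i.other (x (quoteOffset s₀ i.other))) (a i.other) (r := 2 * (Λ : ℝ) - γ) (by
        rcases hstrip with h | ⟨h, hfin, hc⟩
        · exact Or.inl (sub_pos.2 h)
        · exact Or.inr ⟨sub_neg.2 h, tendsto_passageCDF_one (hlaw' i.other) (hlaw i.other).1 hfin,
            (laplaceConverges_density_iff (hlaw' i.other) _).1 hc⟩)
    have hne : γ ≠ 2 * (Λ : ℝ) := by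
      rcases hstrip with h | h
      · exact h.ne
      · exact h.1.ne'
    rw [F.cond_quoteTime_lt_otherTime hQ hq hs₀ hinit hx hΛask hΛbid i, hfhat, hfhat,
      laplace_density_eq (hlaw' i), laplace_density_eq (hlaw' i.other), ha i, ha i.other]
    · exact hasInverseLaplaceAt_quoteTransform _ _ _ _ (a i) (a i.other) hγ hne hconv.1 hconv.2.1
        hconv.2.2
    · rw [ha i.other]
      -- For `Λ = 0` no positive `γ` lies to the left of `2Λ`, so the second alternative holds and
      -- `σ_j < ∞` gives the tail condition; for `Λ > 0` exponential decay does.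
      rcases hΛ0.eq_or_lt with h0 | h0
      · rcases hstrip with h | ⟨_, hfin, _⟩
        · exact absurd h (by rw [← h0]; linarith)
        · have h1 := tendsto_passageCDF_one (hlaw' i.other) (hlaw i.other).1 hfin
          have h2 := (tendsto_const_nhds (x := (1 : ℝ))).sub h1
          rw [sub_self] at h2
          refine h2.congr fun t => ?_
          rw [← h0]
          simp
      · exact tendsto_exp_neg_mul_bounded (fun t _ => abs_passageTail_le _ _ _ t)
          (mul_pos two_pos h0)
  · rintro rfl i s
    -- With spread `1` there is no level inside the spread and the sum is empty.
    have hΛ0 : Λ = 0 := by simpa using hΛask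
    subst hΛ0
    simp [quoteTransform]
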